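/- Conventions. An algorithm is a randomized algorithm with a step count (here: a program of the language WHILE over binary trees with a coin-flip command, which is polynomially equivalent to probabilistic Turing machines); it solves a task within a given number of steps if, with probability at least $2/3$, it halts within that many steps with a correct output. Let $\mathcal G(n,\tfrac12)$ be the uniform distribution on graphs on $n$ labelled vertices, and let $\mathcal G(n,\tfrac12,\kappa)$ be the distribution of a sample of $\mathcal G(n,\tfrac12)$ to which a clique on $\kappa$ uniformly random vertices is added. Strongish Planted Clique Hypothesis (SPCH). There is a constant $\delta\in(0,\tfrac12)$ such that no algorithm $\mathcal A$ satisfies the following for any function $T(n)=n^{o(\log n)}$: for all sufficiently large $n$, on input $G\sim\mathcal G(n,\tfrac12,\lceil n^\delta\rceil)$, $\mathcal A$ halts within $T(n)$ steps with output $1$ with probability at least $2/3$, and on input $G\sim\mathcal G(n,\tfrac12)$, $\mathcal A$ halts within $T(n)$ steps with an output different from $1$ with probability at least $2/3$. (The probabilities are over $G$ and the coins of $\mathcal A$.) Steiner $k$-Forest. Given an undirected graph $G$ with nonnegative integer edge weights, a set of demand pairs $(s_1,t_1),\dots,(s_\ell,t_\ell)$ of vertices and a positive integer $k$, find a (not necessarily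 induced) subgraph of $G$ of smallest total edge weight that connects at least $k$ of the demand pairs. An instance is feasible if such a subgraph exists; $\mathrm{OPT}$ is then the smallest weight. Corollary. Assume SPCH. Then there is no $f(k)\cdot\mathrm{poly}(n)$-time algorithm, for any function $f$, that approximates Steiner $k$-Forest to within a factor $o(\sqrt k)$. That is, there are no algorithm $\mathcal A$, function $f:\mathbb N\to\mathbb N$, constant $c\in\mathbb N$ and function $g:\mathbb N\to\mathbb R$ with $g(k)=o(\sqrt k)$ such that on every feasible instance, with encoding size $n$ and parameter $k$, with probability at least $2/3$ over its coins, $\mathcal A$ halts within $f(k)\cdot n^c$ steps and outputs a subgraph that connects at least $k$ demand pairs and has weight at most $g(k)\cdot\mathrm{OPT}$. -/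

import Mathlib

/-! ### Randomized algorithms

Programs of Jones' language WHILE over binary trees, extended by a coin-flip command. It is a
reasonable machine model: its unit-cost step count and the running time of (probabilistic) multitape
Turing machines bound each other polynomially. In particular `cons` is charged one
step because trees are stored with sharing, and the only test on trees is the test against `nil`. -/

/-- Binary trees, the data type of the language. -/
inductive BTree : Type
  | nil : BTree
  | cons : BTree → BTree → BTree

namespace BTree

/-- Number of inner nodes. -/
def size : BTree → ℕ
  | nil => 0
  | cons l r => l.size + r.size + 1

def head : BTree → BTree
  | nil => nil
  | cons l _ => l

def tail : BTree → BTree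
  | nil => nil
  | cons _ r => r

def ofBool : Bool → BTree
  | false => nil
  | true => cons nil nil

def ofList : List BTree → BTree
  | [] => nil
  | a :: l => cons a (ofList l)

/-- Unary representation. -/
def ofNat : ℕ → BTree
  | 0 => nil
  | n + 1 => cons nil (ofNat n)

/-- Binary representation, least significant bit first. -/
def ofNatBinary (n : ℕ) : BTree := ofList (n.bits.map ofBool)

/-- An `n × n` array of trees, as the list of its rows. -/
def ofMatrix {n : ℕ} (a : Fin n → Fin n → BTree) : BTree :=
  ofList (List.ofFn fun i => ofList (List.ofFn fun j => a i j))

end BTree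

namespace RandWhile

/-- A memory assigns a tree to each variable; variables are numbered. -/
abbrev Store : Type := ℕ → BTree

inductive Expr : Type
  | var : ℕ → Expr
  | nil : Expr
  | cons : Expr → Expr → Expr
  | head : Expr → Expr
  | tail : Expr → Expr

def Expr.eval (s : Store) : Expr → BTree
  | .var x => s x
  | .nil => BTree.nil
  | .cons a b => BTree.cons (a.eval s) (b.eval s)
  | .head a => (a.eval s).head
  | .tail a => (a.eval s).tail

/-- Programs. The value `nil` counts as false in tests, every other value as true. -/
inductive Program : Type
  | assign : ℕ → Expr → Program
  | flip : ℕ → Program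
  | seq : Program → Program → Program
  | cond : Expr → Program → Program → Program
  | loop : Expr → Program → Program

/-- A configuration: the commands still to be executed, and the memory.
The run has halted when no command is left. -/
abbrev Config : Type := List Program × Store

/-- One step of the computation; `flip x` stores a fair random bit in `x`. -/
noncomputable def step : Config → PMF Config
  | ([], s) => PMF.pure ([], s)
  | (.assign x e :: K, s) => PMF.pure (K, Function.update s x (e.eval s))
  | (.flip x :: K, s) =>
      (PMF.uniformOfFintype Bool).map fun b => (K, Function.update s x (BTree.ofBool b))
  | (.seq P Q :: K, s) => PMF.pure (P :: Q :: K, s)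
  | (.cond e P Q :: K, s) =>
      match e.eval s with
      | .nil => PMF.pure (Q :: K, s)
      | .cons _ _ => PMF.pure (P :: K, s)
  | (.loop e P :: K, s) =>
      match e.eval s with
      | .nil => PMF.pure (K, s)
      | .cons _ _ => PMF.pure (P :: .loop e P :: K, s)

/-- The distribution of the configuration after `t` steps. -/
noncomputable def run : ℕ → Config → PMF Config
  | 0, c => PMF.pure c
  | t + 1, c => (step c).bind (run t)

/-- Initially the input is in variable `0` and all other variables are `nil`. -/
def start (A : Program) (x : BTree) : Config :=
  ([A], fun i => if i = 0 then x else BTree.nil)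

/-- The output (the final value of variable `0`), or `none` if the run has not halted yet. -/
def output : Config → Option BTree
  | ([], s) => some (s 0)
  | (_ :: _, _) => none

/-- The distribution, over the coins of `A`, of what `A` has output on input `x` within `t` steps. -/
noncomputable def outputWithin (A : Program) (t : ℕ) (x : BTree) : PMF (Option BTree) :=
  (run t (start A x)).map output

end RandWhile

/-! ### The Strongish Planted Clique Hypothesis -/

/-- Adjacency matrix of a graph on `n` vertices. -/
noncomputable def encodeGraph {n : ℕ} (G : SimpleGraph (Fin n)) : BTree :=
  open Classical in BTree.ofMatrix fun i j => BTree.ofBool (decide (G.Adj i j))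

/-- The Erdős–Rényi distribution `G(n, 1/2)`: the uniform distribution on graphs on `n` labelled
vertices. -/
noncomputable def erdosRenyiHalf (n : ℕ) : PMF (SimpleGraph (Fin n)) :=
  open Classical in PMF.uniformOfFintype (SimpleGraph (Fin n))

/-- The graph `G` with a clique added on the vertices in `S`. -/
def plantClique {n : ℕ} (G : SimpleGraph (Fin n)) (S : Finset (Fin n)) : SimpleGraph (Fin n) :=
  G ⊔ SimpleGraph.fromRel fun u v => u ∈ S ∧ v ∈ S

/-- A uniformly random set of `κ` vertices (of all vertices if `n < κ`). -/
noncomputable def randomSubset (n κ : ℕ) : PMF (Finset (Fin n)) :=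
  PMF.uniformOfFinset (Finset.powersetCard (min κ n) Finset.univ)
    (Finset.powersetCard_nonempty.2 (by simp))

/-- `G(n, 1/2, κ)`: a sample of `G(n, 1/2)` with a clique planted on `κ` random vertices. -/
noncomputable def plantedClique (n κ : ℕ) : PMF (SimpleGraph (Fin n)) :=
  (erdosRenyiHalf n).bind fun G => (randomSubset n κ).map fun S => plantClique G S

/-- Within `T n` steps, for all large `n`, the randomized algorithm `A` tells `G(n, 1/2, ⌈n ^ δ⌉)`
(answer `1`) from `G(n, 1/2)` (any other answer) with error at most `1/3` on either side. The
probability is over the graph and the coins of `A`; a run that takes longer counts as an error. -/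
def SolvesPlantedClique (δ : ℝ) (A : RandWhile.Program) (T : ℕ → ℕ) : Prop :=
  ∀ᶠ n : ℕ in Filter.atTop,
    2 / 3 ≤ ((plantedClique n ⌈(n : ℝ) ^ δ⌉₊).bind fun G =>
        RandWhile.outputWithin A (T n) (encodeGraph G)).toOuterMeasure
          {o | o = some (BTree.ofBool true)} ∧
    2 / 3 ≤ ((erdosRenyiHalf n).bind fun G =>
        RandWhile.outputWithin A (T n) (encodeGraph G)).toOuterMeasure
          {o | ∃ y, o = some y ∧ y ≠ BTree.ofBool true}

/-- There is `δ ∈ (0, 1/2)` such that no algorithm solves the planted `⌈n ^ δ⌉`-clique problem in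
time `n ^ o(log n)`. -/
def StrongishPlantedCliqueHypothesis : Prop :=
  ∃ δ : ℝ, 0 < δ ∧ δ < 1 / 2 ∧
    ¬ ∃ (A : RandWhile.Program) (e : ℕ → ℝ),
      (e =o[Filter.atTop] fun n : ℕ => Real.log n) ∧
      SolvesPlantedClique δ A fun n => ⌊(n : ℝ) ^ e n⌋₊

/-! ### Steiner k-Forest -/

/-- An instance of Steiner `k`-Forest: a graph with nonnegative integer edge weights, a set of
demand pairs, and a positive integer `k`. Only the weights of edges of the graph matter. -/
structure SteinerForestInstance where
  n : ℕ
  graph : SimpleGraph (Fin n)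
  weight : Sym2 (Fin n) → ℕ
  demands : Finset (Fin n × Fin n)
  k : ℕ
  k_pos : 0 < k

namespace SteinerForestInstance

/-- The input given to an algorithm: `k` in unary, the matrix of edge weights in binary (with `nil`
at non-edges), and the matrix of demand pairs. -/
noncomputable def encode (I : SteinerForestInstance) : BTree :=
  open Classical in
  BTree.cons (BTree.ofNat I.k) (BTree.cons
    (BTree.ofMatrix fun i j =>
      if I.graph.Adj i j then BTree.cons BTree.nil (BTree.ofNatBinary (I.weight s(i, j)))
      else BTree.nil)
    (BTree.ofMatrix fun i j => BTree.ofBool (decide ((i, j) ∈ I.demands))))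

/-- `H` is a subgraph that connects at least `k` demand pairs. -/
def IsSolution (I : SteinerForestInstance) (H : SimpleGraph (Fin I.n)) : Prop :=
  H ≤ I.graph ∧ I.k ≤ {p ∈ (I.demands : Set (Fin I.n × Fin I.n)) | H.Reachable p.1 p.2}.ncard

/-- Total edge weight of a subgraph. -/
noncomputable def cost (I : SteinerForestInstance) (H : SimpleGraph (Fin I.n)) : ℕ :=
  open Classical in ∑ e ∈ H.edgeFinset, I.weight e

def IsFeasible (I : SteinerForestInstance) : Prop := ∃ H, I.IsSolution H

/-- The smallest cost of a solution (meaningful for feasible instances). -/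
noncomputable def opt (I : SteinerForestInstance) : ℕ :=
  sInf {w | ∃ H, I.IsSolution H ∧ I.cost H = w}

end SteinerForestInstance

/-- On every feasible instance, with probability at least `2/3` over its coins, the randomized
algorithm `A` outputs, within `T I` steps, (the adjacency matrix of) a solution of cost at most
`g k` times the optimum. -/
def ApproximatesSteinerForest (A : RandWhile.Program) (T : SteinerForestInstance → ℕ)
    (g : ℕ → ℝ) : Prop :=
  ∀ I : SteinerForestInstance, I.IsFeasible →
    2 / 3 ≤ (RandWhile.outputWithin A (T I) I.encode).toOuterMeasure
      {o | ∃ H, o = some (encodeGraph H) ∧ I.IsSolution H ∧ (I.cost H : ℝ) ≤ g I.k * I.opt}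

/-! Suppose that `A` approximates within `g(k) = o(√k)`. A single program, built from `A`, then
detects planted cliques in time `n^(ε log n)` for every `ε > 0`, which contradicts SPCH.

The reduction. Let `2^b` be the least power of two that is at least `n`; numbers from `n` on count
as isolated vertices. Draw `N = 2^(a b λ)` random tuples of `d λ` numbers below `2^b`. Take a star
with `N` leaves and unit weights, one leaf per tuple, and demand every ordered pair of tuples that
are completely joined in the graph. If there is a large clique, cut it into `q + 1` parts. With
probability at least `3/4` every part contains a whole tuple (`three_quarters_le_hits`), and these
tuples satisfy `k = q (q + 1)` demands at cost `q + 1`. If the graph is random, note that random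
tuples expand (`unif_not_expanding`): by Hall's theorem any `w ≤ b` of them contain disjoint sets of
`λ` vertices. So `k` joined pairs among `w` tuples force `k λ² / 2` edges, and a union bound over
the `2^(a b λ w)` choices of tuples rules this out if `2 d b w ≤ k λ` (`erdosRenyiHalf_witness_le`).
For `λ ≈ ε' b` the gap between the two costs is of order `ε' q`, that is `ε' √k`, and `g` stays
below it for a suitable constant `q`. The time is `N^O(1) = n^(O(ε') log n)`.

Uniformity. The functions `f` and `g` need not be computable, so the program knows neither the
running time of `A` nor `q` nor `λ`. It runs `A` with a clock `N^e`, tries all `q` up to about `log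
log n`, and checks every answer. Because of the check, a random graph is hardly ever accepted,
whatever `A` does (`expect_distK_le`). The value of `λ` is found by self-tests: for `λ = 1, 2, …`
cliques of all relevant sizes are planted into random graphs, and the first `λ` that misses none is
used for the input. A stage whose distinguisher is unreliable on planted cliques is unlikely to pass
(`calK_false_le`), and the stage `λ = ⌈ε' b⌉` almost surely passes (`miss_le`, `calK_true_le`). As
this works for every `ε`, a diagonal argument gives an exponent `o(log n)` (`exists_isLittleO_log`).

The rest of the work is to write the program and to bound its steps. `Sim` is a compositional
statement about output distribution and time, and `value_le_outputWithin` sums up the main program.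
-/

open scoped ENNReal

namespace RandWhile

/-! ### Expectations -/

/-- Expectation of a nonnegative function under a discrete distribution. -/
noncomputable def expect {α : Type*} (μ : PMF α) (φ : α → ℝ≥0∞) : ℝ≥0∞ := ∑' a, μ a * φ a

section Expect

variable {α β : Type*}

theorem expect_mono (μ : PMF α) {φ ψ : α → ℝ≥0∞} (h : ∀ a, φ a ≤ ψ a) :
    expect μ φ ≤ expect μ ψ :=
  ENNReal.tsum_le_tsum fun a => mul_le_mul_right (h a) _

@[simp] theorem expect_pure (a : α) (φ : α → ℝ≥0∞) : expect (PMF.pure a) φ = φ a := by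
  classical
  unfold expect
  rw [tsum_eq_single a]
  · simp
  · intro b hb; simp [PMF.pure_apply, hb]

@[simp] theorem expect_const (μ : PMF α) (c : ℝ≥0∞) : expect μ (fun _ => c) = c := by
  unfold expect
  rw [ENNReal.tsum_mul_right, μ.tsum_coe, one_mul]

theorem expect_bind (μ : PMF α) (κ : α → PMF β) (φ : β → ℝ≥0∞) :
    expect (μ.bind κ) φ = expect μ fun a => expect (κ a) φ := by
  unfold expect
  simp only [PMF.bind_apply, ← ENNReal.tsum_mul_right, ← ENNReal.tsum_mul_left]
  rw [ENNReal.tsum_comm]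
  simp only [mul_assoc]

theorem expect_map (μ : PMF α) (f : α → β) (φ : β → ℝ≥0∞) :
    expect (μ.map f) φ = expect μ fun a => φ (f a) := by
  rw [PMF.map, expect_bind]; simp [Function.comp]

theorem expect_add (μ : PMF α) (φ ψ : α → ℝ≥0∞) :
    expect μ (fun a => φ a + ψ a) = expect μ φ + expect μ ψ := by
  unfold expect; simp only [mul_add]; exact ENNReal.tsum_add

theorem expect_mul_left (μ : PMF α) (c : ℝ≥0∞) (φ : α → ℝ≥0∞) :
    expect μ (fun a => c * φ a) = c * expect μ φ := by
  unfold expect; rw [← ENNReal.tsum_mul_left]; congr 1; ext a; ring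

theorem expect_indicator (μ : PMF α) (S : Set α) :
    expect μ (S.indicator fun _ => 1) = μ.toOuterMeasure S := by
  rw [PMF.toOuterMeasure_apply]; unfold expect
  congr 1; ext a; by_cases h : a ∈ S <;> simp [h]

end Expect

/-! ### Running a program with a time budget -/

/-- Expected value of `Φ`, applied to the remaining time and the memory, when the run from `c` halts
within `T` steps; runs that do not halt in time contribute nothing. -/
noncomputable def ev : ℕ → Config → (ℕ → Store → ℝ≥0∞) → ℝ≥0∞
  | T, ([], s), Φ => Φ T s
  | 0, (_ :: _, _), _ => 0
  | T + 1, (P :: K, s), Φ => expect (step (P :: K, s)) fun c => ev T c Φ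

@[simp] theorem ev_nil (T : ℕ) (s : Store) (Φ) : ev T ([], s) Φ = Φ T s := by
  cases T <;> rfl

@[simp] theorem ev_zero_cons (P : Program) (K : List Program) (s : Store) (Φ) :
    ev 0 (P :: K, s) Φ = 0 := rfl

theorem ev_succ_cons (T : ℕ) (P : Program) (K : List Program) (s : Store) (Φ) :
    ev (T + 1) (P :: K, s) Φ = expect (step (P :: K, s)) fun c => ev T c Φ := rfl

theorem ev_mono {Φ Ψ : ℕ → Store → ℝ≥0∞} (h : ∀ r s, Φ r s ≤ Ψ r s) :
    ∀ (T : ℕ) (c : Config), ev T c Φ ≤ ev T c Ψ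
  | T, ([], s) => by simpa using h T s
  | 0, (_ :: _, _) => by simp
  | T + 1, (P :: K, s) => by
      rw [ev_succ_cons, ev_succ_cons]
      exact expect_mono _ fun c => ev_mono h T c

/-- Spare time does no harm: it only increases the remaining time that is passed to `Φ`. All running
times below are upper bounds, so this is used throughout. -/
theorem ev_le_succ {Φ : ℕ → Store → ℝ≥0∞} (h : ∀ s, Monotone fun r => Φ r s) :
    ∀ (T : ℕ) (c : Config), ev T c Φ ≤ ev (T + 1) c Φ
  | T, ([], s) => by simpa using h s (Nat.le_succ T)
  | 0, (_ :: _, _) => by simp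
  | T + 1, (P :: K, s) => by
      rw [ev_succ_cons, ev_succ_cons]
      exact expect_mono _ fun c => ev_le_succ h T c

theorem ev_monotone {Φ : ℕ → Store → ℝ≥0∞} (h : ∀ s, Monotone fun r => Φ r s) (c : Config) :
    Monotone fun T => ev T c Φ :=
  monotone_nat_of_le_succ fun T => ev_le_succ h T c

section Rules

variable (T : ℕ) (K : List Program) (s : Store) (Φ : ℕ → Store → ℝ≥0∞)

theorem ev_assign (x : ℕ) (e : Expr) :
    ev (T + 1) (.assign x e :: K, s) Φ = ev T (K, Function.update s x (e.eval s)) Φ := by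
  rw [ev_succ_cons, step, expect_pure]

theorem ev_flip (x : ℕ) :
    ev (T + 1) (.flip x :: K, s) Φ = expect (PMF.uniformOfFintype Bool) fun b =>
      ev T (K, Function.update s x (BTree.ofBool b)) Φ := by
  rw [ev_succ_cons, step, expect_map]

theorem ev_seq (P Q : Program) :
    ev (T + 1) (.seq P Q :: K, s) Φ = ev T (P :: Q :: K, s) Φ := by
  rw [ev_succ_cons, step, expect_pure]

theorem ev_cond_nil {e : Expr} (P Q : Program) (h : e.eval s = .nil) :
    ev (T + 1) (.cond e P Q :: K, s) Φ = ev T (Q :: K, s) Φ := by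
  rw [ev_succ_cons, step, h]; simp

theorem ev_cond_cons {e : Expr} (P Q : Program) (h : e.eval s ≠ .nil) :
    ev (T + 1) (.cond e P Q :: K, s) Φ = ev T (P :: K, s) Φ := by
  rw [ev_succ_cons, step]
  cases h' : e.eval s with
  | nil => exact absurd h' h
  | cons a b => simp

theorem ev_loop_nil {e : Expr} (P : Program) (h : e.eval s = .nil) :
    ev (T + 1) (.loop e P :: K, s) Φ = ev T (K, s) Φ := by
  rw [ev_succ_cons, step, h]; simp

theorem ev_loop_cons {e : Expr} (P : Program) (h : e.eval s ≠ .nil) :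
    ev (T + 1) (.loop e P :: K, s) Φ = ev T (P :: .loop e P :: K, s) Φ := by
  rw [ev_succ_cons, step]
  cases h' : e.eval s with
  | nil => exact absurd h' h
  | cons a b => simp

end Rules

/-- Running a stack of commands in two parts. -/
theorem ev_append (L : List Program) (Φ : ℕ → Store → ℝ≥0∞) : ∀ (T : ℕ) (K : List Program)
    (s : Store), ev T (K ++ L, s) Φ = ev T (K, s) fun r s' => ev r (L, s') Φ
  | T, [], s => by simp
  | 0, P :: K, s => by simp
  | T + 1, P :: K, s => by
      have ih := ev_append L Φ T
      rw [List.cons_append]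
      cases P with
      | assign x e => rw [ev_assign, ev_assign, ih]
      | flip x => rw [ev_flip, ev_flip]; simp only [ih]
      | seq P Q => rw [ev_seq, ev_seq, ← ih]; rfl
      | cond e P Q =>
        by_cases h : e.eval s = .nil
        · rw [ev_cond_nil _ _ _ _ _ _ h, ev_cond_nil _ _ _ _ _ _ h, ← ih]; rfl
        · rw [ev_cond_cons _ _ _ _ _ _ h, ev_cond_cons _ _ _ _ _ _ h, ← ih]; rfl
      | loop e P =>
        by_cases h : e.eval s = .nil
        · rw [ev_loop_nil _ _ _ _ _ h, ev_loop_nil _ _ _ _ _ h, ← ih]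
        · rw [ev_loop_cons _ _ _ _ _ h, ev_loop_cons _ _ _ _ _ h, ← ih]; rfl

theorem ev_cons (T : ℕ) (P : Program) (K : List Program) (s : Store) (Φ : ℕ → Store → ℝ≥0∞) :
    ev T (P :: K, s) Φ = ev T ([P], s) fun r s' => ev r (K, s') Φ :=
  ev_append K Φ T [P] s

/-- A run that is not over after `T` steps lies outside the set on the left and contributes `0` to
`ev` on the right. -/
theorem expect_run (S : Set BTree) : ∀ (T : ℕ) (c : Config),
    (run T c).toOuterMeasure {c | ∃ y ∈ S, output c = some y} =
      ev T c fun _ s => S.indicator (fun _ => 1) (s 0)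
  | 0, ([], s) => by
      rw [run, ← expect_indicator, expect_pure]
      by_cases h : s 0 ∈ S <;> simp [h, output]
  | 0, (P :: K, s) => by
      rw [run, ← expect_indicator, expect_pure]
      simp [Set.indicator, output]
  | T + 1, ([], s) => by
      have := expect_run S T ([], s)
      rw [run, step, PMF.pure_bind, this]; simp
  | T + 1, (P :: K, s) => by
      rw [run, ← expect_indicator, expect_bind, ev_succ_cons]
      congr 1; ext c
      rw [expect_indicator, expect_run S T c]

/-- The probability of an output in `S` within `T` steps. -/
theorem outputWithin_apply (A : Program) (T : ℕ) (x : BTree) (S : Set BTree) :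
    (outputWithin A T x).toOuterMeasure {o | ∃ y, o = some y ∧ y ∈ S} =
      ev T (start A x) fun _ s => S.indicator (fun _ => 1) (s 0) := by
  rw [← expect_run, outputWithin, PMF.toOuterMeasure_map_apply]
  congr 1; ext c
  simp only [Set.mem_preimage, Set.mem_ofPred_eq]
  exact ⟨fun ⟨y, h, h'⟩ => ⟨y, h', h⟩, fun ⟨y, h, h'⟩ => ⟨y, h', h⟩⟩

/-! ### Programs that transform the value of variable `0` -/

/-- All variables that the program writes are smaller than this number. -/
def Program.bd : Program → ℕ
  | .assign x _ => x + 1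
  | .flip x => x + 1
  | .seq P Q => max P.bd Q.bd
  | .cond _ P Q => max P.bd Q.bd
  | .loop _ P => P.bd

/-- Started with `x` in variable `0`, the program halts within `T` steps, and then variable `0`
contains `enc a` for a random `a` with distribution `μ`; variables from `P.bd` on are unchanged. -/
def Sim (P : Program) (x : BTree) {α : Type} (μ : PMF α) (enc : α → BTree) (T : ℕ) : Prop :=
  -- Stated for a lower bound `ψ` of an arbitrary continuation `Φ`, so that such statements compose;
  -- `r` is the time left to the continuation.
  ∀ (s : Store) (Φ : ℕ → Store → ℝ≥0∞) (r : ℕ) (ψ : BTree → ℝ≥0∞), s 0 = x →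
    (∀ s, Monotone fun r => Φ r s) →
    (∀ s', (∀ i, P.bd ≤ i → s' i = s i) → ψ (s' 0) ≤ Φ r s') →
    expect μ (fun a => ψ (enc a)) ≤ ev (T + r) ([P], s) Φ

/-- Deterministic version of `Sim`. -/
def Det (P : Program) (x y : BTree) (T : ℕ) : Prop :=
  Sim P x (PMF.pure ()) (fun _ => y) T

/-! ### Composition rules for `Sim` and `Det` -/

section Combinators

variable {α β : Type} {P Q : Program} {x y z : BTree} {μ : PMF α} {enc : α → BTree} {T T' : ℕ}

theorem Sim.mono (h : Sim P x μ enc T) (hT : T ≤ T') : Sim P x μ enc T' := fun s Φ r ψ hs hΦ hψ =>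
  (h s Φ r ψ hs hΦ hψ).trans (ev_monotone hΦ _ (by omega))

theorem Det.mono (h : Det P x y T) (hT : T ≤ T') : Det P x y T' := Sim.mono h hT

/-- The bound `ψ` only sees the tree in variable `0`, so only the distribution of `enc a` matters
and the index type may be changed. -/
theorem Sim.of_eq (h : Sim P x μ enc T) {μ' : PMF β} {enc' : β → BTree}
    (he : μ.map enc = μ'.map enc') : Sim P x μ' enc' T := fun s Φ r ψ hs hΦ hψ => by
  have := h s Φ r ψ hs hΦ hψ
  rwa [← expect_map, he, expect_map] at this

theorem Det.to_sim (h : Det P x y T) (a : α) (ha : enc a = y) : Sim P x (PMF.pure a) enc T :=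
  Sim.of_eq h (by simp [PMF.pure_map, ha])

theorem Sim.seq {κ : α → PMF β} {enc' : β → BTree} (hP : Sim P x μ enc T)
    (hQ : ∀ a, Sim Q (enc a) (κ a) enc' T') :
    Sim (.seq P Q) x (μ.bind κ) enc' (T + T' + 1) := by
  intro s Φ r ψ hs hΦ hψ
  rw [show T + T' + 1 + r = (T + (T' + r)) + 1 by omega, ev_seq, ev_cons, expect_bind]
  -- As `enc` need not be injective, the expected value after `Q` is not a function of the tree. The
  -- supremum over all preimages is, and each preimage can be bounded separately.
  let ψ' : BTree → ℝ≥0∞ := fun y => ⨆ (a : α) (_ : enc a = y), expect (κ a) fun c => ψ (enc' c)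
  refine le_trans (expect_mono _ fun a => ?_)
    (hP s (fun r s' => ev r ([Q], s') Φ) (T' + r) ψ' hs (fun s => ev_monotone hΦ _) ?_)
  · exact le_iSup₂_of_le a rfl le_rfl
  · intro s' hs'
    refine iSup₂_le fun a ha => hQ a s' Φ r ψ ha.symm hΦ fun s'' hs'' => hψ s'' fun i hi => ?_
    simp only [Program.bd, max_le_iff] at hi
    rw [hs'' i hi.2, hs' i hi.1]

theorem Det.seq (hP : Det P x y T) (hQ : Det Q y z T') : Det (.seq P Q) x z (T + T' + 1) :=
  Sim.of_eq (Sim.seq hP (fun _ => hQ)) (by simp)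

theorem Det.seq_sim (hP : Det P x y T) (hQ : Sim Q y μ enc T') :
    Sim (.seq P Q) x μ enc (T + T' + 1) :=
  Sim.of_eq (Sim.seq hP (fun _ => hQ)) (by simp)

theorem Sim.seq_det {enc' : α → BTree} (hP : Sim P x μ enc T)
    (hQ : ∀ a, Det Q (enc a) (enc' a) T') :
    Sim (.seq P Q) x μ enc' (T + T' + 1) :=
  Sim.of_eq (Sim.seq hP (fun a => (hQ a).to_sim a rfl)) (by simp)

/-- The value of an expression that mentions no variable but `0`. -/
def Expr.at (e : Expr) (x : BTree) : BTree := e.eval fun _ => x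

/-- The expression mentions no variable but `0`. -/
def Expr.Closed (e : Expr) : Prop := ∀ s : Store, e.eval s = e.at (s 0)

/-- Apply an expression to variable `0`. -/
def ex (e : Expr) : Program := .assign 0 e

theorem det_ex (e : Expr) (hy : e.at x = y) (he : e.Closed := by exact fun _ => rfl) :
    Det (ex e) x y 1 := by
  intro s Φ r ψ hs hΦ hψ
  rw [expect_pure, add_comm, ex, ev_assign, ev_nil, he s, hs, hy]
  convert hψ (Function.update s 0 y) _ using 1
  · simp
  · intro i hi
    simp only [ex, Program.bd] at hi
    rw [Function.update_of_ne (by omega)]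

/-- Run `P` on the value of `e` and put the result in front of variable `0`. -/
def letc (e : Expr) (P : Program) : Program :=
  .seq (.assign (P.bd + 1) (.var 0)) (.seq (ex e) (.seq P
    (.assign 0 (.cons (.var 0) (.var (P.bd + 1))))))

/-- Variable `P.bd + 1` is beyond everything that `P` writes, so the old value survives the run of
`P`. -/
theorem Sim.letc {e : Expr} (hy : e.at x = y) (h : Sim P y μ enc T)
    (he : e.Closed := by exact fun _ => rfl) :
    Sim (letc e P) x μ (fun a => .cons (enc a) x) (T + 6) := by
  intro s Φ r ψ hs hΦ hψ
  unfold RandWhile.letc ex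
  rw [show T + 6 + r = (T + (r + 1) + 4) + 1 by omega, ev_seq, ev_assign, ev_seq, ev_assign,
    ev_seq, ev_cons, he _]
  set s₁ := Function.update (Function.update s (P.bd + 1) (s 0)) 0
    (e.at (Function.update s (P.bd + 1) (s 0) 0)) with hs₁
  have h0 : s₁ 0 = y := by simp [hs₁, hs, hy]
  have hv : s₁ (P.bd + 1) = x := by simp [hs₁, hs]
  refine h s₁ _ (r + 1) (fun y => ψ (.cons y x)) h0 (fun s => ev_monotone hΦ _) ?_
  intro s' hs'
  rw [ev_assign, ev_nil]
  have hv' : s' (P.bd + 1) = x := by rw [hs' _ (by omega), hv]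
  convert hψ (Function.update s' 0 (Expr.eval s' (.cons (.var 0) (.var (P.bd + 1))))) _ using 1
  · simp [Expr.eval, hv']
  · intro i hi
    simp only [RandWhile.letc, ex, Program.bd] at hi
    rw [Function.update_of_ne (by omega), hs' _ (by omega), hs₁,
      Function.update_of_ne (by omega), Function.update_of_ne (by omega)]

theorem Det.letc {e : Expr} (hy : e.at x = y) (h : Det P y z T)
    (he : e.Closed := by exact fun _ => rfl) : Det (letc e P) x (.cons z x) (T + 6) :=
  Sim.letc hy h he

theorem Sim.cond_true {e : Expr} (hx : e.at x ≠ .nil)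
    (h : Sim P x μ enc T) (he : e.Closed := by exact fun _ => rfl) :
    Sim (.cond e P Q) x μ enc (T + 1) := by
  intro s Φ r ψ hs hΦ hψ
  rw [show T + 1 + r = T + r + 1 by omega, ev_cond_cons _ _ _ _ _ _ (by rwa [he s, hs])]
  refine h s Φ r ψ hs hΦ fun s' hs' => hψ s' fun i hi => hs' i ?_
  simp only [Program.bd] at hi; omega

theorem Sim.cond_false {e : Expr} (hx : e.at x = .nil)
    (h : Sim Q x μ enc T) (he : e.Closed := by exact fun _ => rfl) :
    Sim (.cond e P Q) x μ enc (T + 1) := by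
  intro s Φ r ψ hs hΦ hψ
  rw [show T + 1 + r = T + r + 1 by omega, ev_cond_nil _ _ _ _ _ _ (by rwa [he s, hs])]
  refine h s Φ r ψ hs hΦ fun s' hs' => hψ s' fun i hi => hs' i ?_
  simp only [Program.bd] at hi; omega

/-- Put a random bit in front of variable `0`. -/
def coin : Program := .seq (.flip 1) (ex (.cons (.var 1) (.var 0)))

theorem sim_coin (x : BTree) :
    Sim coin x (PMF.uniformOfFintype Bool) (fun b => .cons (.ofBool b) x) 3 := by
  intro s Φ r ψ hs hΦ hψ
  rw [show 3 + r = r + 3 by omega, coin, ev_seq, ev_flip]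
  refine expect_mono _ fun b => ?_
  rw [ex, ev_assign, ev_nil]
  convert hψ _ _ using 1
  · simp [Expr.eval, hs]
  · intro i hi
    simp only [coin, ex, Program.bd] at hi
    rw [Function.update_of_ne (by omega), Function.update_of_ne (by omega)]

/-- For each element of the list `e`: put it in front of variable `0` and run `P`. -/
def forc (e : Expr) (P : Program) : Program :=
  .seq (.assign (P.bd + 1) e) (.loop (.var (P.bd + 1))
    (.seq (ex (.cons (.head (.var (P.bd + 1))) (.var 0)))
      (.seq P (.assign (P.bd + 1) (.tail (.var (P.bd + 1)))))))

/-- The states between rounds form a Markov chain with kernels `κ`. The proof works with backward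
values `κ' i a`, the expected final `ψ` when round `i` starts in state `a`, and inducts on the
number of rounds that remain. -/
theorem Sim.forc {e : Expr}
    {L : List BTree} {α : ℕ → Type} {enc : ∀ i, α i → BTree} {μ : ∀ i, PMF (α i)}
    {κ : ∀ i, α i → PMF (α (i + 1))} (hx : e.at x = .ofList L)
    (h0 : (μ 0).map (enc 0) = PMF.pure x)
    (hμ : ∀ i < L.length, μ (i + 1) = (μ i).bind (κ i))
    (h : ∀ (i : ℕ) (hi : i < L.length) (a : α i),
      Sim P (.cons L[i] (enc i a)) (κ i a) (enc (i + 1)) T)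
    (he : e.Closed := by exact fun _ => rfl) :
    Sim (forc e P) x (μ L.length) (enc L.length) (L.length * (T + 6) + 3) := by
  intro s Φ r ψ hs hΦ hψ
  unfold RandWhile.forc
  set v := P.bd + 1 with hv
  rw [show L.length * (T + 6) + 3 + r = (L.length * (T + 6) + 1 + r) + 2 by omega, ev_seq,
    ev_assign, he s, hs, hx]
  set W := Program.loop (.var v) (.seq (ex (.cons (.head (.var v)) (.var 0)))
    (.seq P (.assign v (.tail (.var v))))) with hW
  have key : ∀ j, j ≤ L.length → ∀ (a : α (L.length - j)) (s' : Store),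
      s' 0 = enc _ a → s' v = .ofList (L.drop (L.length - j)) → (∀ i, v < i → s' i = s i) →
      ∀ κ' : ∀ i, α i → ℝ≥0∞, (∀ a, κ' L.length a = ψ (enc _ a)) →
      (∀ i < L.length, ∀ a, κ' i a = expect (κ i a) (κ' (i + 1))) →
      κ' _ a ≤ ev (j * (T + 6) + 1 + r) ([W], s') Φ := by
    intro j
    induction j with
    | zero =>
      intro _ a s' h0 hv' hi κ' hκ _
      rw [show 0 * (T + 6) + 1 + r = r + 1 by omega, ev_loop_nil _ _ _ _ _ (by
        simpa [Expr.eval, BTree.ofList] using hv'), ev_nil]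
      have h2 : κ' (L.length - 0) a = ψ (enc (L.length - 0) a) := hκ a
      rw [h2, ← h0]
      refine hψ _ fun i hi' => hi i ?_
      simp only [RandWhile.forc, ex, Program.bd] at hi'; omega
    | succ j ih =>
      intro hj a s' h0 hv' hi κ' hκ hκ'
      have hlt : L.length - (j + 1) < L.length := by omega
      -- The type of states depends on the index, so the truncated difference is replaced by a
      -- variable before rewriting.
      obtain ⟨i₀, hi₀⟩ : ∃ i₀, i₀ = L.length - (j + 1) := ⟨_, rfl⟩
      have hj' : L.length - j = i₀ + 1 := by omega
      rw [hj'] at ih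
      revert a
      rw [← hi₀] at hv' hlt ⊢
      intro a h0
      rw [List.drop_eq_getElem_cons hlt] at hv'
      rw [show (j + 1) * (T + 6) + 1 + r = (T + (j * (T + 6) + 1 + r + 1) + 4) + 1 by ring,
        ev_loop_cons _ _ _ _ _ (by simp [Expr.eval, hv', BTree.ofList]), ev_seq, ex, ev_assign,
        ev_seq, ev_cons, hκ' _ hlt]
      set s₁ := Function.update s' 0 (Expr.eval s' (.cons (.head (.var v)) (.var 0))) with hs₁
      have h10 : s₁ 0 = .cons L[i₀] (enc _ a) := by
        simp [hs₁, Expr.eval, hv', h0, BTree.ofList, BTree.head]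
      let ψ' : BTree → ℝ≥0∞ := fun y => ⨆ (a : α (i₀ + 1)) (_ : enc (i₀ + 1) a = y), κ' (i₀ + 1) a
      refine le_trans (expect_mono _ fun a' => ?_)
        (h i₀ hlt a s₁ _ (j * (T + 6) + 1 + r + 1 + 1) ψ' h10 (fun s => ev_monotone hΦ _) ?_ |>.trans
          (ev_monotone (fun s => ev_monotone hΦ _) _ (by omega)))
      · exact le_iSup₂_of_le a' rfl le_rfl
      · intro s₂ hs₂
        refine iSup₂_le fun a' ha' => ?_
        rw [ev_assign]
        refine (ih (by omega) a' _ ?_ ?_ ?_ κ' hκ hκ').trans (ev_monotone hΦ _ (by omega))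
        · rw [Function.update_of_ne (by omega), ha']
        · rw [Function.update_self]
          simp [Expr.eval, hs₂ v (by omega), hs₁, hv', BTree.ofList, BTree.tail]
        · intro i hi'
          rw [Function.update_of_ne (by omega), hs₂ i (by omega), hs₁,
            Function.update_of_ne (by omega), hi i hi']
  -- Backward recursion: the values are corrected at one index at a time, from the last round down.
  obtain ⟨κ', hκ, hκ'⟩ : ∃ κ' : ∀ i, α i → ℝ≥0∞, (∀ a, κ' L.length a = ψ (enc _ a)) ∧
      (∀ i < L.length, ∀ a, κ' i a = expect (κ i a) (κ' (i + 1))) := by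
    have : ∀ j, ∃ κ' : ∀ i, α i → ℝ≥0∞, (∀ a, κ' L.length a = ψ (enc _ a)) ∧
      (∀ i < L.length, L.length - j ≤ i → ∀ a, κ' i a = expect (κ i a) (κ' (i + 1))) := by
      classical
      intro j
      induction j with
      | zero => exact ⟨fun i a => ψ (enc i a), fun a => rfl, fun i hi hi' => by omega⟩
      | succ j ih =>
        obtain ⟨κ', hκ, hκ'⟩ := ih
        by_cases hj : L.length ≤ j
        · exact ⟨κ', hκ, fun i hi _ => hκ' i hi (by omega)⟩
        refine ⟨fun i => if i = L.length - (j + 1) then fun a => expect (κ i a) (κ' (i + 1))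
          else κ' i, fun a => ?_, fun i hi hi' a => ?_⟩
        · beta_reduce
          rw [if_neg (by omega), hκ]
        · beta_reduce
          by_cases hij : i = L.length - (j + 1)
          · rw [if_pos hij]
            simp only [show i + 1 ≠ L.length - (j + 1) by omega, if_false]
          · rw [if_neg hij, hκ' i hi (by omega)]
            simp only [show i + 1 ≠ L.length - (j + 1) by omega, if_false]
    obtain ⟨κ', h1, h2⟩ := this L.length
    exact ⟨κ', h1, fun i hi => h2 i hi (by omega)⟩
  -- The martingale property of the values, which links the law after the last round with the
  -- initial state.
  have hfold : ∀ i ≤ L.length, expect (μ i) (κ' i) = expect (μ 0) (κ' 0) := by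
    intro i hi
    induction i with
    | zero => rfl
    | succ i ih =>
      rw [← ih (by omega), hμ i (by omega), expect_bind]
      congr 1; ext a; rw [hκ' i (by omega)]
  have e1 : (expect (μ L.length) fun a => ψ (enc L.length a)) = expect (μ 0) (κ' 0) := by
    rw [← hfold _ le_rfl]; congr 1; ext a; rw [hκ]
  rw [e1]
  have hle : ∀ a, enc 0 a = x → κ' 0 a ≤ ev (L.length * (T + 6) + 1 + r)
      ([W], Function.update s v (.ofList L)) Φ := by
    intro a ha
    have := key L.length le_rfl
    rw [Nat.sub_self] at this
    refine this a _ ?_ ?_ ?_ κ' hκ hκ'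
    · rw [Function.update_of_ne (by omega), ha, hs]
    · simp
    · intro i hi; rw [Function.update_of_ne (by omega)]
  calc expect (μ 0) (κ' 0)
      ≤ expect (μ 0) fun a => (fun y => ⨆ (a : α 0) (_ : enc 0 a = y), κ' 0 a) (enc 0 a) :=
        expect_mono _ fun a => le_iSup₂_of_le (f := fun a' _ => κ' 0 a') a rfl le_rfl
    _ = ⨆ (a : α 0) (_ : enc 0 a = x), κ' 0 a := by
        rw [← expect_map (μ 0) (enc 0) (fun y => ⨆ (a : α 0) (_ : enc 0 a = y), κ' 0 a), h0,
          expect_pure]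
    _ ≤ _ := iSup₂_le hle

/-- A loop over a list whose states are known in advance. -/
theorem Det.forc {e : Expr}
    {L : List BTree} {y : ℕ → BTree} (hx : e.at (y 0) = .ofList L)
    (h : ∀ (i : ℕ) (hi : i < L.length), Det P (.cons L[i] (y i)) (y (i + 1)) T)
    (he : e.Closed := by exact fun _ => rfl) :
    Det (forc e P) (y 0) (y L.length) (L.length * (T + 6) + 3) :=
  Sim.forc (α := fun _ => Unit) (enc := fun i _ => y i) (μ := fun _ => PMF.pure ())
    (κ := fun _ _ => PMF.pure ()) hx (by simp [PMF.pure_map]) (by simp) (fun i hi _ => h i hi) he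

/-- Convention for running times: one number `Z` bounds all data and times are powers of `Z`. A loop
over at most `Z` elements raises the exponent by `2`, one for the rounds and one to absorb the
overhead. -/
theorem forc_time {L Z i : ℕ} (hZ : 32 ≤ Z) (hL : L ≤ Z) (hi : i ≠ 0) :
    L * (Z ^ i + 6) + 3 ≤ Z ^ (i + 2) := by
  have h1 : Z ≤ Z ^ i := Nat.le_self_pow hi Z
  have h2 : L * (Z ^ i + 6) ≤ Z * (2 * Z ^ i) := Nat.mul_le_mul hL (by omega)
  have h3 : Z * (32 * Z ^ i) ≤ Z * (Z * Z ^ i) :=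
    Nat.mul_le_mul le_rfl (Nat.mul_le_mul hZ le_rfl)
  have h4 : Z * (Z * Z ^ i) = Z ^ (i + 2) := by ring
  have h5 : 1 * 1 ≤ Z * Z ^ i := Nat.mul_le_mul (by omega) (by omega)
  have h6 : Z * (2 * Z ^ i) = 2 * (Z * Z ^ i) := by ring
  have h7 : Z * (32 * Z ^ i) = 32 * (Z * Z ^ i) := by ring
  omega

/-- Up to `32` copies of a lower power fit into a higher one, which pays for sequential composition
and additive constants. -/
theorem pow_time {Z : ℕ} (hZ : 32 ≤ Z) (i j : ℕ) (hij : i < j := by norm_num) :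
    32 * Z ^ i ≤ Z ^ j ∧ 1 ≤ Z ^ i := by
  refine ⟨le_trans ?_ (Nat.pow_le_pow_right (by omega) hij), Nat.one_le_pow _ _ (by omega)⟩
  rw [pow_succ, mul_comm]; exact Nat.mul_le_mul le_rfl hZ

theorem Det.forc_pow {Z : ℕ} (hZ : 32 ≤ Z) (j k : ℕ) {e : Expr}
    {L : List BTree} (y : ℕ → BTree) (hL : L.length ≤ Z) (hx : e.at (y 0) = .ofList L)
    (h : ∀ (i : ℕ) (hi : i < L.length), Det P (.cons L[i] (y i)) (y (i + 1)) (Z ^ j))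
    (he : e.Closed := by exact fun _ => rfl) (hj : j ≠ 0 := by norm_num)
    (hk : j + 2 = k := by norm_num) :
    Det (RandWhile.forc e P) (y 0) (y L.length) (Z ^ k) :=
  hk ▸ (Det.forc hx h he).mono (forc_time hZ hL hj)

theorem Sim.forc_pow {Z : ℕ} (hZ : 32 ≤ Z) (j k : ℕ) {e : Expr}
    {L : List BTree} {α : ℕ → Type} (enc : ∀ i, α i → BTree) (μ : ∀ i, PMF (α i))
    (κ : ∀ i, α i → PMF (α (i + 1))) (hL : L.length ≤ Z) (hx : e.at x = .ofList L)
    (h0 : (μ 0).map (enc 0) = PMF.pure x)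
    (hμ : ∀ i < L.length, μ (i + 1) = (μ i).bind (κ i))
    (h : ∀ (i : ℕ) (hi : i < L.length) (a : α i),
      Sim P (.cons L[i] (enc i a)) (κ i a) (enc (i + 1)) (Z ^ j))
    (he : e.Closed := by exact fun _ => rfl) (hj : j ≠ 0 := by norm_num)
    (hk : j + 2 = k := by norm_num) :
    Sim (RandWhile.forc e P) x (μ L.length) (enc L.length) (Z ^ k) :=
  hk ▸ (Sim.forc hx h0 hμ h he).mono (forc_time hZ hL hj)

end Combinators

end RandWhile

namespace RandWhile

/-! ### Running a program with a clock -/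

def Expr.vb : Expr → ℕ
  | .var x => x + 1
  | .nil => 0
  | .cons a b => max a.vb b.vb
  | .head a => a.vb
  | .tail a => a.vb

/-- All variables that the program reads or writes are smaller than this number. -/
def Program.vb : Program → ℕ
  | .assign x e => max (x + 1) e.vb
  | .flip x => x + 1
  | .seq P Q => max P.vb Q.vb
  | .cond e P Q => max e.vb (max P.vb Q.vb)
  | .loop e P => max e.vb P.vb

theorem Expr.eval_congr {s s' : Store} : ∀ (e : Expr), (∀ i < e.vb, s i = s' i) →
    e.eval s = e.eval s'
  | .var x, h => h x (by simp [Expr.vb])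
  | .nil, _ => rfl
  | .cons a b, h => by
      simp only [Expr.vb, lt_max_iff] at h
      simp only [Expr.eval, Expr.eval_congr a fun i hi => h i (.inl hi),
        Expr.eval_congr b fun i hi => h i (.inr hi)]
  | .head a, h => by simp only [Expr.eval, Expr.eval_congr a h]
  | .tail a, h => by simp only [Expr.eval, Expr.eval_congr a h]

/-- At most `n` rounds of a loop; each round consumes one tick of the clock `z`. -/
noncomputable def fuelLoop (e : Expr) (body : ℕ → Store → PMF (ℕ × Store)) :
    ℕ → ℕ → Store → PMF (ℕ × Store)
  | n + 1, z + 1, s =>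
      open Classical in
      if e.eval s = .nil then PMF.pure (z + 1, s)
      else (body z s).bind fun p => fuelLoop e body n p.1 p.2
  | _, z, s => PMF.pure (z, s)

/-- Semantics of a program with a clock that is decreased in each round of a loop; loops end when
the clock has run out. -/
noncomputable def den : Program → ℕ → Store → PMF (ℕ × Store)
  | .assign x e, z, s => PMF.pure (z, Function.update s x (e.eval s))
  | .flip x, z, s =>
      (PMF.uniformOfFintype Bool).map fun b => (z, Function.update s x (BTree.ofBool b))
  | .seq P Q, z, s => (den P z s).bind fun p => den Q p.1 p.2
  | .cond e P Q, z, s => open Classical in if e.eval s = .nil then den Q z s else den P z s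
  | .loop e P, z, s => fuelLoop e (den P) z z s

theorem fuelLoop_zero_left (e : Expr) (body) (z : ℕ) (s : Store) :
    fuelLoop e body 0 z s = PMF.pure (z, s) := by simp [fuelLoop]

theorem fuelLoop_zero_right (e : Expr) (body) (n : ℕ) (s : Store) :
    fuelLoop e body n 0 s = PMF.pure (0, s) := by cases n <;> simp [fuelLoop]

theorem fuelLoop_nil {e : Expr} (body) (n z : ℕ) {s : Store} (h : e.eval s = .nil) :
    fuelLoop e body n z s = PMF.pure (z, s) := by
  cases n <;> cases z <;> simp [fuelLoop, h]

theorem fuelLoop_cons {e : Expr} (body) (n z : ℕ) {s : Store} (h : e.eval s ≠ .nil) :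
    fuelLoop e body (n + 1) (z + 1) s = (body z s).bind fun p => fuelLoop e body n p.1 p.2 := by
  simp [fuelLoop, h]

theorem fuelLoop_le {e : Expr} {body} (hb : ∀ z s, ∀ p ∈ (body z s).support, p.1 ≤ z) :
    ∀ (n z : ℕ) (s : Store), ∀ p ∈ (fuelLoop e body n z s).support, p.1 ≤ z
  | 0, z, s, p, hp => by
      rw [fuelLoop_zero_left, PMF.mem_support_pure_iff] at hp; rw [hp]
  | n + 1, 0, s, p, hp => by
      rw [fuelLoop_zero_right, PMF.mem_support_pure_iff] at hp; rw [hp]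
  | n + 1, z + 1, s, p, hp => by
      by_cases h : e.eval s = .nil
      · rw [fuelLoop_nil _ _ _ h, PMF.mem_support_pure_iff] at hp; rw [hp]
      · rw [fuelLoop_cons _ _ _ h, PMF.mem_support_bind_iff] at hp
        obtain ⟨p', hp', hp⟩ := hp
        have := hb _ _ _ hp'
        have := fuelLoop_le hb _ _ _ _ hp
        omega

/-- The clock only goes down, and each round of a loop takes at least one tick. Hence the separate
round counter of `fuelLoop`, which starts at the clock value and exists for the recursion, never
ends a loop before the clock does. -/
theorem den_le : ∀ (P : Program) (z : ℕ) (s : Store), ∀ p ∈ (den P z s).support, p.1 ≤ z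
  | .assign x e, z, s, p, hp => by
      rw [den, PMF.mem_support_pure_iff] at hp; rw [hp]
  | .flip x, z, s, p, hp => by
      rw [den, PMF.mem_support_map_iff] at hp; obtain ⟨b, -, rfl⟩ := hp; rfl
  | .seq P Q, z, s, p, hp => by
      rw [den, PMF.mem_support_bind_iff] at hp
      obtain ⟨p', hp', hp⟩ := hp
      exact (den_le Q _ _ _ hp).trans (den_le P _ _ _ hp')
  | .cond e P Q, z, s, p, hp => by
      rw [den] at hp
      split_ifs at hp
      · exact den_le Q _ _ _ hp
      · exact den_le P _ _ _ hp
  | .loop e P, z, s, p, hp => fuelLoop_le (fun z s => den_le P z s) _ _ _ _ hp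

theorem expect_mono_support {α : Type*} (μ : PMF α) {φ ψ : α → ℝ≥0∞}
    (h : ∀ a ∈ μ.support, φ a ≤ ψ a) : expect μ φ ≤ expect μ ψ := by
  refine ENNReal.tsum_le_tsum fun a => ?_
  by_cases ha : μ a = 0
  · simp [ha]
  · exact mul_le_mul_right (h a ((PMF.mem_support_iff _ _).2 ha)) _

/-- A run of at most `z` steps is not disturbed by a clock that starts at `z`. -/
theorem ev_le_den {Φ : ℕ → Store → ℝ≥0∞} (hΦ : ∀ s, Monotone fun r => Φ r s) (P : Program) :
    ∀ (z : ℕ) (s : Store), ev z ([P], s) Φ ≤ expect (den P z s) fun p => Φ p.1 p.2 := by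
  -- Every step uses a unit of time but only rounds of loops use a tick, so the clock stays at least
  -- as large as the remaining time.
  induction P generalizing Φ with
  | assign x e =>
    intro z s
    cases z with
    | zero => simp
    | succ z => rw [ev_assign, ev_nil, den, expect_pure]; exact hΦ _ (Nat.le_succ z)
  | flip x =>
    intro z s
    cases z with
    | zero => simp
    | succ z =>
      rw [ev_flip, den, expect_map]
      exact expect_mono _ fun b => by rw [ev_nil]; exact hΦ _ (Nat.le_succ z)
  | seq P Q ihP ihQ =>
    intro z s
    cases z with
    | zero => simp
    | succ z =>
      rw [ev_seq, ev_cons]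
      refine (ev_monotone (fun s => ev_monotone hΦ _) _ (Nat.le_succ z)).trans ?_
      refine (ihP (fun s => ev_monotone hΦ _) _ _).trans ?_
      rw [den, expect_bind]
      exact expect_mono _ fun p => ihQ hΦ _ _
  | cond e P Q ihP ihQ =>
    intro z s
    cases z with
    | zero => simp
    | succ z =>
      by_cases h : e.eval s = .nil
      · rw [ev_cond_nil _ _ _ _ _ _ h, den, if_pos h]
        exact (ev_monotone hΦ _ (Nat.le_succ z)).trans (ihQ hΦ _ _)
      · rw [ev_cond_cons _ _ _ _ _ _ h, den, if_neg h]
        exact (ev_monotone hΦ _ (Nat.le_succ z)).trans (ihP hΦ _ _)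
  | loop e P ih =>
    -- The round counter is any `n ≥ z`, since one run of the body may use up more than one unit of
    -- `z`.
    have key : ∀ n z s, z ≤ n → ev z ([.loop e P], s) Φ ≤
        expect (fuelLoop e (den P) n z s) fun p => Φ p.1 p.2 := by
      intro n
      induction n with
      | zero => intro z s hz; obtain rfl : z = 0 := by omega
                simp
      | succ n ihn =>
        intro z s hz
        cases z with
        | zero => simp
        | succ z =>
          by_cases h : e.eval s = .nil
          · rw [ev_loop_nil _ _ _ _ _ h, fuelLoop_nil _ _ _ h, ev_nil, expect_pure]
            exact hΦ _ (Nat.le_succ z)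
          · rw [ev_loop_cons _ _ _ _ _ h, fuelLoop_cons _ _ _ h, ev_cons, expect_bind]
            refine (ih (fun s => ev_monotone hΦ _) _ _).trans ?_
            refine expect_mono_support _ fun p hp => ihn _ _ ?_
            have := den_le P _ _ p hp
            omega
    intro z s
    exact key z z s le_rfl

/-- Set the flag `t + 1` of a loop with condition `e` according to `e` and the clock `t`. -/
def clockTest (t : ℕ) (e : Expr) : Program :=
  .cond (.var t) (.assign (t + 1) e) (.assign (t + 1) .nil)

/-- The program with a clock in variable `t`. -/
def clocked (t : ℕ) : Program → Program
  | .assign x e => .assign x e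
  | .flip x => .flip x
  | .seq P Q => .seq (clocked t P) (clocked t Q)
  | .cond e P Q => .cond e (clocked t P) (clocked t Q)
  | .loop e P => .seq (clockTest t e) (.loop (.var (t + 1))
      (.seq (.assign t (.tail (.var t))) (.seq (clocked t P) (clockTest t e))))

def Program.cost : Program → ℕ
  | .assign _ _ => 1
  | .flip _ => 1
  | .seq P Q => P.cost + Q.cost + 1
  | .cond _ P Q => P.cost + Q.cost + 1
  | .loop _ P => P.cost + 6

/-- The memory `σ` contains `s` below `t` and the clock `z` in variable `t`. -/
def ClockRel (t z : ℕ) (s σ : Store) : Prop := (∀ i < t, σ i = s i) ∧ σ t = .ofNat z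

theorem ClockRel.update {t z : ℕ} {s σ : Store} (h : ClockRel t z s σ) {x : ℕ} (hx : x < t)
    (v : BTree) : ClockRel t z (Function.update s x v) (Function.update σ x v) := by
  refine ⟨fun i hi => ?_, by rw [Function.update_of_ne (by omega), h.2]⟩
  by_cases hix : i = x
  · subst hix; simp
  · rw [Function.update_of_ne hix, Function.update_of_ne hix, h.1 i hi]

theorem ClockRel.eval {t z : ℕ} {s σ : Store} (h : ClockRel t z s σ) {e : Expr} (he : e.vb ≤ t) :
    e.eval σ = e.eval s := Expr.eval_congr e fun i hi => h.1 i (by omega)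

theorem ev_clockTest {t z : ℕ} {s σ : Store} (h : ClockRel t z s σ) {e : Expr} (he : e.vb ≤ t)
    (T : ℕ) (K : List Program) (Φ : ℕ → Store → ℝ≥0∞) :
    ev (T + 2) (clockTest t e :: K, σ) Φ =
      ev T (K, Function.update σ (t + 1) (if z = 0 then .nil else e.eval s)) Φ := by
  unfold clockTest
  cases z with
  | zero => rw [ev_cond_nil _ _ _ _ _ _ (by simpa [Expr.eval, BTree.ofNat] using h.2), ev_assign]
            simp [Expr.eval]
  | succ z =>
    rw [ev_cond_cons _ _ _ _ _ _ (by simp [Expr.eval, h.2, BTree.ofNat]), ev_assign, h.eval he]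
    simp

theorem ClockRel.update_flag {t z : ℕ} {s σ : Store} (h : ClockRel t z s σ) (v : BTree) :
    ClockRel t z s (Function.update σ (t + 1) v) :=
  ⟨fun i hi => by rw [Function.update_of_ne (by omega), h.1 i hi],
    by rw [Function.update_of_ne (by omega), h.2]⟩

theorem ClockRel.tick {t z : ℕ} {s σ : Store} (h : ClockRel t (z + 1) s σ) :
    ClockRel t z s (Function.update σ t (Expr.eval σ (.tail (.var t)))) :=
  ⟨fun i hi => by rw [Function.update_of_ne (by omega), h.1 i hi],
    by simp [Expr.eval, h.2, BTree.ofNat, BTree.tail]⟩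

/-- Amortized running time: a tick of the clock is worth `C` steps and pays for a round of any loop,
while `P.cost` pays for what happens outside the rounds. One `C`, the cost of the whole program,
serves all subprograms. -/
theorem den_le_ev_clocked {t C : ℕ} (P : Program) (hP : P.vb ≤ t) (hC : P.cost ≤ C) :
    ∀ (z : ℕ) (s σ : Store) (Φ : ℕ → Store → ℝ≥0∞) (r : ℕ) (ψ : ℕ × Store → ℝ≥0∞),
      ClockRel t z s σ → (∀ s, Monotone fun r => Φ r s) →
      (∀ z' s' σ', ClockRel t z' s' σ' → (∀ i, t + 1 < i → σ' i = σ i) →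
        ψ (z', s') ≤ Φ (C * z' + r) σ') →
      expect (den P z s) ψ ≤ ev (P.cost + C * z + r) ([clocked t P], σ) Φ := by
  induction P with
  | assign x e =>
    intro z s σ Φ r ψ h hΦ hψ
    simp only [Program.vb, max_le_iff] at hP
    rw [den, expect_pure, Program.cost, show 1 + C * z + r = C * z + r + 1 by omega, clocked,
      ev_assign, ev_nil, h.eval hP.2]
    refine hψ _ _ _ (h.update (by omega) _) fun i hi => ?_
    rw [Function.update_of_ne (by omega)]
  | flip x =>
    intro z s σ Φ r ψ h hΦ hψ
    simp only [Program.vb] at hP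
    rw [den, expect_map, Program.cost, show 1 + C * z + r = C * z + r + 1 by omega, clocked,
      ev_flip]
    refine expect_mono _ fun b => ?_
    rw [ev_nil]
    refine hψ _ _ _ (h.update (by omega) _) fun i hi => ?_
    rw [Function.update_of_ne (by omega)]
  | seq P Q ihP ihQ =>
    intro z s σ Φ r ψ h hΦ hψ
    simp only [Program.vb, max_le_iff] at hP
    simp only [Program.cost] at hC
    rw [den, expect_bind, Program.cost, clocked,
      show P.cost + Q.cost + 1 + C * z + r = (P.cost + C * z + (Q.cost + r)) + 1 by omega, ev_seq,
      ev_cons]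
    refine ihP hP.1 (by omega) z s σ _ _ _ h (fun s => ev_monotone hΦ _) fun z' s' σ' h' hσ' => ?_
    rw [show C * z' + (Q.cost + r) = Q.cost + C * z' + r by omega]
    exact ihQ hP.2 (by omega) z' s' σ' Φ r ψ h' hΦ fun z'' s'' σ'' h'' hσ'' =>
      hψ z'' s'' σ'' h'' fun i hi => by rw [hσ'' i hi, hσ' i hi]
  | cond e P Q ihP ihQ =>
    intro z s σ Φ r ψ h hΦ hψ
    simp only [Program.vb, max_le_iff] at hP
    simp only [Program.cost] at hC
    rw [den, Program.cost, clocked,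
      show P.cost + Q.cost + 1 + C * z + r = (P.cost + Q.cost + C * z + r) + 1 by omega]
    by_cases he : e.eval s = .nil
    · rw [if_pos he, ev_cond_nil _ _ _ _ _ _ (by rw [h.eval hP.1, he])]
      exact (ihQ hP.2.2 (by omega) z s σ Φ r ψ h hΦ hψ).trans (ev_monotone hΦ _ (by omega))
    · rw [if_neg he, ev_cond_cons _ _ _ _ _ _ (by rwa [h.eval hP.1])]
      exact (ihP hP.2.1 (by omega) z s σ Φ r ψ h hΦ hψ).trans (ev_monotone hΦ _ (by omega))
  | loop e P ih =>
    intro z s σ Φ r ψ h hΦ hψ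
    simp only [Program.vb, max_le_iff] at hP
    simp only [Program.cost] at hC
    -- Invariant of the clocked loop: the flag is nonempty exactly if the clock has not run out and
    -- the condition holds. Nested loops share the flag, so it is set anew after each run of the
    -- body.
    have key : ∀ n z s σ', z ≤ n → ClockRel t z s σ' → (∀ i, t + 1 < i → σ' i = σ i) →
        σ' (t + 1) = (if z = 0 then .nil else e.eval s) →
        expect (fuelLoop e (den P) n z s) ψ ≤ ev (1 + C * z + r) ([.loop (.var (t + 1))
          (.seq (.assign t (.tail (.var t))) (.seq (clocked t P) (clockTest t e)))], σ') Φ := by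
      intro n
      induction n with
      | zero =>
        intro z s σ' hz h' hσ' hf
        obtain rfl : z = 0 := by omega
        rw [fuelLoop_zero_left, expect_pure, show 1 + C * 0 + r = C * 0 + r + 1 by omega,
          ev_loop_nil _ _ _ _ _ (by simpa [Expr.eval] using hf), ev_nil]
        exact hψ _ _ _ h' hσ'
      | succ n ihn =>
        intro z s σ' hz h' hσ' hf
        by_cases h0 : z = 0 ∨ e.eval s = .nil
        · have : fuelLoop e (den P) (n + 1) z s = PMF.pure (z, s) := by
            rcases h0 with rfl | h0
            · exact fuelLoop_zero_right _ _ _ _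
            · exact fuelLoop_nil _ _ _ h0
          rw [this, expect_pure, show 1 + C * z + r = C * z + r + 1 by omega,
            ev_loop_nil _ _ _ _ _ (by
              rw [Expr.eval, hf]; rcases h0 with h0 | h0 <;> simp [h0]), ev_nil]
          exact hψ _ _ _ h' hσ'
        · push Not at h0
          obtain ⟨z, rfl⟩ := Nat.exists_eq_succ_of_ne_zero h0.1
          rw [fuelLoop_cons _ _ _ h0.2, expect_bind]
          refine le_trans ?_ (ev_monotone hΦ _
            (show (P.cost + C * z + (3 + r) + 3) + 1 ≤ 1 + C * (z + 1) + r by rw [mul_add]; omega))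
          beta_reduce
          rw [ev_loop_cons _ _ _ _ _ (by rw [Expr.eval, hf]; simp [h0.2]), ev_seq, ev_assign,
            ev_seq, ev_cons]
          -- The induction hypothesis needs `p.1 ≤ n`. This holds on the support by `den_le`;
          -- elsewhere the value is cut to `0`.
          refine le_trans (expect_mono_support (ψ := fun p => if p.1 ≤ n then
            expect (fuelLoop e (den P) n p.1 p.2) ψ else 0) _ fun p hp => ?_)
            (ih hP.2 (by omega) z s _ _ _ _ h'.tick (fun s => ev_monotone hΦ _) ?_)
          · have := den_le P _ _ p hp
            rw [if_pos (by omega)]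
          intro z' s' σ'' h'' hσ''
          rw [show C * z' + (3 + r) = 1 + C * z' + r + 2 by omega, ev_clockTest h'' hP.1]
          by_cases hz' : z' ≤ n
          · rw [if_pos hz']
            refine ihn z' s' _ hz' (h''.update_flag _) (fun i hi => ?_) (by simp)
            rw [Function.update_of_ne (by omega), hσ'' i hi, Function.update_of_ne (by omega),
              hσ' i hi]
          · rw [if_neg hz']; exact zero_le
    rw [den, Program.cost, clocked]
    refine le_trans ?_ (ev_monotone hΦ _
      (show (1 + C * z + r + 2) + 1 ≤ P.cost + 6 + C * z + r by omega))
    beta_reduce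
    rw [ev_seq, ev_clockTest h hP.1]
    exact key z z s _ le_rfl (h.update_flag _)
      (fun i hi => by rw [Function.update_of_ne (by omega)]) (by simp)

/-- Clear the variables `1, …, n`. -/
def clearVars : ℕ → Program
  | 0 => ex (.var 0)
  | n + 1 => .seq (clearVars n) (.assign (n + 1) .nil)

theorem ev_clearVars (Φ : ℕ → Store → ℝ≥0∞) : ∀ (n T : ℕ) (K : List Program) (s : Store),
    ev (T + (2 * n + 1)) (clearVars n :: K, s) Φ =
      ev T (K, fun i => if 0 < i ∧ i ≤ n then .nil else s i) Φ
  | 0, T, K, s => by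
      rw [clearVars, ex, mul_zero, zero_add, ev_assign]
      congr 2; ext i; rw [if_neg (by omega)]; simp [Expr.eval]
  | n + 1, T, K, s => by
      rw [clearVars, show T + (2 * (n + 1) + 1) = T + 1 + (2 * n + 1) + 1 by ring, ev_seq,
        ev_clearVars Φ n, ev_assign]
      congr 2; ext i
      by_cases h : i = n + 1
      · subst h; simp [Expr.eval]
      · rw [Function.update_of_ne h]
        congr 1; apply propext; omega

/-- Run `A` on the tail of the input; its head is the clock. -/
def timed (A : Program) : Program :=
  .seq (.assign (A.vb + 1) (.head (.var 0))) (.seq (ex (.tail (.var 0)))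
    (.seq (.assign (A.vb + 2) .nil) (.seq (clearVars A.vb) (clocked (A.vb + 1) A))))

/-- The output distribution of `A` on input `x`, with a clock that starts at `z`. -/
noncomputable def outDist (A : Program) (z : ℕ) (x : BTree) : PMF BTree :=
  (den A z fun i => if i = 0 then x else .nil).map fun p => p.2 0

/-- The time bound of `A` need not be computable: any clock value that is at least as large
preserves the guarantee. -/
theorem outputWithin_le_outDist (A : Program) {T z : ℕ} (hT : T ≤ z) (x : BTree) (S : Set BTree) :
    (outputWithin A T x).toOuterMeasure {o | ∃ y, o = some y ∧ y ∈ S} ≤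
      (outDist A z x).toOuterMeasure S := by
  have hΦ : ∀ s : Store, Monotone fun _ : ℕ => S.indicator (fun _ => (1 : ℝ≥0∞)) (s 0) :=
    fun s => monotone_const
  rw [outputWithin_apply, outDist, ← expect_indicator, expect_map]
  exact (ev_monotone hΦ _ hT).trans (ev_le_den hΦ A z _)

/-- `Sim` allows arbitrary contents of the other variables while `outDist` starts from an empty
memory, hence `clearVars`. Clock and flag sit above all variables of `A`. -/
theorem sim_timed (A : Program) (z : ℕ) (x : BTree) :
    Sim (timed A) (.cons (.ofNat z) x) (outDist A z x) id
      ((A.cost + 2 * A.vb + 10) * (z + 1)) := by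
  intro s Φ r ψ hs hΦ hψ
  have hT : A.cost + A.cost * z + r + (2 * A.vb + 1) + 1 + 1 + 1 + 1 + 1 + 1 + 1 ≤
      (A.cost + 2 * A.vb + 10) * (z + 1) + r := by
    have : A.cost * (z + 1) + (2 * A.vb + 10) * 1 ≤ (A.cost + 2 * A.vb + 10) * (z + 1) := by
      nlinarith [Nat.zero_le ((2 * A.vb + 10) * z)]
    rw [mul_add] at this; omega
  refine le_trans ?_ (ev_monotone hΦ _ hT)
  beta_reduce
  rw [timed, ev_seq, ev_assign, ev_seq, ex, ev_assign, ev_seq, ev_assign, ev_seq, ev_clearVars,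
    outDist, expect_map]
  refine den_le_ev_clocked A (by omega) le_rfl z _ _ Φ r _ ⟨fun i hi => ?_, ?_⟩ hΦ ?_
  · by_cases h0 : i = 0
    · subst h0; simp [Expr.eval, hs, BTree.tail]
    · beta_reduce
      rw [if_pos (by omega), if_neg h0]
  · beta_reduce
    rw [if_neg (by omega), Function.update_of_ne (by omega), Function.update_of_ne (by omega)]
    simp [Expr.eval, hs, BTree.head]
  · intro z' s' σ' h hσ'
    refine le_trans ?_ (hΦ σ' (show r ≤ A.cost * z' + r by omega))
    have h0 := h.1 0 (by omega)
    change ψ (s' 0) ≤ _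
    rw [← h0]
    refine hψ σ' fun i hi => ?_
    -- This is the purpose of assigning `nil` to the flag in `timed`: it makes `Program.bd` exceed
    -- the flag even if `A` contains no loop.
    have hi' : A.vb + 2 < i := by
      simp only [timed, ex, Program.bd] at hi; omega
    rw [hσ' i (by omega), if_neg (by omega), Function.update_of_ne (by omega),
      Function.update_of_ne (by omega), Function.update_of_ne (by omega)]

end RandWhile

/-! ### Unary numbers as lists -/

theorem BTree.ofNat_eq_ofList (n : ℕ) : ofNat n = ofList (List.replicate n nil) := by
  induction n with
  | zero => rfl
  | succ n ih => rw [ofNat, ih]; rfl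

@[simp] theorem BTree.tail_ofNat (n : ℕ) : (ofNat n).tail = ofNat (n - 1) := by
  cases n <;> rfl

theorem BTree.ofNat_eq_nil {n : ℕ} : ofNat n = nil ↔ n = 0 := by
  cases n <;> simp [ofNat]

namespace RandWhile

/-! ### Arithmetic in unary -/

abbrev X : Expr := .var 0

/-- A numeral. -/
def lit : ℕ → Expr
  | 0 => .nil
  | n + 1 => .cons .nil (lit n)

@[simp] theorem eval_lit (n : ℕ) (s : Store) : (lit n).eval s = .ofNat n := by
  induction n with
  | zero => rfl
  | succ n ih => simp [lit, Expr.eval, ih, BTree.ofNat]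

/-- `(a, b) ↦ a - b` -/
def subP : Program := .seq (forc X.tail (ex (.cons X.tail.head.tail X.tail.tail))) (ex X.head)

theorem det_sub {Z : ℕ} (hZ : 32 ≤ Z) {a b : ℕ} (hb : b ≤ Z) :
    Det subP (.cons (.ofNat a) (.ofNat b)) (.ofNat (a - b)) (Z ^ 4) := by
  have h := Det.forc_pow hZ 1 3 (e := X.tail)
    (P := ex (.cons X.tail.head.tail X.tail.tail)) (L := List.replicate b .nil)
    (fun i => .cons (.ofNat (a - i)) (.ofNat b)) (by simpa) (BTree.ofNat_eq_ofList b)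
    (fun i hi => (det_ex _ (by
      change BTree.cons (BTree.ofNat (a - i)).tail (.ofNat b) = _
      rw [BTree.tail_ofNat, Nat.sub_sub])).mono (by simp; omega))
  rw [List.length_replicate] at h
  refine (h.seq (det_ex X.head rfl)).mono ?_
  have := pow_time hZ 3 4
  omega

/-- `(a, b) ↦ a * b` -/
def mulP : Program :=
  .seq (ex (.cons .nil X)) (.seq (forc X.tail.head (.seq (ex X.tail) (forc X.tail.tail
    (ex (.cons (.cons .nil X.tail.head) X.tail.tail))))) (ex X.head))

theorem det_mul {Z : ℕ} (hZ : 32 ≤ Z) {a b : ℕ} (ha : a ≤ Z) (hb : b ≤ Z) :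
    Det mulP (.cons (.ofNat a) (.ofNat b)) (.ofNat (a * b)) (Z ^ 7) := by
  have hin : ∀ i, Det (forc X.tail.tail (ex (.cons (.cons .nil X.tail.head) X.tail.tail)))
      (.cons (.ofNat (i * b)) (.cons (.ofNat a) (.ofNat b)))
      (.cons (.ofNat ((i + 1) * b)) (.cons (.ofNat a) (.ofNat b))) (Z ^ 3) := by
    intro i
    have h := Det.forc_pow hZ 1 3 (e := X.tail.tail)
      (P := ex (.cons (.cons .nil X.tail.head) X.tail.tail)) (L := List.replicate b .nil)
      (fun j => .cons (.ofNat (i * b + j)) (.cons (.ofNat a) (.ofNat b))) (by simpa)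
      (BTree.ofNat_eq_ofList b) (fun i hi => (det_ex _ rfl).mono (by simp; omega))
    rw [List.length_replicate] at h
    rwa [add_mul, one_mul]
  have h := Det.forc_pow hZ 4 6 (e := X.tail.head)
    (P := .seq (ex X.tail) (forc X.tail.tail (ex (.cons (.cons .nil X.tail.head) X.tail.tail))))
    (L := List.replicate a .nil) (fun i => .cons (.ofNat (i * b)) (.cons (.ofNat a) (.ofNat b)))
    (by simpa) (BTree.ofNat_eq_ofList a) (fun i hi => ((det_ex X.tail rfl).seq (hin i)).mono (by
      have := pow_time hZ 3 4; omega))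
  rw [List.length_replicate, zero_mul] at h
  refine ((det_ex _ rfl).seq (h.seq (det_ex X.head rfl))).mono ?_
  have := pow_time hZ 6 7
  omega

/-- `a ↦ a ^ m` -/
def powP : ℕ → Program
  | 0 => ex (.cons .nil .nil)
  | m + 1 => .seq (letc X (powP m)) mulP

theorem det_pow {Z : ℕ} (hZ : 32 ≤ Z) {a : ℕ} (ha : a ≤ Z) : ∀ m : ℕ, (∀ i ≤ m, a ^ i ≤ Z) →
    Det (powP m) (.ofNat a) (.ofNat (a ^ m)) ((m + 1) * Z ^ 8)
  | 0, _ => (det_ex _ (by rw [pow_zero]; rfl)).mono (by have := pow_time hZ 8 9; omega)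
  | m + 1, h => by
      refine ((Det.letc rfl (det_pow hZ ha m fun i hi => h i (by omega))).seq
        (det_mul hZ (h m (by omega)) ha)).mono ?_
      have := pow_time hZ 7 8
      rw [add_mul (m + 1) 1]
      omega

/-- `s ↦ 2 ^ s` -/
def twoPowP : Program :=
  .seq (ex (.cons (lit 1) X)) (.seq (forc X.tail (.seq (ex X.tail) (.seq
    (letc (.cons (lit 2) X.head) mulP) (ex (.cons X.head X.tail.tail))))) (ex X.head))

theorem det_twoPow {Z : ℕ} (hZ : 32 ≤ Z) {s : ℕ} (hs : 2 ^ s ≤ Z) :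
    Det twoPowP (.ofNat s) (.ofNat (2 ^ s)) (Z ^ 11) := by
  have hsZ : s ≤ Z := Nat.lt_two_pow_self.le.trans hs
  have h := Det.forc_pow hZ 8 10 (e := X.tail)
    (P := .seq (ex X.tail) (.seq (letc (.cons (lit 2) X.head) mulP)
      (ex (.cons X.head X.tail.tail))))
    (L := List.replicate s .nil) (fun i => .cons (.ofNat (2 ^ i)) (.ofNat s))
    (by simpa) (BTree.ofNat_eq_ofList s) (fun i hi => by
      have hp : 2 ^ i ≤ Z := (Nat.pow_le_pow_right (by norm_num) (by simp at hi; omega)).trans hs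
      refine ((det_ex X.tail rfl).seq ((Det.letc rfl (det_mul hZ (a := 2) (b := 2 ^ i) (by omega) hp)).seq
        (det_ex _ (y := .cons (.ofNat (2 ^ (i + 1))) (.ofNat s)) ?_))).mono ?_
      · rw [pow_succ, mul_comm]; rfl
      · have := pow_time hZ 7 8; omega)
  rw [List.length_replicate] at h
  refine ((det_ex _ rfl).seq (h.seq (det_ex X.head rfl))).mono ?_
  have := pow_time hZ 10 11
  omega

/-- The length of a list, in unary. -/
def lenP : Program :=
  .seq (ex (.cons .nil X)) (.seq (forc X.tail (ex (.cons (.cons .nil X.tail.head) X.tail.tail)))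
    (ex X.head))

theorem det_len {Z : ℕ} (hZ : 32 ≤ Z) {L : List BTree} (hL : L.length ≤ Z) :
    Det lenP (.ofList L) (.ofNat L.length) (Z ^ 4) := by
  have h := Det.forc_pow hZ 1 3 (e := X.tail)
    (P := ex (.cons (.cons .nil X.tail.head) X.tail.tail))
    (L := L) (fun i => .cons (.ofNat i) (.ofList L)) hL rfl
    (fun i hi => (det_ex _ rfl).mono (by simp; omega))
  refine ((det_ex _ rfl).seq (h.seq (det_ex X.head rfl))).mono ?_
  have := pow_time hZ 3 4
  omega

/-- `n ↦ Nat.clog 2 n` -/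
def clogP : Program :=
  .seq (ex (.cons (lit 1) (.cons .nil X))) (.seq (forc X.tail.tail (.seq (ex X.tail) (.seq
    (letc (.cons X.tail.tail X.head) subP)
    (.cond X.head (.seq (ex X.tail) (.seq (letc (.cons (lit 2) X.head) mulP)
      (ex (.cons X.head (.cons (.cons .nil X.tail.tail.head) X.tail.tail.tail)))))
      (ex X.tail))))) (ex X.tail.head))

/-- The power of two is doubled while it is below `n` and stays put afterwards; `n` rounds suffice
because `Nat.clog 2 n ≤ n`. The last power may exceed `n`, hence the bound on `2 * n`. -/
theorem det_clog {Z : ℕ} (hZ : 32 ≤ Z) {n : ℕ} (hn : 2 * n ≤ Z) :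
    Det clogP (.ofNat n) (.ofNat (Nat.clog 2 n)) (Z ^ 11) := by
  set y : ℕ → BTree := fun i =>
    .cons (.ofNat (2 ^ min i (Nat.clog 2 n))) (.cons (.ofNat (min i (Nat.clog 2 n))) (.ofNat n))
    with hy
  have hbody : ∀ (i : ℕ) (t : BTree), Det (.seq (ex X.tail) (.seq
      (letc (.cons X.tail.tail X.head) subP)
      (.cond X.head (.seq (ex X.tail) (.seq (letc (.cons (lit 2) X.head) mulP)
        (ex (.cons X.head (.cons (.cons .nil X.tail.tail.head) X.tail.tail.tail)))))
        (ex X.tail)))) (.cons t (y i)) (y (i + 1)) (Z ^ 8) := by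
    intro i t
    set b := min i (Nat.clog 2 n) with hb
    have hp : 2 ^ b ≤ Z := by
      rcases Nat.eq_zero_or_pos b with h | h
      · rw [h]; omega
      · have h1 : b - 1 < Nat.clog 2 n := by omega
        have := (Nat.lt_clog_iff_pow_lt (by norm_num)).1 h1
        rw [show b = b - 1 + 1 by omega, pow_succ]; omega
    have hsub := Det.letc (e := .cons X.tail.tail X.head) (x := y i) rfl
      (det_sub hZ (a := n) (b := 2 ^ b) hp)
    have hpow := pow_time hZ 4 5
    have hpow5 := pow_time hZ 5 6
    have hpow6 := pow_time hZ 6 7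
    have hpow7 := pow_time hZ 7 8
    by_cases hlt : 2 ^ b < n
    · have hb' : b < Nat.clog 2 n := (Nat.lt_clog_iff_pow_lt (by norm_num)).2 hlt
      have hyi : y i = .cons (.ofNat (2 ^ b)) (.cons (.ofNat b) (.ofNat n)) := rfl
      have hyi' : y (i + 1) = .cons (.ofNat (2 * 2 ^ b)) (.cons (.ofNat (b + 1)) (.ofNat n)) := by
        rw [hy]; beta_reduce
        rw [show min (i + 1) (Nat.clog 2 n) = b + 1 by omega, pow_succ, mul_comm]
      refine ((det_ex X.tail rfl).seq (hsub.seq (Sim.cond_true (T := Z ^ 7 + 11) ?_ ?_))).mono ?_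
      · simp [Expr.at, Expr.eval, BTree.head, BTree.ofNat_eq_nil]; omega
      · rw [hyi, hyi']
        refine Det.mono ((det_ex X.tail rfl).seq ((Det.letc rfl (det_mul hZ (a := 2)
          (b := 2 ^ b) (by omega) hp)).seq (det_ex _ rfl))) (by omega)
      · omega
    · have hb' : ¬ b < Nat.clog 2 n := fun h => hlt ((Nat.lt_clog_iff_pow_lt (by norm_num)).1 h)
      refine ((det_ex X.tail rfl).seq (hsub.seq (Sim.cond_false (T := 1) ?_ (det_ex X.tail ?_)))).mono ?_
      · simp [Expr.at, Expr.eval, BTree.head, BTree.ofNat_eq_nil]; omega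
      · rw [hy]; beta_reduce
        rw [show min (i + 1) (Nat.clog 2 n) = b by omega]; rfl
      · omega
  have h := Det.forc_pow hZ 8 10 (e := X.tail.tail)
    (L := List.replicate n .nil) y (by simp; omega) (BTree.ofNat_eq_ofList n)
    (fun i hi => hbody i _)
  rw [List.length_replicate] at h
  have hn' : min n (Nat.clog 2 n) = Nat.clog 2 n :=
    min_eq_right (Nat.clog_le_of_le_pow Nat.lt_two_pow_self.le)
  have hy0 : y 0 = .cons (.ofNat 1) (.cons .nil (.ofNat n)) := by simp [hy]; rfl
  have hyn : y n = .cons (.ofNat (2 ^ Nat.clog 2 n)) (.cons (.ofNat (Nat.clog 2 n)) (.ofNat n)) := by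
    rw [hy]; beta_reduce; rw [hn']
  rw [hy0, hyn] at h
  refine ((det_ex _ rfl).seq (h.seq (det_ex X.tail.head rfl))).mono ?_
  have := pow_time hZ 10 11
  omega

end RandWhile

namespace RandWhile

/-! ### Uniform distributions -/

noncomputable abbrev unif (α : Type*) [Fintype α] [Nonempty α] : PMF α := PMF.uniformOfFintype α

theorem unif_map_equiv {α β : Type*} [Fintype α] [Nonempty α] [Fintype β] [Nonempty β]
    (e : α ≃ β) : (unif α).map e = unif β := by
  classical
  ext b
  rw [PMF.map_apply, tsum_eq_single (e.symm b)]
  · simp [unif, Fintype.card_congr e]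
  · intro a ha
    rw [if_neg]
    rintro rfl; simp at ha

theorem unif_prod {α β : Type*} [Fintype α] [Nonempty α] [Fintype β] [Nonempty β] :
    unif (α × β) = (unif α).bind fun a => (unif β).map fun b => (a, b) := by
  classical
  ext ⟨a, b⟩
  rw [PMF.bind_apply, tsum_eq_single a]
  · rw [PMF.map_apply, tsum_eq_single b]
    · simp only [unif, PMF.uniformOfFintype_apply, if_true, Fintype.card_prod, Nat.cast_mul]
      rw [ENNReal.mul_inv] <;> simp
    · intro b' hb'; rw [if_neg]; simpa using fun h => hb' h.symm
  · intro a' ha'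
    rw [PMF.map_apply]
    simp [Prod.ext_iff, ha'.symm]

theorem unif_snoc {β : Type} [Fintype β] [Nonempty β] (i : ℕ) :
    unif (Fin (i + 1) → β) = (unif (Fin i → β)).bind fun f =>
      (unif β).map fun a => Fin.snoc (α := fun _ => β) f a := by
  rw [← unif_map_equiv ((Equiv.prodComm _ _).trans (Fin.snocEquiv fun _ : Fin (i + 1) => β)),
    unif_prod, PMF.map_bind]
  congr 1; ext1 f
  rw [PMF.map_comp]; rfl

/-- One round of `pickP`: a fresh low bit is appended to `p`. -/
theorem unif_two_pow (i : ℕ) :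
    unif (Fin (2 ^ (i + 1))) = (unif (Fin (2 ^ i))).bind fun p =>
      (unif Bool).map fun b => ⟨2 * p + b.toNat, by
        have := p.2; have := b.toNat_le; rw [pow_succ]; omega⟩ := by
  let F : Fin (2 ^ i) × Bool → Fin (2 ^ (i + 1)) := fun x => ⟨2 * x.1 + x.2.toNat, by
    have := x.1.2; have := x.2.toNat_le; rw [pow_succ]; omega⟩
  have hF : Function.Bijective F := by
    rw [Fintype.bijective_iff_injective_and_card]
    refine ⟨?_, by simp [pow_succ]⟩
    rintro ⟨p, b⟩ ⟨p', b'⟩ h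
    have h' : 2 * (p : ℕ) + b.toNat = 2 * p' + b'.toNat := congrArg Fin.val h
    ext1
    · ext; cases b <;> cases b' <;> simp at h' ⊢ <;> omega
    · cases b <;> cases b' <;> simp at h' ⊢ <;> omega
  rw [← unif_map_equiv (Equiv.ofBijective F hF), unif_prod, PMF.map_bind]
  congr 1; ext1 p
  rw [PMF.map_comp]; rfl

/-! ### Lists -/

/-- A list, with its first element in front. -/
def encL {N : ℕ} (a : Fin N → BTree) : BTree := .ofList (List.ofFn a)

/-- A list, with its last element in front. -/
def encR {N : ℕ} (a : Fin N → BTree) : BTree := .ofList (List.ofFn a).reverse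

theorem ofNat_eq_encR (n : ℕ) : BTree.ofNat n = encR (fun _ : Fin n => .nil) := by
  rw [BTree.ofNat_eq_ofList, encR]; simp [List.ofFn_const]

theorem encR_snoc {N : ℕ} {β : Type} (enc : β → BTree) (f : Fin N → β) (a : β) :
    encR (fun i => enc (Fin.snoc (α := fun _ => β) f a i)) =
      .cons (enc a) (encR fun i => enc (f i)) := by
  rw [encR, List.ofFn_succ']; simp [BTree.ofList, encR]

theorem encL_rev {N : ℕ} (a : Fin N → BTree) : encL (fun i => a i.rev) = encR a := by
  rw [encL, encR]; congr 1
  apply List.ext_getElem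
  · simp
  · intro i h1 h2; simp [Fin.rev]; congr 1; ext; simp; omega

/-- Apply `P` to each element of the list `e`, paired with the context. -/
def mapP (e : Expr) (P : Program) : Program :=
  .seq (ex (.cons .nil X)) (.seq (forc e (.seq (letc (.cons X.head X.tail.tail) P)
    (ex (.cons (.cons X.head X.tail.tail.head) X.tail.tail.tail)))) (ex X.head))

/-- Results are put in front one by one, which reverses the order. So the input has its last element
in front and the output its first. -/
theorem det_mapP {Z : ℕ} (hZ : 32 ≤ Z) (j k : ℕ) {e : Expr} {P : Program} {N : ℕ}
    (a g : Fin N → BTree) {ctx : BTree} (hN : N ≤ Z) (hx : e.at (.cons .nil ctx) = encR a)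
    (h : ∀ i, Det P (.cons (a i) ctx) (g i) (Z ^ j))
    (he : e.Closed := by exact fun _ => rfl)
    (hk : j + 4 = k := by norm_num) :
    Det (mapP e P) ctx (encL g) (Z ^ k) := by
  subst hk
  have hlen : (List.ofFn a).reverse.length = N := by simp
  have h := Det.forc_pow hZ (j + 1) (j + 3) (e := e) (P := .seq (letc (.cons X.head X.tail.tail) P)
    (ex (.cons (.cons X.head X.tail.tail.head) X.tail.tail.tail))) (L := (List.ofFn a).reverse)
    (fun i => .cons (.ofList ((List.ofFn g).drop (N - i))) ctx) (by simpa) (by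
      rw [List.drop_of_length_le (by simp)]; exact hx) (fun i hi => by
      have hi' : i < N := by simpa using hi
      have hg : (List.ofFn g).drop (N - (i + 1)) =
          g ⟨N - (i + 1), by omega⟩ :: (List.ofFn g).drop (N - i) := by
        rw [List.drop_eq_getElem_cons (by simp; omega)]
        simp [show N - (i + 1) + 1 = N - i by omega]
      have ha : (List.ofFn a).reverse[i] = a ⟨N - (i + 1), by omega⟩ := by
        simp; congr 1; ext; simp; omega
      rw [hg, ha]
      refine ((Det.letc rfl (h ⟨N - (i + 1), by omega⟩)).seq (det_ex _ rfl)).mono ?_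
      have := pow_time hZ j (j + 1) (by omega); omega) he (by omega) (by omega)
  rw [hlen] at h
  simp only [Nat.sub_self, List.drop_zero, Nat.sub_zero] at h
  rw [List.drop_of_length_le (by simp)] at h
  refine ((det_ex _ rfl).seq (h.seq (det_ex X.head rfl))).mono ?_
  have := pow_time hZ (j + 3) (j + 4) (by omega); omega

/-- The law of the result does not depend on the element, so results are indexed by their time of
creation, the newest in front; `unif_snoc` is one round. -/
theorem sim_mapP {Z : ℕ} (hZ : 32 ≤ Z) (j k : ℕ) {e : Expr} {P : Program} {N : ℕ}
    (a : Fin N → BTree) {β : Type} [Fintype β] [Nonempty β] (enc : β → BTree)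
    {ctx : BTree} (hN : N ≤ Z) (hx : e.at (.cons .nil ctx) = encR a)
    (h : ∀ x, Sim P (.cons x ctx) (unif β) enc (Z ^ j))
    (he : e.Closed := by exact fun _ => rfl)
    (hk : j + 4 = k := by norm_num) :
    Sim (mapP e P) ctx (unif (Fin N → β)) (fun f => encR fun i => enc (f i)) (Z ^ k) := by
  subst hk
  have hlen : (List.ofFn a).reverse.length = N := by simp
  have h := Sim.forc_pow hZ (j + 1) (j + 3) (e := e) (P := .seq (letc (.cons X.head X.tail.tail) P)
    (ex (.cons (.cons X.head X.tail.tail.head) X.tail.tail.tail))) (L := (List.ofFn a).reverse)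
    (x := .cons .nil ctx)
    (α := fun i => Fin i → β) (fun i f => .cons (encR fun i => enc (f i)) ctx)
    (fun i => unif (Fin i → β))
    (fun i f => (unif β).map fun a => Fin.snoc (α := fun _ => β) f a) (by simpa) hx
    (by
      rw [show (fun f : Fin 0 → β => BTree.cons (encR fun i => enc (f i)) ctx) =
        Function.const _ (.cons .nil ctx) from by ext f; simp [encR, BTree.ofList],
        PMF.map_const])
    (fun i hi => unif_snoc i) (fun i hi f => by
      refine Sim.of_eq (Sim.mono (Sim.seq_det (enc' := fun a =>
        .cons (encR fun i => enc (Fin.snoc (α := fun _ => β) f a i)) ctx)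
        (Sim.letc rfl (h _)) (fun b => det_ex _ ?_)) ?_) ?_
      · rw [encR_snoc]; rfl
      · have := pow_time hZ j (j + 1) (by omega); omega
      · rw [PMF.map_comp]; rfl) he (by omega) (by omega)
  rw [hlen] at h
  refine Sim.mono (Det.seq_sim (det_ex _ rfl) (Sim.seq_det h fun f => det_ex X.head rfl)) ?_
  have := pow_time hZ (j + 3) (j + 4) (by omega); omega

/-- Disjunction of independent random bits. -/
noncomputable def orIter (p : ℕ → PMF Bool) : ℕ → PMF Bool
  | 0 => PMF.pure false
  | i + 1 => (orIter p i).bind fun b => (p i).map fun c => b || c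

/-- Run `P` once for each element of the list `e`, on the number of the round and the context;
tell whether one of the answers was positive. -/
def anyP (e : Expr) (P : Program) : Program :=
  .seq (ex (.cons .nil (.cons .nil X))) (.seq (forc e
    (.seq (ex (.cons X.tail.head (.cons (.cons .nil X.tail.tail.head) X.tail.tail.tail)))
      (.seq (letc X.tail P) (.cond X.head (ex (.cons (lit 1) X.tail.tail)) (ex X.tail)))))
    (ex X.head))

/-- The round number is increased before `P` runs, so `P` sees `1, …, N`. -/
theorem sim_any {Z : ℕ} (hZ : 32 ≤ Z) (j k : ℕ) {e : Expr} {P : Program} {N : ℕ}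
    (p : ℕ → PMF Bool) {ctx : BTree} (hN : N ≤ Z)
    (hx : e.at (.cons .nil (.cons .nil ctx)) = .ofNat N)
    (h : ∀ i < N, Sim P (.cons (.ofNat (i + 1)) ctx) (p i) .ofBool (Z ^ j))
    (he : e.Closed := by exact fun _ => rfl)
    (hk : j + 4 = k := by norm_num) :
    Sim (anyP e P) ctx (orIter p N) .ofBool (Z ^ k) := by
  subst hk
  have h := Sim.forc_pow hZ (j + 1) (j + 3) (e := e) (P := .seq (ex (.cons X.tail.head
      (.cons (.cons .nil X.tail.tail.head) X.tail.tail.tail)))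
      (.seq (letc X.tail P) (.cond X.head (ex (.cons (lit 1) X.tail.tail)) (ex X.tail))))
    (L := List.replicate N .nil) (x := .cons .nil (.cons .nil ctx))
    (α := fun _ => Bool) (fun i b => .cons (.ofBool b) (.cons (.ofNat i) ctx))
    (fun i => orIter p i) (fun i b => (p i).map fun c => b || c) (by simpa)
    (hx.trans (BTree.ofNat_eq_ofList N))
    (by simp [orIter, PMF.pure_map, BTree.ofBool, BTree.ofNat]) (fun i hi => rfl) (fun i hi b => by
      have hi' : i < N := by simpa using hi
      refine Sim.of_eq (Sim.mono ((det_ex _ rfl).seq_sim (Sim.seq_det (enc' := fun c =>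
        .cons (.ofBool (b || c)) (.cons (.ofNat (i + 1)) ctx)) (T' := 2)
        (Sim.letc rfl (h i hi')) (fun c => ?_))) ?_) ?_
      · cases c with
        | false => rw [Bool.or_false]; exact Sim.cond_false rfl (det_ex _ rfl)
        | true => rw [Bool.or_true]; exact Sim.cond_true (fun h => by cases h) (det_ex _ rfl)
      · have := pow_time hZ j (j + 1) (by omega); omega
      · rw [PMF.map_comp]; rfl) he (by omega) (by omega)
  rw [List.length_replicate] at h
  refine Sim.mono (Det.seq_sim (det_ex _ rfl) (Sim.seq_det h fun f => det_ex X.head rfl)) ?_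
  have := pow_time hZ (j + 3) (j + 4) (by omega); omega

/-! ### Random sets and graphs -/

/-- `b ↦` a random number below `2 ^ b`. -/
def pickP : Program :=
  .seq (ex (.cons .nil X)) (.seq (forc X.tail
    (.seq (ex X.tail) (.seq (letc (.cons (lit 2) X.head) mulP) (.seq (ex (.cons X.head X.tail.tail))
      (.seq coin (.cond X.head (ex (.cons (.cons .nil X.tail.head) X.tail.tail)) (ex X.tail)))))))
    (ex X.head))

theorem sim_pick {Z : ℕ} (hZ : 32 ≤ Z) {b : ℕ} (hb : 2 ^ b ≤ Z) :
    Sim pickP (.ofNat b) (unif (Fin (2 ^ b))) (fun p => .ofNat p) (Z ^ 11) := by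
  have hbZ : b ≤ Z := Nat.lt_two_pow_self.le.trans hb
  have h := Sim.forc_pow hZ 8 10 (e := X.tail) (P := .seq (ex X.tail) (.seq
      (letc (.cons (lit 2) X.head) mulP) (.seq (ex (.cons X.head X.tail.tail))
      (.seq coin (.cond X.head (ex (.cons (.cons .nil X.tail.head) X.tail.tail)) (ex X.tail))))))
    (L := List.replicate b .nil) (x := .cons .nil (.ofNat b))
    (α := fun i => Fin (2 ^ i)) (fun i p => .cons (.ofNat p) (.ofNat b))
    (fun i => unif (Fin (2 ^ i))) (fun i p => (unif Bool).map fun b => ⟨2 * p + b.toNat, by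
        have := p.2; have := b.toNat_le; rw [pow_succ]; omega⟩) (by simpa)
    (BTree.ofNat_eq_ofList b)
    (by
      rw [show (fun p : Fin (2 ^ 0) => BTree.cons (.ofNat p) (.ofNat b)) =
        Function.const _ (.cons .nil (.ofNat b)) from by
          ext p; simp [BTree.ofNat], PMF.map_const])
    (fun i hi => unif_two_pow i) (fun i hi p => by
      have hi' : i < b := by simpa using hi
      have hp : (p : ℕ) ≤ Z := p.2.le.trans
        ((Nat.pow_le_pow_right (by norm_num) hi'.le).trans hb)
      refine Sim.of_eq (Sim.mono ((det_ex X.tail rfl).seq_sim (Det.seq_sim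
        (Det.letc rfl (det_mul hZ (a := 2) (b := p) (by omega) hp)) ((det_ex _ rfl).seq_sim
        (Sim.seq_det (enc' := fun c => .cons (.ofNat (2 * p + c.toNat)) (.ofNat b)) (T' := 2)
          (sim_coin _) (fun c => ?_))))) ?_) ?_
      · cases c with
        | false => exact Sim.cond_false rfl (det_ex _ rfl)
        | true => exact Sim.cond_true (fun h => by cases h) (det_ex _ rfl)
      · have := pow_time hZ 7 8; omega
      · rw [PMF.map_comp]; rfl)
  rw [List.length_replicate] at h
  refine Sim.mono (Det.seq_sim (det_ex _ rfl) (Sim.seq_det h fun f => det_ex X.head rfl)) ?_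
  have := pow_time hZ 10 11; omega

end RandWhile

/-! ### Truth values and list entries of trees -/

/-- The truth value of a tree. -/
def BTree.truthy : BTree → Bool
  | nil => false
  | cons _ _ => true

theorem BTree.truthy_iff {t : BTree} : t.truthy = true ↔ t ≠ nil := by
  cases t <;> simp [truthy]

theorem BTree.truthy_eq_false {t : BTree} : t.truthy = false ↔ t = nil := by
  cases t <;> simp [truthy]

@[simp] theorem BTree.truthy_ofBool (b : Bool) : (ofBool b).truthy = b := by
  cases b <;> rfl

/-- The entry with index `i` of a list. -/
def BTree.nth (t : BTree) (i : ℕ) : BTree := (tail^[i] t).head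

theorem BTree.nth_succ (t : BTree) (i : ℕ) : t.nth (i + 1) = t.tail.nth i := rfl

theorem BTree.nth_ofList : ∀ (L : List BTree) (i : ℕ), (ofList L).nth i = L.getD i nil
  | [], i => by
      have : ∀ i, tail^[i] nil = nil := fun i => by
        induction i with
        | zero => rfl
        | succ i ih => rw [Function.iterate_succ_apply', ih]; rfl
      simp [nth, ofList, this, head]
  | a :: L, 0 => by simp [nth, ofList, head]
  | a :: L, i + 1 => by
      rw [nth_succ]; change (ofList L).nth i = _; simpa using nth_ofList L i

namespace RandWhile

open BTree (nth)

/-! ### Adjacency -/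

/-- `(L, i) ↦ L.nth i` -/
def nthP : Program :=
  .seq (forc X.tail (ex (.cons X.tail.head.tail X.tail.tail))) (ex X.head.head)

theorem det_nth {Z : ℕ} (hZ : 32 ≤ Z) (L : BTree) {i : ℕ} (hi : i ≤ Z) :
    Det nthP (.cons L (.ofNat i)) (L.nth i) (Z ^ 4) := by
  have h := Det.forc_pow hZ 1 3 (e := X.tail)
    (P := ex (.cons X.tail.head.tail X.tail.tail)) (L := List.replicate i .nil)
    (fun j => .cons (BTree.tail^[j] L) (.ofNat i)) (by simpa) (BTree.ofNat_eq_ofList i)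
    (fun i hi => (det_ex _ (by rw [Function.iterate_succ_apply']; rfl)).mono (by simp; omega))
  rw [List.length_replicate] at h
  refine (h.seq (det_ex X.head.head rfl)).mono ?_
  have := pow_time hZ 3 4
  omega

/-- Adjacency of `x` and `y`, in this order, if a clique is added on the numbers below `κ`. -/
def adjO (mat : BTree) (κ x y : ℕ) : Bool := decide (x < κ) || ((mat.nth x).nth y).truthy

/-- Adjacency in the graph given by the lower triangle of the matrix `mat`, with a clique added on
the numbers below `κ`. -/
def adjK (mat : BTree) (κ x y : ℕ) : Bool :=
  if y < x then adjO mat κ x y else if x < y then adjO mat κ y x else false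

def adjOP : Program :=
  .seq (letc (.cons X.head.tail X.tail.head) subP) (.cond X.head (ex (lit 1)) (.seq (ex X.tail)
    (.seq (letc (.cons X.head.head X.tail.head) nthP) (.seq (letc (.cons X.head X.tail.tail.tail) nthP)
      (.cond X.head (ex (lit 1)) (ex .nil))))))

theorem det_adjO {Z : ℕ} (hZ : 32 ≤ Z) (mat : BTree) {κ x y : ℕ} (hx : x ≤ Z) (hy : y ≤ Z) :
    Det adjOP (.cons (.cons mat (.ofNat κ)) (.cons (.ofNat x) (.ofNat y)))
      (.ofBool (adjO mat κ x y)) (Z ^ 5) := by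
  have hpow := pow_time hZ 4 5
  have hsub := Det.letc (e := .cons X.head.tail X.tail.head)
    (x := .cons (.cons mat (.ofNat κ)) (.cons (.ofNat x) (.ofNat y))) rfl
    (det_sub hZ (a := κ) (b := x) hx)
  by_cases h : x < κ
  · refine Det.mono (Det.seq hsub (Sim.cond_true (T := 1) ?_ (det_ex _ ?_))) (by omega)
    · change BTree.ofNat (κ - x) ≠ _; rw [Ne, BTree.ofNat_eq_nil]; omega
    · simp [adjO, h]; rfl
  · refine Det.mono (Det.seq hsub (Sim.cond_false (T := 2 * Z ^ 4 + 18) ?_ (Det.mono ((det_ex X.tail rfl).seq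
      ((Det.letc rfl (det_nth hZ mat hx)).seq ((Det.letc rfl (det_nth hZ (mat.nth x) hy)).seq
        (?_ : Det _ _ _ 2)))) (by omega)))) (by omega)
    · change BTree.ofNat (κ - x) = _; rw [BTree.ofNat_eq_nil]; omega
    · by_cases ht : ((mat.nth x).nth y).truthy
      · exact Sim.cond_true (BTree.truthy_iff.1 ht) (det_ex _ (by simp [adjO, ht]; rfl))
      · have ht' : ((mat.nth x).nth y).truthy = false := by simpa using ht
        exact Sim.cond_false (BTree.truthy_eq_false.1 ht')
          (det_ex _ (by simp [adjO, ht, h]; rfl))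

/-- `((mat, κ), (x, y)) ↦ adjK mat κ x y` -/
def adjP : Program :=
  .seq (letc (.cons X.tail.head X.tail.tail) subP) (.cond X.head (.seq (ex X.tail) adjOP)
    (.seq (ex X.tail) (.seq (letc (.cons X.tail.tail X.tail.head) subP) (.cond X.head
      (.seq (ex (.cons X.tail.head (.cons X.tail.tail.tail X.tail.tail.head))) adjOP) (ex .nil)))))

theorem det_adj {Z : ℕ} (hZ : 32 ≤ Z) (mat : BTree) {κ x y : ℕ} (hx : x ≤ Z) (hy : y ≤ Z) :
    Det adjP (.cons (.cons mat (.ofNat κ)) (.cons (.ofNat x) (.ofNat y)))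
      (.ofBool (adjK mat κ x y)) (Z ^ 6) := by
  have hpow := pow_time hZ 4 5
  have hpow' := pow_time hZ 5 6
  set e : BTree := .cons (.cons mat (.ofNat κ)) (.cons (.ofNat x) (.ofNat y)) with he
  have hsub := Det.letc (e := .cons X.tail.head X.tail.tail) (x := e) rfl
    (det_sub hZ (a := x) (b := y) hy)
  by_cases h : y < x
  · refine Det.mono (Det.seq hsub (Sim.cond_true (T := Z ^ 5 + 2) ?_ ?_)) (by omega)
    · change BTree.ofNat (x - y) ≠ _; rw [Ne, BTree.ofNat_eq_nil]; omega
    · rw [adjK, if_pos h]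
      exact Det.mono ((det_ex X.tail rfl).seq (det_adjO hZ mat hx hy)) (by omega)
  · have hsub' := Det.letc (e := .cons X.tail.tail X.tail.head) (x := e) rfl
      (det_sub hZ (a := y) (b := x) hx)
    refine Det.mono (Det.seq hsub (Sim.cond_false (T := Z ^ 5 + Z ^ 4 + 20) ?_ (Det.mono ((det_ex X.tail rfl).seq
      (hsub'.seq (?_ : Det _ _ _ (Z ^ 5 + 3)))) (by omega)))) (by omega)
    · change BTree.ofNat (x - y) = _; rw [BTree.ofNat_eq_nil]; omega
    · rw [adjK, if_neg h]
      by_cases h' : x < y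
      · rw [if_pos h']
        refine Sim.cond_true (T := Z ^ 5 + 2) ?_ (Det.mono ((det_ex _ rfl).seq
          (det_adjO hZ mat hy hx)) (by omega))
        change BTree.ofNat (y - x) ≠ _; rw [Ne, BTree.ofNat_eq_nil]; omega
      · rw [if_neg h']
        refine Sim.cond_false (T := Z ^ 5 + 2) ?_ (Det.mono (det_ex _ rfl) (by omega))
        change BTree.ofNat (y - x) = _; rw [BTree.ofNat_eq_nil]; omega

/-- `((mat, κ), (S, S')) ↦` whether each element of `S` is adjacent to each element of `S'` -/
def allAdjP : Program :=
  .seq (ex (.cons (lit 1) X)) (.seq (forc X.tail.tail.head (.seq (forc X.tail.tail.tail.tail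
    (.seq (letc (.cons X.tail.tail.tail.head (.cons X.tail.head X.head)) adjP)
      (.cond X.head (ex X.tail.tail) (ex (.cons X.tail.tail.head (.cons .nil X.tail.tail.tail.tail))))))
    (ex X.tail))) (ex X.head))

theorem det_allAdj {Z : ℕ} (hZ : 32 ≤ Z) (mat : BTree) {κ : ℕ} {l l' : List ℕ}
    (hl : l.length ≤ Z) (hl' : l'.length ≤ Z) (h : ∀ x ∈ l, x ≤ Z) (h' : ∀ x ∈ l', x ≤ Z) :
    Det allAdjP (.cons (.cons mat (.ofNat κ)) (.cons (.ofList (l.map .ofNat)) (.ofList (l'.map .ofNat))))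
      (.ofBool (l.all fun x => l'.all fun y => adjK mat κ x y)) (Z ^ 13) := by
  set ctx : BTree := .cons (.cons mat (.ofNat κ)) (.cons (.ofList (l.map .ofNat)) (.ofList (l'.map .ofNat)))
    with hctx
  have hin : ∀ x ≤ Z, ∀ fl : Bool, Det (forc X.tail.tail.tail.tail
      (.seq (letc (.cons X.tail.tail.tail.head (.cons X.tail.head X.head)) adjP)
      (.cond X.head (ex X.tail.tail) (ex (.cons X.tail.tail.head (.cons .nil X.tail.tail.tail.tail))))))
      (.cons (.ofNat x) (.cons (.ofBool fl) ctx))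
      (.cons (.ofNat x) (.cons (.ofBool (fl && l'.all fun y => adjK mat κ x y)) ctx)) (Z ^ 9) := by
    intro x hx fl
    have := Det.forc_pow hZ 7 9 (e := X.tail.tail.tail.tail)
      (P := .seq (letc (.cons X.tail.tail.tail.head (.cons X.tail.head X.head)) adjP)
      (.cond X.head (ex X.tail.tail) (ex (.cons X.tail.tail.head (.cons .nil X.tail.tail.tail.tail)))))
      (L := l'.map .ofNat) (fun i => .cons (.ofNat x)
        (.cons (.ofBool (fl && (l'.take i).all fun y => adjK mat κ x y)) ctx)) (by simpa) rfl
      (fun i hi => by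
        have hi' : i < l'.length := by simpa using hi
        have hpow := pow_time hZ 6 7
        rw [List.getElem_map, List.take_succ_eq_append_getElem hi', List.all_append, ← Bool.and_assoc]
        refine Det.mono (Det.seq (Det.letc rfl (det_adj hZ mat (κ := κ) hx (h' _ (List.getElem_mem hi'))))
          (?_ : Det _ _ _ 2)) (by omega)
        cases hadj : adjK mat κ x l'[i] with
        | true => exact Sim.cond_true (fun h => by cases h) (det_ex _ (by simp [hadj]; rfl))
        | false => exact Sim.cond_false rfl (det_ex _ (by simp [hadj]; rfl)))
    simpa using this
  have hout := Det.forc_pow hZ 10 12 (e := X.tail.tail.head)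
    (P := .seq (forc X.tail.tail.tail.tail
      (.seq (letc (.cons X.tail.tail.tail.head (.cons X.tail.head X.head)) adjP)
      (.cond X.head (ex X.tail.tail) (ex (.cons X.tail.tail.head (.cons .nil X.tail.tail.tail.tail))))))
      (ex X.tail))
    (L := l.map .ofNat) (fun i =>
      .cons (.ofBool ((l.take i).all fun x => l'.all fun y => adjK mat κ x y)) ctx) (by simpa) rfl
    (fun i hi => by
      have hi' : i < l.length := by simpa using hi
      have hpow := pow_time hZ 9 10
      rw [List.getElem_map, List.take_succ_eq_append_getElem hi', List.all_append]
      refine Det.mono (Det.seq (hin l[i] (h _ (List.getElem_mem hi')) _) (det_ex X.tail ?_)) (by omega)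
      simp only [List.all_cons, List.all_nil, Bool.and_true]; rfl)
  rw [List.length_map, List.take_length] at hout
  refine Det.mono (Det.seq (det_ex _ rfl) (Det.seq hout (det_ex X.head rfl))) ?_
  have := pow_time hZ 12 13
  omega

/-! ### Sets of vertices and the instance built from them -/

/-- A tuple of numbers. -/
def encSet {ℓ : ℕ} (S : Fin ℓ → ℕ) : BTree := encR fun j => .ofNat (S j)

/-- Whether all members of `S` are adjacent to all members of `S'`. -/
def pat {ℓ : ℕ} (adj : ℕ → ℕ → Bool) (S S' : Fin ℓ → ℕ) : Bool :=
  decide (∀ i j, adj (S i) (S' j) = true)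

theorem det_pat {Z : ℕ} (hZ : 32 ≤ Z) (mat : BTree) {κ ℓ : ℕ} (hℓ : ℓ ≤ Z) {S S' : Fin ℓ → ℕ}
    (h : ∀ i, S i ≤ Z) (h' : ∀ i, S' i ≤ Z) :
    Det allAdjP (.cons (.cons mat (.ofNat κ)) (.cons (encSet S) (encSet S')))
      (.ofBool (pat (adjK mat κ) S S')) (Z ^ 13) := by
  have henc : ∀ S : Fin ℓ → ℕ, encSet S = .ofList ((List.ofFn S).reverse.map .ofNat) := fun S => by
    rw [encSet, encR, List.map_reverse, List.map_ofFn]; rfl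
  have hall : ∀ (S : Fin ℓ → ℕ) (p : ℕ → Bool),
      (List.ofFn S).reverse.all p = decide (∀ i, p (S i) = true) := fun S p => by
    rw [Bool.eq_iff_iff]; simp [List.mem_ofFn]
  have hpat : pat (adjK mat κ) S S' =
      (List.ofFn S).reverse.all fun x => (List.ofFn S').reverse.all fun y => adjK mat κ x y := by
    simp only [hall, pat, decide_eq_true_eq]
  rw [henc, henc, hpat]
  refine det_allAdj hZ mat (by simpa) (by simpa) ?_ ?_
  · simp only [List.mem_reverse, List.mem_ofFn]; rintro _ ⟨i, rfl⟩; exact h i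
  · simp only [List.mem_reverse, List.mem_ofFn]; rintro _ ⟨i, rfl⟩; exact h' i

/-- The demand matrix with entries `p i j` between leaves. -/
def demTree {N : ℕ} (p : Fin N → Fin N → Bool) : BTree :=
  .cons (.cons .nil (encL fun _ : Fin N => .nil))
    (encL fun i => .cons .nil (encL fun j => .ofBool (p i j)))

def edge1 : BTree := .cons .nil (.cons (.cons .nil .nil) .nil)

/-- The weight matrix of a star with `N` leaves and weights `1`. -/
def starTree (N : ℕ) : BTree :=
  .cons (.cons .nil (encL fun _ : Fin N => edge1))
    (encL fun _ : Fin N => .cons edge1 (encL fun _ : Fin N => .nil))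

def demRowP : Program :=
  .seq (mapP X.tail.tail.tail
    (.seq (ex (.cons X.tail.tail.head (.cons X.tail.head X.head))) allAdjP)) (ex (.cons .nil X))

/-- `((mat, κ), sets) ↦` demand matrix -/
def demP : Program :=
  .seq (letc X (mapP X.tail.tail demRowP)) (.seq (letc X.tail.tail (mapP X.tail (ex .nil)))
    (ex (.cons (.cons .nil X.head) X.tail.head)))

theorem det_dem {Z : ℕ} (hZ : 32 ≤ Z) (mat : BTree) {κ ℓ N : ℕ} (hℓ : ℓ ≤ Z) (hN : N ≤ Z)
    {f : Fin N → Fin ℓ → ℕ} (h : ∀ i j, f i j ≤ Z) :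
    Det demP (.cons (.cons mat (.ofNat κ)) (encR fun i => encSet (f i)))
      (demTree fun i j => pat (adjK mat κ) (f i) (f j)) (Z ^ 24) := by
  have hrow : ∀ i, Det demRowP
      (.cons (encSet (f i)) (.cons (.cons mat (.ofNat κ)) (encR fun i => encSet (f i))))
      (.cons .nil (encL fun j => .ofBool (pat (adjK mat κ) (f i) (f j)))) (Z ^ 19) := fun i => by
    refine Det.mono (Det.seq (det_mapP hZ 14 18 (fun j => encSet (f j))
      (fun j => .ofBool (pat (adjK mat κ) (f i) (f j))) hN rfl fun j => ?_) (det_ex _ rfl)) ?_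
    · refine Det.mono (Det.seq (det_ex _ rfl) (det_pat hZ mat hℓ (h i) (h j))) ?_
      have := pow_time hZ 13 14; omega
    · have := pow_time hZ 18 19; omega
  refine Det.mono (Det.seq (Det.letc rfl (det_mapP hZ 19 23 (fun i => encSet (f i)) _ hN rfl hrow))
    (Det.seq (Det.letc rfl (det_mapP hZ 1 5 (fun i => encSet (f i)) (fun _ => .nil) hN rfl
      fun i => Det.mono (det_ex _ rfl) (by simp; omega))) (det_ex _ rfl))) ?_
  have := pow_time hZ 23 24
  have := pow_time hZ 5 23
  omega

def edgeE : Expr := .cons .nil (.cons (.cons .nil .nil) .nil)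

/-- `L ↦` weight matrix of a star with as many leaves as the length of `L` -/
def starP : Program :=
  .seq (letc X (mapP X.tail (ex .nil))) (.seq (letc X (mapP X.tail.tail (ex (.cons edgeE X.tail.head))))
    (.seq (letc X.tail.tail (mapP X.tail (ex edgeE))) (ex (.cons (.cons .nil X.head) X.tail.head))))

theorem det_star {Z : ℕ} (hZ : 32 ≤ Z) {N : ℕ} (hN : N ≤ Z) (a : Fin N → BTree) :
    Det starP (encR a) (starTree N) (Z ^ 6) := by
  refine Det.mono (Det.seq (Det.letc rfl (det_mapP hZ 1 5 a (fun _ => .nil) hN rfl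
      fun i => Det.mono (det_ex _ rfl) (by simp; omega)))
    (Det.seq (Det.letc rfl (det_mapP hZ 1 5 a (fun _ => .cons edge1 (encL fun _ : Fin N => .nil)) hN rfl
      fun i => Det.mono (det_ex _ rfl) (by simp; omega)))
    (Det.seq (Det.letc rfl (det_mapP hZ 1 5 a (fun _ => edge1) hN rfl
      fun i => Det.mono (det_ex _ rfl) (by simp; omega))) (det_ex _ rfl)))) ?_
  have := pow_time hZ 5 6
  omega

end RandWhile

namespace RandWhile

open BTree (nth)

/-! ### Checking a proposed solution -/

/-- Number of `j < N` such that `F` and `c` are both true at `j`. -/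
def cntRow (F c : BTree) (N : ℕ) : ℕ :=
  Nat.count (fun j => ((F.nth j).truthy && (c.nth j).truthy) = true) N

/-- `(F, (cells, acc)) ↦ acc + cntRow F cells` -/
def cntRowP : Program :=
  .seq (forc X.tail.head (.cond X.head
    (.cond X.tail.head.head
      (ex (.cons X.tail.head.tail (.cons X.tail.tail.head (.cons .nil X.tail.tail.tail))))
      (ex (.cons X.tail.head.tail X.tail.tail)))
    (ex (.cons X.tail.head.tail X.tail.tail)))) (ex X.tail.tail)

theorem det_cntRow {Z : ℕ} (hZ : 32 ≤ Z) (F : BTree) {L : List BTree} (hL : L.length ≤ Z)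
    (acc : ℕ) :
    Det cntRowP (.cons F (.cons (.ofList L) (.ofNat acc)))
      (.ofNat (acc + cntRow F (.ofList L) L.length)) (Z ^ 4) := by
  have h := Det.forc_pow hZ 1 3 (e := X.tail.head) (P := .cond X.head
    (.cond X.tail.head.head
      (ex (.cons X.tail.head.tail (.cons X.tail.tail.head (.cons .nil X.tail.tail.tail))))
      (ex (.cons X.tail.head.tail X.tail.tail)))
    (ex (.cons X.tail.head.tail X.tail.tail))) (L := L)
    (fun i => .cons (BTree.tail^[i] F) (.cons (.ofList L) (.ofNat (acc + cntRow F (.ofList L) i))))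
    (by simpa) rfl (fun i hi => by
      have hn : (BTree.ofList L).nth i = L[i] := by
        rw [BTree.nth_ofList, List.getD_eq_getElem _ _ hi]
      have hcnt : cntRow F (.ofList L) (i + 1) = cntRow F (.ofList L) i +
          if ((F.nth i).truthy && (L[i]).truthy) = true then 1 else 0 := by
        rw [cntRow, Nat.count_succ, hn]; rfl
      rw [hcnt, Function.iterate_succ_apply']
      refine Det.mono (?_ : Det _ _ _ 3) (by simp; omega)
      by_cases h1 : (L[i]).truthy = true
      · refine Sim.cond_true (T := 2) (BTree.truthy_iff.1 h1) ?_
        by_cases h2 : (F.nth i).truthy = true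
        · exact Sim.cond_true (T := 1) (BTree.truthy_iff.1 h2) (det_ex _ (by simp [h1, h2]; rfl))
        · have h2' : (F.nth i).truthy = false := by simpa using h2
          exact Sim.cond_false (T := 1) (BTree.truthy_eq_false.1 h2')
            (det_ex _ (by simp [h2]; rfl))
      · have h1' : (L[i]).truthy = false := by simpa using h1
        exact Sim.cond_false (T := 2) (BTree.truthy_eq_false.1 h1')
          (Det.mono (det_ex _ (by simp [h1]; rfl)) (by omega)))
  rw [show acc + cntRow F (.ofList L) 0 = acc by simp [cntRow]] at h
  refine Det.mono (Det.seq h (det_ex X.tail.tail rfl)) ?_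
  have := pow_time hZ 3 4; omega

/-- Number of pairs `(i, j)` such that `F` is true at `i` and `j` and the matrix `rows`, the first
column of which is dropped, is true at `(i, j)`. -/
def cntAll (F rows : BTree) (N : ℕ) : ℕ :=
  ∑ i ∈ Finset.range N, if (F.nth i).truthy then cntRow F (rows.nth i).tail N else 0

/-- `(F, rows) ↦ cntAll F rows` -/
def cntAllP : Program :=
  .seq (ex (.cons X.head (.cons .nil X))) (.seq (forc X.tail.tail.tail (.cond X.tail.head.head
    (.seq (letc (.cons X.tail.tail.tail.head (.cons X.head.tail X.tail.tail.head)) cntRowP)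
      (ex (.cons X.tail.tail.head.tail (.cons X.head X.tail.tail.tail.tail))))
    (ex (.cons X.tail.head.tail X.tail.tail)))) (ex X.tail.head))

theorem det_cntAll {Z : ℕ} (hZ : 32 ≤ Z) (F : BTree) {N : ℕ} (hN : N ≤ Z)
    (c : Fin N → Fin N → BTree) :
    Det cntAllP (.cons F (encL fun i => .cons .nil (encL (c i))))
      (.ofNat (cntAll F (encL fun i => .cons .nil (encL (c i))) N)) (Z ^ 8) := by
  set R : List BTree := List.ofFn fun i => .cons .nil (encL (c i)) with hR
  have hRlen : R.length = N := by simp [hR]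
  have hin : ∀ (i : ℕ) (hi : i < N), R[i] = .cons .nil (.ofList (List.ofFn (c ⟨i, hi⟩))) := by
    intro i hi; simp [hR, encL]
  have hrows : (encL fun i => .cons .nil (encL (c i))) = BTree.ofList R := rfl
  rw [hrows]
  have h := Det.forc_pow hZ 5 7 (e := X.tail.tail.tail) (P := .cond X.tail.head.head
    (.seq (letc (.cons X.tail.tail.tail.head (.cons X.head.tail X.tail.tail.head)) cntRowP)
      (ex (.cons X.tail.tail.head.tail (.cons X.head X.tail.tail.tail.tail))))
    (ex (.cons X.tail.head.tail X.tail.tail))) (L := R)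
    (fun i => .cons (BTree.tail^[i] F) (.cons (.ofNat (∑ i ∈ Finset.range i,
      if (F.nth i).truthy then cntRow F ((BTree.ofList R).nth i).tail N else 0))
      (.cons F (.ofList R)))) (by omega) rfl (fun i hi => by
      have hi' : i < N := by omega
      have hn : (BTree.ofList R).nth i = R[i] := by
        rw [BTree.nth_ofList, List.getD_eq_getElem _ _ hi]
      rw [Finset.sum_range_succ, hn, Function.iterate_succ_apply', hin i hi']
      refine Det.mono (?_ : Det _ _ _ (Z ^ 4 + 9)) (by have := pow_time hZ 4 5; omega)
      by_cases h2 : (F.nth i).truthy = true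
      · have hc := det_cntRow hZ F (L := List.ofFn (c ⟨i, hi'⟩)) (by simpa) (∑ i ∈ Finset.range i,
          if (F.nth i).truthy then cntRow F ((BTree.ofList R).nth i).tail N else 0)
        rw [List.length_ofFn] at hc
        refine Sim.cond_true (T := Z ^ 4 + 8) (BTree.truthy_iff.1 h2) ?_
        rw [if_pos h2]
        exact Det.mono (Det.seq (Det.letc rfl hc) (det_ex _ rfl)) (by omega)
      · have h2' : (F.nth i).truthy = false := by simpa using h2
        refine Sim.cond_false (T := Z ^ 4 + 8) (BTree.truthy_eq_false.1 h2') ?_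
        rw [if_neg h2]
        exact Det.mono (det_ex _ rfl) (by omega))
  rw [hRlen] at h
  refine Det.mono (Det.seq (det_ex _ rfl) (Det.seq h (det_ex X.tail.head rfl))) ?_
  have := pow_time hZ 7 8; omega

/-- `(v, (w, (k, (b, lam)))) ↦ k ≤ w ∧ 2 * d * b * v ≤ k * lam` -/
def okP (d : ℕ) : Program :=
  .seq (letc (.cons X.tail.tail.head X.tail.head) subP) (.cond X.head (ex .nil) (.seq (ex X.tail)
    (.seq (letc (.cons (lit (2 * d)) X.tail.tail.tail.head) mulP)
    (.seq (letc (.cons X.head X.tail.head) mulP)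
    (.seq (letc (.cons X.tail.tail.tail.tail.head X.tail.tail.tail.tail.tail.tail) mulP)
    (.seq (letc (.cons X.tail.head X.head) subP)
    (.cond X.head (ex .nil) (ex (lit 1)))))))))

theorem det_ok {Z : ℕ} (hZ : 32 ≤ Z) {d v w k b lam : ℕ} (hd : 2 * d ≤ Z) (hb : b ≤ Z)
    (hdb : 2 * d * b ≤ Z) (hv : v ≤ Z) (hw : w ≤ Z) (hk : k ≤ Z) (hlam : lam ≤ Z)
    (hkl : k * lam ≤ Z) :
    Det (okP d) (.cons (.ofNat v) (.cons (.ofNat w) (.cons (.ofNat k) (.cons (.ofNat b) (.ofNat lam)))))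
      (.ofBool (decide (k ≤ w ∧ 2 * d * b * v ≤ k * lam))) (Z ^ 8) := by
  have hpow := pow_time hZ 7 8
  have hpow' := pow_time hZ 4 7
  have hcl : (Expr.cons (lit (2 * d)) X.tail.tail.tail.head).Closed := fun s => by
    simp [Expr.at, Expr.eval]
  refine Det.mono (Det.seq (Det.letc rfl (det_sub hZ (a := k) (b := w) hw))
    (?_ : Det _ _ _ (3 * Z ^ 7 + Z ^ 4 + 50))) (by omega)
  by_cases h : k ≤ w
  · refine Sim.cond_false (T := 3 * Z ^ 7 + Z ^ 4 + 49) ?_ (Det.mono (Det.seq (det_ex X.tail rfl)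
      (Det.seq (Det.letc (by simp [Expr.at, Expr.eval]; rfl) (det_mul hZ (a := 2 * d) (b := b) hd hb) hcl)
      (Det.seq (Det.letc rfl (det_mul hZ (a := 2 * d * b) (b := v) hdb hv))
      (Det.seq (Det.letc rfl (det_mul hZ (a := k) (b := lam) hk hlam))
      (Det.seq (Det.letc rfl (det_sub hZ (a := 2 * d * b * v) (b := k * lam) hkl))
      (?_ : Det _ _ _ 2)))))) (by omega))
    · change BTree.ofNat (k - w) = _; rw [BTree.ofNat_eq_nil]; omega
    · by_cases h' : 2 * d * b * v ≤ k * lam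
      · refine Sim.cond_false (T := 1) ?_ (det_ex _ ?_)
        · change BTree.ofNat (2 * d * b * v - k * lam) = _; rw [BTree.ofNat_eq_nil]; omega
        · simp [h, h']; rfl
      · refine Sim.cond_true (T := 1) ?_ (det_ex _ ?_)
        · change BTree.ofNat (2 * d * b * v - k * lam) ≠ _; rw [Ne, BTree.ofNat_eq_nil]; omega
        · simp [h']; rfl
  · refine Sim.cond_true (T := 3 * Z ^ 7 + Z ^ 4 + 49) ?_ (Det.mono (det_ex _ ?_) (by omega))
    · change BTree.ofNat (k - w) ≠ _; rw [Ne, BTree.ofNat_eq_nil]; omega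
    · simp [h]; rfl

end RandWhile

namespace RandWhile

open BTree (nth)

/-! ### The distinguisher -/

/-- The algorithm for Steiner `k`-Forest and the numerical parameters of the reduction: sets have
`d * lam` elements, there are `2 ^ (b * (a * lam))` of them, the clock of `A` is the `e`-th power of
their number, and cliques of size at least `n ^ (1 / m)` have to be found. -/
structure Params where
  A : Program
  d : ℕ
  a : ℕ
  e : ℕ
  m : ℕ

/-- `tl i` drops `i` entries of the environment. -/
def tl : ℕ → Expr
  | 0 => X
  | i + 1 => (tl i).tail

/-- The entry with index `i` of the environment. -/
def nd (i : ℕ) : Expr := (tl i).head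

variable (p : Params)

/-- The number of sets. -/
def Params.num (b lam : ℕ) : ℕ := 2 ^ (b * (p.a * lam))

/-- Families of sets, as tuples. -/
abbrev Params.Fam (b lam : ℕ) : Type := Fin (p.num b lam) → Fin (p.d * lam) → Fin (2 ^ b)

/-- The pairs of sets that are completely joined. -/
def Params.famPat {b lam : ℕ} (adj : ℕ → ℕ → Bool) (f : p.Fam b lam)
    (i j : Fin (p.num b lam)) : Bool :=
  pat adj (fun x => (f i x : ℕ)) (fun x => (f j x : ℕ))

/-- Encoding of the instance with demands `P`. -/
def instTree {N : ℕ} (k : ℕ) (P : Fin N → Fin N → Bool) : BTree :=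
  .cons (.ofNat k) (.cons (starTree N) (demTree P))

/-- The check of an answer `y`. -/
def verify {N : ℕ} (d b lam k : ℕ) (P : Fin N → Fin N → Bool) (y : BTree) : Bool :=
  decide (k ≤ cntAll y.head.tail (demTree P).tail N ∧
    2 * d * b * cntRow y.head.tail (starTree N).head.tail N ≤ k * lam)

/-- Run `A` on the instance with demands `P` and check its answer. -/
noncomputable def Params.coreK (b lam q : ℕ) (P : Fin (p.num b lam) → Fin (p.num b lam) → Bool) :
    PMF Bool :=
  (outDist p.A (p.num b lam ^ p.e) (instTree (q * (q + 1)) P)).map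
    (verify p.d b lam (q * (q + 1)) P)

noncomputable def Params.roundK (b lam q : ℕ) (adj : ℕ → ℕ → Bool) : PMF Bool :=
  (unif (p.Fam b lam)).bind fun f => p.coreK b lam q (p.famPat adj f)

/-- The answer of the distinguisher with parameter `lam` on a graph. -/
noncomputable def Params.distK (n b b₂ lam : ℕ) (adj : ℕ → ℕ → Bool) : PMF Bool :=
  orIter (fun _ => orIter (fun i => p.roundK b lam (i + 1) adj) b₂) n

/-- The matrix of a family of bits. -/
def bitTree {n : ℕ} (β : Fin n → Fin n → Bool) : BTree :=
  encR fun i => encR fun j => .ofBool (β i j)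

/-- Whether the distinguisher misses a random planted clique of size `κ`. -/
noncomputable def Params.testK (n b b₂ lam κ : ℕ) : PMF Bool :=
  (unif (Fin n → Fin n → Bool)).bind fun β =>
    (p.distK n b b₂ lam (adjK (bitTree β) κ)).map fun r => !r

/-- Whether one of `n` tests with cliques of size `κ` fails. -/
noncomputable def Params.kapK (n b b₂ lam κ : ℕ) : PMF Bool :=
  if κ ^ p.m < n then PMF.pure false else orIter (fun _ => p.testK n b b₂ lam κ) n

/-- Whether one of the tests fails. -/
noncomputable def Params.calK (n b b₂ lam : ℕ) : PMF Bool :=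
  orIter (fun i => p.kapK n b b₂ lam (i + 1)) n

/-- One stage of the algorithm: no answer if one of the tests fails. -/
noncomputable def Params.stageK (n b b₂ lam : ℕ) (adj : ℕ → ℕ → Bool) : PMF (Option Bool) :=
  (p.calK n b b₂ lam).bind fun fail =>
    if fail then PMF.pure none else (p.distK n b b₂ lam adj).map some

/-- `Z` is large enough for the computations of stage `lam`. -/
structure Params.Budget (n b b₂ lam Z : ℕ) : Prop where
  hZ : 32 ≤ Z
  hd : 2 * p.d ≤ Z
  hdb : 2 * p.d * b ≤ Z
  ha : p.a ≤ Z
  hal : p.a * lam ≤ Z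
  hdl : p.d * lam ≤ Z
  hb : 2 ^ b ≤ Z
  hlam : lam ≤ Z
  hN : p.num b lam * p.num b lam ≤ Z
  hNe : ∀ i ≤ p.e, p.num b lam ^ i + 1 ≤ Z
  hA : p.A.cost + 2 * p.A.vb + 10 ≤ Z
  he : p.e + 1 ≤ Z
  hb₂ : b₂ + 1 ≤ Z
  hk : b₂ * (b₂ + 1) ≤ Z
  hkl : b₂ * (b₂ + 1) * lam ≤ Z
  hn : 2 * n ≤ Z
  hm : p.m + 1 ≤ Z
  hnm : ∀ i ≤ p.m, n ^ i ≤ Z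

variable {p} {n b b₂ lam Z : ℕ}

theorem Params.num_pos : 1 ≤ p.num b lam := Nat.one_le_two_pow

theorem Params.Budget.num_le (h : p.Budget n b b₂ lam Z) : p.num b lam ≤ Z :=
  (Nat.le_mul_of_pos_left _ Params.num_pos).trans h.hN

def numP (p : Params) : Program :=
  .seq (letc (.cons (lit p.a) X.tail) mulP) (.seq (ex (.cons X.tail.head X.head))
    (.seq mulP twoPowP))

theorem closed_cons_lit {i : ℕ} {e : Expr} (he : e.Closed) : (Expr.cons (lit i) e).Closed :=
  fun s => by simp [Expr.at, Expr.eval, he s]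

theorem at_cons_lit {i : ℕ} {e : Expr} {x : BTree} :
    (Expr.cons (lit i) e).at x = .cons (.ofNat i) (e.at x) := by
  simp [Expr.at, Expr.eval]

theorem det_num (h : p.Budget n b b₂ lam Z) :
    Det (numP p) (.cons (.ofNat b) (.ofNat lam)) (.ofNat (p.num b lam)) (Z ^ 12) := by
  have hbZ : b ≤ Z := Nat.lt_two_pow_self.le.trans h.hb
  refine Det.mono (Det.seq (Det.letc at_cons_lit (det_mul h.hZ (a := p.a) (b := lam) h.ha h.hlam)
      (closed_cons_lit fun _ => rfl))
    (Det.seq (det_ex _ rfl) (Det.seq (det_mul h.hZ (a := b) hbZ h.hal)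
      (det_twoPow h.hZ h.num_le)))) ?_
  have := pow_time h.hZ 7 11
  have := pow_time h.hZ 11 12
  omega

def setP (p : Params) : Program :=
  .seq (ex X.tail.tail) (.seq (letc (.cons (lit p.d) X.tail) mulP)
    (mapP X.tail.head (.seq (ex X.tail.tail.head) pickP)))

/-- `(b, lam) ↦` a random family of sets -/
def famP (p : Params) : Program := .seq (letc X (numP p)) (mapP X.tail.head (setP p))

def encFam (f : p.Fam b lam) : BTree := encR fun i => encSet fun j => (f i j : ℕ)

theorem sim_fam (h : p.Budget n b b₂ lam Z) :
    Sim (famP p) (.cons (.ofNat b) (.ofNat lam)) (unif (p.Fam b lam)) encFam (Z ^ 22) := by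
  have hd : p.d ≤ Z := by have := h.hd; omega
  refine Sim.mono (Det.seq_sim (Det.letc rfl (det_num h)) (sim_mapP h.hZ 17 21 (fun _ => .nil)
    (fun S : Fin (p.d * lam) → Fin (2 ^ b) => encSet fun j => (S j : ℕ)) h.num_le
    (ofNat_eq_encR _) fun x => ?_)) ?_
  · refine Sim.mono (Det.seq_sim (det_ex X.tail.tail rfl) (Det.seq_sim (Det.letc at_cons_lit
      (det_mul h.hZ (a := p.d) (b := lam) hd h.hlam) (closed_cons_lit fun _ => rfl))
      (sim_mapP h.hZ 12 16 (fun _ => .nil) (fun i : Fin (2 ^ b) => .ofNat (i : ℕ)) h.hdl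
        (ofNat_eq_encR _) fun x => Sim.mono (Det.seq_sim (det_ex X.tail.tail.head rfl)
          (sim_pick h.hZ h.hb)) ?_))) ?_
    · have := pow_time h.hZ 11 12; omega
    · have := pow_time h.hZ 7 16
      have := pow_time h.hZ 16 17
      omega
  · have := pow_time h.hZ 12 21
    have := pow_time h.hZ 21 22
    omega

theorem cntRow_le (F c : BTree) (N : ℕ) : cntRow F c N ≤ N := Nat.count_le _

theorem cntAll_le (F rows : BTree) (N : ℕ) : cntAll F rows N ≤ N * N := by
  refine (Finset.sum_le_card_nsmul _ _ N fun i _ => ?_).trans (by simp)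
  split_ifs
  · exact cntRow_le _ _ _
  · exact Nat.zero_le _

/-- `((mat, κ), (b, (lam, q))) ↦` one round of the distinguisher -/
def roundP (p : Params) : Program :=
  .seq (letc (.cons (nd 1) (nd 2)) (famP p))
  (.seq (letc (.cons (nd 1) (nd 0)) demP)
  (.seq (letc (nd 1) starP)
  (.seq (letc (tl 6) (.seq (ex (.cons X (.cons .nil X))) mulP))
  (.seq (letc (.cons (nd 5) (nd 6)) (.seq (numP p) (powP p.e)))
  (.seq (letc (.cons (nd 0) (.cons (nd 1) (.cons (nd 2) (nd 3)))) (timed p.A))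
  (.seq (letc (.cons (nd 0).head.tail (nd 4).tail) cntAllP)
  (.seq (letc (.cons (nd 1).head.tail (.cons (nd 4).head.tail .nil)) cntRowP)
  (.seq (ex (.cons (nd 0) (.cons (nd 1) (.cons (nd 4) (.cons (nd 9) (nd 10)))))) (okP p.d)))))))))

/-- The demand matrix, at `Z ^ 24`, dominates the time. Running `A` costs at most `Z ^ 2`, because
its clock `num ^ e` is below `Z`. -/
theorem sim_round (h : p.Budget n b b₂ lam Z) (mat : BTree) (κ : ℕ) {q : ℕ} (hq : q ≤ b₂) :
    Sim (roundP p) (.cons (.cons mat (.ofNat κ)) (.cons (.ofNat b) (.cons (.ofNat lam) (.ofNat q))))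
      (p.roundK b lam q (adjK mat κ)) .ofBool (Z ^ 25) := by
  have hN := h.num_le
  have hk : q * (q + 1) ≤ Z := (Nat.mul_le_mul hq (by omega)).trans h.hk
  have hkl : q * (q + 1) * lam ≤ Z :=
    (Nat.mul_le_mul_right _ (Nat.mul_le_mul hq (by omega))).trans h.hkl
  have hbZ : b ≤ Z := Nat.lt_two_pow_self.le.trans h.hb
  have h4 := pow_time h.hZ 4 23
  have h6 := pow_time h.hZ 6 23
  have h7 := pow_time h.hZ 7 23
  have h8 := pow_time h.hZ 8 9
  have h9 := pow_time h.hZ 9 23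
  have h12 := pow_time h.hZ 12 23
  have h22 := pow_time h.hZ 22 23
  have h23 := pow_time h.hZ 23 24
  have h24 := pow_time h.hZ 24 25
  have h2 := pow_time h.hZ 2 23
  refine Sim.mono (Sim.seq (Sim.letc rfl (sim_fam h)) fun f =>
    (?_ : Sim _ _ _ _ (Z ^ 24 + 4 * Z ^ 23))) (by omega)
  have hf : ∀ i j, (f i j : ℕ) ≤ Z := fun i j => (f i j).2.le.trans h.hb
  refine Sim.mono (Det.seq_sim (Det.letc rfl (det_dem h.hZ mat h.hdl hN hf)) (Det.seq_sim
    (Det.letc rfl (det_star h.hZ hN _)) (Det.seq_sim (Det.letc rfl (Det.seq (det_ex _ rfl)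
      (det_mul h.hZ (a := q) (b := q + 1) (by have := h.hb₂; omega) (by have := h.hb₂; omega))))
    (Det.seq_sim (Det.letc rfl (Det.seq (det_num h) (det_pow h.hZ hN p.e fun i hi =>
      (Nat.le_succ _).trans (h.hNe i hi)))) (Sim.seq_det (Sim.letc rfl (sim_timed p.A _ _))
      fun y => (?_ : Det _ _ (.ofBool (verify p.d b lam (q * (q + 1)) (p.famPat (adjK mat κ) f) y))
        (Z ^ 9))))))) ?_ |>.of_eq ?_
  · set P := p.famPat (adjK mat κ) f with hP
    have hv := det_cntRow h.hZ y.head.tail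
      (L := List.ofFn fun _ : Fin (p.num b lam) => edge1) (by simpa using hN) 0
    rw [zero_add, List.length_ofFn] at hv
    refine Det.mono (Det.seq (Det.letc rfl (det_cntAll h.hZ y.head.tail hN
      (fun i j => .ofBool (P i j)))) (Det.seq (Det.letc rfl hv) (Det.seq (det_ex _ rfl)
      (det_ok h.hZ (d := p.d) (k := q * (q + 1)) (lam := lam) h.hd hbZ h.hdb
        ((cntRow_le _ _ _).trans hN) ((cntAll_le _ _ _).trans h.hN) hk h.hlam hkl)))) ?_
    have := pow_time h.hZ 4 8
    omega
  · have h1 : (p.A.cost + 2 * p.A.vb + 10) * (p.num b lam ^ p.e + 1) ≤ Z ^ 2 := by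
      rw [pow_two]; exact Nat.mul_le_mul h.hA (h.hNe _ le_rfl)
    have h3 : (p.e + 1) * Z ^ 8 ≤ Z ^ 9 := by
      rw [pow_succ, mul_comm]; exact Nat.mul_le_mul le_rfl h.he
    omega
  · rw [Params.coreK, PMF.map_comp]; rfl

end RandWhile

/-! ### Programs for the distinguisher, its tests and the main loop -/

namespace RandWhile

open BTree (nth)

variable {p : Params} {n b b₂ lam Z : ℕ}

/-- `((mat, κ), (n, (b, (b₂, lam)))) ↦` answer of the distinguisher -/
def distP (p : Params) : Program :=
  anyP (nd 3) (.seq (ex X.tail) (anyP (nd 5)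
    (.seq (ex (.cons (nd 1) (.cons (nd 3) (.cons (tl 5) (nd 0))))) (roundP p))))

/-- Encoding of the parameters of a stage. -/
def encPar (n b b₂ lam : ℕ) : BTree :=
  .cons (.ofNat n) (.cons (.ofNat b) (.cons (.ofNat b₂) (.ofNat lam)))

theorem sim_dist (h : p.Budget n b b₂ lam Z) (mat : BTree) (κ : ℕ) :
    Sim (distP p) (.cons (.cons mat (.ofNat κ)) (encPar n b b₂ lam))
      (p.distK n b b₂ lam (adjK mat κ)) .ofBool (Z ^ 35) := by
  have hn : n ≤ Z := by have := h.hn; omega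
  have hb₂ : b₂ ≤ Z := by have := h.hb₂; omega
  refine sim_any h.hZ 31 35 _ hn rfl fun i _ => ?_
  refine Sim.mono (Det.seq_sim (det_ex X.tail rfl)
    (sim_any h.hZ 26 30 _ hb₂ rfl fun j hj => ?_)) ?_
  · refine Sim.mono (Det.seq_sim (det_ex _ rfl) (sim_round h mat κ (q := j + 1) (by omega))) ?_
    have := pow_time h.hZ 25 26; omega
  · have := pow_time h.hZ 30 31; omega

/-- `n ↦` a random matrix -/
def genP : Program :=
  mapP X.tail (.seq (ex X.tail) (mapP X.tail (.seq coin (ex X.head))))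

theorem sim_gen (hZ : 32 ≤ Z) (hn : n ≤ Z) :
    Sim genP (.ofNat n) (unif (Fin n → Fin n → Bool)) bitTree (Z ^ 10) := by
  refine sim_mapP hZ 6 10 (fun _ => .nil)
    (fun c : Fin n → Bool => encR fun j => .ofBool (c j)) hn (ofNat_eq_encR _) fun x => ?_
  refine Sim.mono (Det.seq_sim (det_ex X.tail rfl) (sim_mapP hZ 1 5 (fun _ => .nil)
    BTree.ofBool hn (ofNat_eq_encR _) fun y => ?_)) ?_
  · exact Sim.mono (Sim.seq_det (sim_coin _) fun c => det_ex X.head rfl) (by simp; omega)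
  · have := pow_time hZ 5 6; omega

def testP (p : Params) : Program :=
  .seq (letc (nd 2) genP) (.seq (ex (.cons (.cons (nd 0) (nd 2)) (tl 3))) (.seq (distP p)
    (.cond X (ex .nil) (ex (lit 1)))))

theorem sim_test (h : p.Budget n b b₂ lam Z) (x : BTree) (κ : ℕ) :
    Sim (testP p) (.cons x (.cons (.ofNat κ) (encPar n b b₂ lam)))
      (p.testK n b b₂ lam κ) .ofBool (Z ^ 36) := by
  have hn : n ≤ Z := by have := h.hn; omega
  refine Sim.mono (Sim.seq (Sim.letc rfl (sim_gen h.hZ hn)) fun β =>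
    (?_ : Sim _ _ _ _ (Z ^ 35 + 5))) ?_
  · refine Sim.of_eq (Sim.mono (Det.seq_sim (det_ex _ rfl) (Sim.seq_det
      (enc' := fun r => .ofBool !r) (T' := 2) (sim_dist h (bitTree β) κ) fun r => ?_)) ?_) ?_
    · cases r with
      | true => exact Sim.cond_true (fun h => by cases h) (det_ex _ rfl)
      | false => exact Sim.cond_false rfl (det_ex _ rfl)
    · omega
    · rw [PMF.map_comp]; rfl
  · have := pow_time h.hZ 10 35
    have := pow_time h.hZ 35 36
    omega

def kapP (p : Params) : Program :=
  .seq (letc (nd 0) (powP p.m)) (.seq (letc (.cons (nd 2) (nd 0)) subP)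
    (.cond (nd 0) (ex .nil) (.seq (ex (tl 2)) (anyP (nd 3) (testP p)))))

theorem sim_kap (h : p.Budget n b b₂ lam Z) {κ : ℕ} (hκ : κ ≤ n) :
    Sim (kapP p) (.cons (.ofNat κ) (encPar n b b₂ lam)) (p.kapK n b b₂ lam κ) .ofBool (Z ^ 41) := by
  have hn : n ≤ Z := by have := h.hn; omega
  have hpow : ∀ i ≤ p.m, κ ^ i ≤ Z := fun i hi => (Nat.pow_le_pow_left hκ i).trans (h.hnm i hi)
  have h3 : (p.m + 1) * Z ^ 8 ≤ Z ^ 9 := by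
    rw [pow_succ, mul_comm]; exact Nat.mul_le_mul le_rfl h.hm
  have h4 := pow_time h.hZ 4 40
  have h9 := pow_time h.hZ 9 40
  have h40 := pow_time h.hZ 40 41
  refine Sim.mono (Det.seq_sim (Det.letc rfl (det_pow h.hZ (hκ.trans hn) p.m hpow)) (Det.seq_sim
    (Det.letc rfl (det_sub h.hZ (a := n) (b := κ ^ p.m) (hpow _ le_rfl)))
    (?_ : Sim _ _ _ _ (Z ^ 40 + 3)))) (by omega)
  unfold Params.kapK
  split_ifs with hlt
  · refine Sim.cond_true (T := Z ^ 40 + 2) ?_ (Det.to_sim (Det.mono (det_ex _ rfl) (by omega)) _ rfl)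
    change BTree.ofNat (n - κ ^ p.m) ≠ _; rw [Ne, BTree.ofNat_eq_nil]; omega
  · refine Sim.cond_false (T := Z ^ 40 + 2) ?_ (Sim.mono (Det.seq_sim (det_ex _ rfl)
      (sim_any h.hZ 36 40 _ hn rfl fun i _ => sim_test h _ κ)) (by omega))
    change BTree.ofNat (n - κ ^ p.m) = _; rw [BTree.ofNat_eq_nil]; omega

def calP (p : Params) : Program := anyP (nd 2) (kapP p)

theorem sim_cal (h : p.Budget n b b₂ lam Z) :
    Sim (calP p) (encPar n b b₂ lam) (p.calK n b b₂ lam) .ofBool (Z ^ 45) :=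
  sim_any h.hZ 41 45 _ (by have := h.hn; omega) rfl fun i hi => sim_kap h hi

/-- State of the main loop: is it still running, stage, answer, data. -/
def encState (n b b₂ : ℕ) (x : BTree) (lam : ℕ) : Option Bool → BTree
  | none => .cons (.ofNat 1) (.cons (.ofNat lam) (.cons .nil
      (.cons (.ofNat n) (.cons (.ofNat b) (.cons (.ofNat b₂) x)))))
  | some r => .cons .nil (.cons (.ofNat lam) (.cons (.ofBool r)
      (.cons (.ofNat n) (.cons (.ofNat b) (.cons (.ofNat b₂) x)))))

def stageP (p : Params) : Program :=
  .seq (ex (.cons (nd 0) (.cons (.cons .nil (nd 1)) (tl 2))))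
  (.seq (letc (.cons (nd 3) (.cons (nd 4) (.cons (nd 5) (nd 1)))) (calP p))
  (.cond (nd 0) (ex (tl 1)) (.seq (ex (tl 1))
    -- The `nil` next to the matrix is `κ = 0`: nothing is planted into the input graph.
    (.seq (letc (.cons (.cons (tl 6) .nil) (.cons (nd 3) (.cons (nd 4) (.cons (nd 5) (nd 1)))))
      (distP p)) (ex (.cons .nil (.cons (nd 2) (.cons (nd 0) (tl 4)))))))))

theorem sim_stage (h : p.Budget n b b₂ (lam + 1) Z) (x : BTree) :
    Sim (stageP p) (encState n b b₂ x lam none) (p.stageK n b b₂ (lam + 1) (adjK x 0))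
      (encState n b b₂ x (lam + 1)) (Z ^ 46) := by
  have h35 := pow_time h.hZ 35 45
  have h45 := pow_time h.hZ 45 46
  refine Sim.mono (Det.seq_sim (det_ex _ rfl) (Sim.seq (Sim.letc rfl (sim_cal h)) fun fail =>
    (?_ : Sim _ _ _ _ (Z ^ 35 + 11)))) (by omega)
  cases fail with
  | true =>
    exact Sim.cond_true (T := Z ^ 35 + 10) (fun h => by cases h)
      (Det.to_sim (Det.mono (det_ex _ rfl) (by omega)) _ rfl)
  | false =>
    refine Sim.cond_false (T := Z ^ 35 + 10) rfl (Sim.of_eq (Sim.mono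
      (Det.seq_sim (det_ex _ rfl) (Sim.seq_det (enc' := fun r => encState n b b₂ x (lam + 1) (some r))
        (Sim.letc rfl (sim_dist h x 0)) fun r => det_ex _ rfl)) (by omega)) ?_)
    simp [PMF.map_comp, Function.comp_def]

/-- The algorithm for the planted clique problem. -/
def mainP (p : Params) : Program :=
  .seq (.seq (letc X lenP) (.seq (letc (nd 0) clogP) (.seq (letc (nd 0) clogP)
    (ex (.cons (lit 1) (.cons .nil (.cons .nil
      (.cons (nd 2) (.cons (nd 1) (.cons (nd 0) (tl 3))))))))))) (.seq
    (.loop X.head (stageP p)) (ex (nd 2)))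

/-- Expected value of `ψ` at the answer, if the algorithm stops within `j` stages after `lam`. -/
noncomputable def Params.value (p : Params) (n b b₂ : ℕ) (adj : ℕ → ℕ → Bool) (ψ : Bool → ℝ≥0∞) :
    ℕ → ℕ → ℝ≥0∞
  | 0, _ => 0
  | j + 1, lam => expect (p.stageK n b b₂ (lam + 1) adj) fun o =>
      o.elim (p.value n b b₂ adj ψ j (lam + 1)) ψ

/-- Induction on the number of stages that are still allowed; runs that need more stages count as
`0` in `Params.value`. The postcondition is a supremum over the answers encoded in variable `0`, so
that it is a function of the memory. -/
theorem value_le_ev_loop (x : BTree) (ψ : Bool → ℝ≥0∞) :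
    ∀ (j lam : ℕ), (∀ i < j, p.Budget n b b₂ (lam + i + 1) Z) →
    ∀ s : Store, s 0 = encState n b b₂ x lam none →
      p.value n b b₂ (adjK x 0) ψ j lam ≤ ev (j * (Z ^ 46 + 1) + 3) ([.loop X.head (stageP p), ex (nd 2)], s)
        fun _ s => ⨆ (r : Bool) (_ : s 0 = .ofBool r), ψ r := by
  intro j
  have hmono : ∀ s : Store, Monotone fun _ : ℕ => ⨆ (r : Bool) (_ : s 0 = .ofBool r), ψ r :=
    fun s => monotone_const
  induction j with
  | zero => intro lam _ s _; exact zero_le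
  | succ j ih =>
    intro lam hB s hs
    rw [show (j + 1) * (Z ^ 46 + 1) + 3 = Z ^ 46 + (j * (Z ^ 46 + 1) + 3) + 1 by ring,
      ev_loop_cons _ _ _ _ _ (by simp [Expr.eval, hs, encState, BTree.head, BTree.ofNat]), ev_cons]
    let ψ' : BTree → ℝ≥0∞ := fun y => ⨆ (o : Option Bool) (_ : y = encState n b b₂ x (lam + 1) o),
      o.elim (p.value n b b₂ (adjK x 0) ψ j (lam + 1)) ψ
    refine le_trans (expect_mono _ fun o => ?_) (sim_stage (hB 0 (by omega)) x s _
      (j * (Z ^ 46 + 1) + 3) ψ' hs (fun s => ev_monotone hmono _) fun s' hs' => ?_)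
    · exact le_iSup₂_of_le (f := fun (o' : Option Bool)
        (_ : encState n b b₂ x (lam + 1) o = encState n b b₂ x (lam + 1) o') =>
        o'.elim (p.value n b b₂ (adjK x 0) ψ j (lam + 1)) ψ) o rfl le_rfl
    · refine iSup₂_le fun o ho => ?_
      cases o with
      | none =>
        refine ih (lam + 1) (fun i hi => ?_) s' ho
        have := hB (i + 1) (by omega)
        rwa [show lam + 1 + i + 1 = lam + (i + 1) + 1 by ring]
      | some r =>
        rw [show j * (Z ^ 46 + 1) + 3 = (j * (Z ^ 46 + 1) + 1) + 2 by ring,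
          ev_loop_nil _ _ _ _ _ (by simp [Expr.eval, ho, encState, BTree.head]), ex, ev_assign, ev_nil]
        exact le_iSup₂_of_le (f := fun (r' : Bool) (_ : _ = BTree.ofBool r') => ψ r') r
          (by rw [Function.update_self]; simp [Expr.eval, nd, tl, ho, encState, BTree.head, BTree.tail])
          le_rfl

/-- The interface between programs and probability: all that the rest of the proof uses about the
main program is this bound by `Params.value`. -/
theorem value_le_outputWithin (L : List BTree) (j : ℕ) (hn : 2 * L.length ≤ Z)
    (hb : 2 * Nat.clog 2 L.length ≤ Z)
    (hB : ∀ i < j, p.Budget L.length (Nat.clog 2 L.length) (Nat.clog 2 (Nat.clog 2 L.length)) (i + 1) Z)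
    (hZ : 32 ≤ Z) (S : Set BTree) (ψ : Bool → ℝ≥0∞) (hψ : ∀ r, ψ r ≤ S.indicator (fun _ => 1) (.ofBool r))
    {T : ℕ} (hT : j * (Z ^ 46 + 1) + Z ^ 12 ≤ T) :
    p.value L.length (Nat.clog 2 L.length) (Nat.clog 2 (Nat.clog 2 L.length)) (adjK (.ofList L) 0) ψ j 0 ≤
      (outputWithin (mainP p) T (.ofList L)).toOuterMeasure {o | ∃ y, o = some y ∧ y ∈ S} := by
  rw [outputWithin_apply]
  have hmono : ∀ s : Store, Monotone fun _ : ℕ => S.indicator (fun _ => (1 : ℝ≥0∞)) (s 0) :=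
    fun s => monotone_const
  have h4 := pow_time hZ 4 11
  have h11 := pow_time hZ 11 12
  have hinit := Det.seq (Det.letc (e := X) rfl (det_len hZ (L := L) (by omega))) (Det.seq
    (Det.letc (e := nd 0) rfl (det_clog hZ hn)) (Det.seq (Det.letc (e := nd 0) rfl (det_clog hZ hb))
    (det_ex (.cons (lit 1) (.cons .nil (.cons .nil
      (.cons (nd 2) (.cons (nd 1) (.cons (nd 0) (tl 3))))))) rfl)))
  refine le_trans ?_ (ev_monotone hmono _ (show
    (Z ^ 4 + 6 + (Z ^ 11 + 6 + (Z ^ 11 + 6 + 1 + 1) + 1) + 1) + (j * (Z ^ 46 + 1) + 3 + 1) + 1 ≤ T by omega))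
  beta_reduce
  rw [start, mainP, ev_seq, ev_cons]
  set v := p.value L.length (Nat.clog 2 L.length) (Nat.clog 2 (Nat.clog 2 L.length))
    (adjK (.ofList L) 0) ψ j 0 with hv
  let ψ' : BTree → ℝ≥0∞ := fun y => ⨆ (_ : y = encState L.length (Nat.clog 2 L.length)
    (Nat.clog 2 (Nat.clog 2 L.length)) (.ofList L) 0 none), v
  refine le_trans ?_ (hinit _ _ (j * (Z ^ 46 + 1) + 3 + 1) ψ' ?_ (fun s => ev_monotone hmono _)
    fun s' hs' => ?_)
  · rw [expect_pure]
    exact le_iSup_of_le (f := fun _ => v) rfl le_rfl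
  · simp
  · refine iSup_le fun hs => ?_
    rw [ev_seq]
    refine (value_le_ev_loop (Z := Z) (.ofList L) ψ j 0 (fun i hi => by simpa using hB i hi) s' hs).trans
      (ev_mono (fun r s => iSup₂_le fun r hr => ?_) _ _)
    rw [hr]; exact hψ r

end RandWhile

namespace RandWhile

/-! ### Star instances -/

section Star

variable {N : ℕ}

theorem nth_encL (a : Fin N → BTree) (i : Fin N) : (encL a).nth i = a i := by
  rw [encL, BTree.nth_ofList, List.getD_eq_getElem _ _ (by simp)]; simp

theorem cntRow_eq (F c : BTree) (N : ℕ) : cntRow F c N =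
    ∑ j : Fin N, if ((F.nth j).truthy && (c.nth j).truthy) = true then 1 else 0 := by
  rw [cntRow, Nat.count_eq_card_filter_range, Finset.card_filter, Finset.sum_range]

/-- The leaves that are connected to the center according to `F`. -/
def leaves (N : ℕ) (F : BTree) : Finset (Fin N) := {i | (F.nth i).truthy = true}

theorem cntRow_star (F : BTree) : cntRow F (starTree N).head.tail N = (leaves N F).card := by
  have : ∀ j : Fin N, ((starTree N).head.tail.nth j) = edge1 := fun j =>
    nth_encL (fun _ : Fin N => edge1) j
  rw [cntRow_eq, leaves, Finset.card_filter]
  simp only [this, show edge1.truthy = true from rfl, Bool.and_true]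

theorem cntAll_dem (F : BTree) (P : Fin N → Fin N → Bool) : cntAll F (demTree P).tail N =
    ((leaves N F ×ˢ leaves N F).filter fun x => P x.1 x.2 = true).card := by
  have h1 : ∀ i : Fin N, ((demTree P).tail.nth i).tail = encL fun j => .ofBool (P i j) := fun i => by
    rw [show (demTree P).tail = encL fun i => .cons .nil (encL fun j => .ofBool (P i j)) from rfl,
      nth_encL]; rfl
  rw [cntAll, Finset.sum_range, Finset.card_filter, Finset.sum_product, leaves, Finset.sum_filter]
  refine Finset.sum_congr rfl fun i _ => ?_
  rw [cntRow_eq, h1, Finset.sum_filter]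
  congr 1
  refine Finset.sum_congr rfl fun j _ => ?_
  rw [nth_encL, BTree.truthy_ofBool]
  cases (F.nth j).truthy <;> cases P i j <;> simp

/-- Only the first row of the answer is read, as a set of leaves. So a passed check exhibits few
leaves with many demands even if the answer encodes no graph at all. -/
theorem verify_eq_true {d b lam k : ℕ} {P : Fin N → Fin N → Bool} {y : BTree} :
    verify d b lam k P y = true ↔
      k ≤ ((leaves N y.head.tail ×ˢ leaves N y.head.tail).filter fun x => P x.1 x.2 = true).card ∧
        2 * d * b * (leaves N y.head.tail).card ≤ k * lam := by
  rw [verify, decide_eq_true_eq, cntRow_star, cntAll_dem]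

/-- The star with center `0`. -/
def starGraph (N : ℕ) : SimpleGraph (Fin (N + 1)) where
  Adj i j := i ≠ j ∧ (i = 0 ∨ j = 0)
  symm := ⟨fun _ _ h => ⟨h.1.symm, h.2.symm⟩⟩
  loopless := ⟨fun _ h => h.1 rfl⟩

/-- The demands `P` between the leaves. -/
def starDem (P : Fin N → Fin N → Bool) : Finset (Fin (N + 1) × Fin (N + 1)) :=
  (Finset.univ.filter fun x : Fin N × Fin N => P x.1 x.2 = true).map
    ⟨fun x => (x.1.succ, x.2.succ), fun x y h => by simpa [Prod.ext_iff] using h⟩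

/-- The instance of Steiner `k`-Forest on a star with demands `P` between the leaves. -/
def starInst (P : Fin N → Fin N → Bool) (k : ℕ) (hk : 0 < k) : SteinerForestInstance where
  n := N + 1
  graph := starGraph N
  weight := fun _ => 1
  demands := starDem P
  k := k
  k_pos := hk

variable (P : Fin N → Fin N → Bool) (k : ℕ) (hk : 0 < k)

theorem mem_starDem {x : Fin (N + 1) × Fin (N + 1)} : x ∈ starDem P ↔
    ∃ i j, P i j = true ∧ x = (i.succ, j.succ) := by
  constructor
  · intro h
    obtain ⟨y, hy, rfl⟩ := Finset.mem_map.1 h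
    exact ⟨y.1, y.2, (Finset.mem_filter.1 hy).2, rfl⟩
  · rintro ⟨i, j, h, rfl⟩
    exact Finset.mem_map.2 ⟨(i, j), Finset.mem_filter.2 ⟨Finset.mem_univ _, h⟩, rfl⟩

theorem ofMatrix_succ (a : Fin (N + 1) → Fin (N + 1) → BTree) : BTree.ofMatrix a =
    .cons (.cons (a 0 0) (encL fun j => a 0 j.succ))
      (encL fun i => .cons (a i.succ 0) (encL fun j => a i.succ j.succ)) := by
  unfold BTree.ofMatrix encL
  simp only [List.ofFn_succ, BTree.ofList]

/-- The program writes down `instTree` directly; this identifies it with the encoding to which the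
guarantee of `A` applies. -/
theorem encode_starInst : (starInst P k hk).encode = instTree k P := by
  classical
  have hbin : BTree.ofNatBinary 1 = .cons (.cons .nil .nil) .nil := by
    simp [BTree.ofNatBinary, BTree.ofList, BTree.ofBool]
  unfold SteinerForestInstance.encode instTree
  congr 1; congr 1
  · refine (ofMatrix_succ (N := N) _).trans ?_
    have hpos : ∀ i j : Fin (N + 1), i ≠ j ∧ (i = 0 ∨ j = 0) →
        @ite BTree ((starInst P k hk).graph.Adj i j) (Classical.propDecidable _)
          (.cons .nil (BTree.ofNatBinary ((starInst P k hk).weight s(i, j)))) .nil = edge1 :=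
      fun i j h => (if_pos h).trans (by
        change BTree.cons .nil (BTree.ofNatBinary 1) = _
        rw [hbin]; rfl)
    have hneg : ∀ i j : Fin (N + 1), ¬ (i ≠ j ∧ (i = 0 ∨ j = 0)) →
        @ite BTree ((starInst P k hk).graph.Adj i j) (Classical.propDecidable _)
          (.cons .nil (BTree.ofNatBinary ((starInst P k hk).weight s(i, j)))) .nil = .nil :=
      fun i j h => if_neg h
    unfold starTree
    refine congrArg₂ _ (congrArg₂ _ (hneg 0 0 (by simp)) (congrArg _ (funext fun j =>
      hpos 0 j.succ (by simp [Fin.ext_iff])))) (congrArg _ (funext fun i =>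
      congrArg₂ _ (hpos i.succ 0 (by simp [Fin.ext_iff])) (congrArg _ (funext fun j =>
        hneg i.succ j.succ (by simp [Fin.ext_iff])))))
  · refine (ofMatrix_succ (N := N) _).trans ?_
    have hneg : ∀ i j : Fin (N + 1), (i = 0 ∨ j = 0) →
        BTree.ofBool (@decide ((i, j) ∈ starDem P)
          (Finset.decidableMem (_ : Fin (N + 1) × Fin (N + 1)) _)) = .nil := fun i j h => by
      rw [decide_eq_false]; · rfl
      · intro h'
        obtain ⟨i', j', -, h2⟩ := (mem_starDem P).1 h'
        rw [Prod.ext_iff] at h2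
        rcases h with h | h
        · exact Fin.succ_ne_zero i' (h2.1.symm.trans h)
        · exact Fin.succ_ne_zero j' (h2.2.symm.trans h)
    have hP : ∀ i j : Fin N,
        BTree.ofBool (@decide ((i.succ, j.succ) ∈ starDem P)
          (Finset.decidableMem (_ : Fin (N + 1) × Fin (N + 1)) _)) = .ofBool (P i j) := fun i j => by
      congr 1
      rw [Bool.eq_iff_iff, decide_eq_true_eq]
      refine (mem_starDem P).trans ⟨?_, fun h => ⟨i, j, h, rfl⟩⟩
      rintro ⟨i', j', h, h2⟩
      rw [Prod.ext_iff] at h2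
      rw [Fin.succ_injective _ h2.1, Fin.succ_injective _ h2.2]; exact h
    unfold demTree
    exact congrArg₂ _ (congrArg₂ _ (hneg 0 0 (.inl rfl)) (congrArg _ (funext fun j =>
      hneg 0 j.succ (.inl rfl)))) (congrArg _ (funext fun i =>
      congrArg₂ _ (hneg i.succ 0 (.inr rfl)) (congrArg _ (funext fun j => hP i j))))

theorem size_encL {a : Fin N → BTree} {B : ℕ} (h : ∀ i, (a i).size ≤ B) :
    (encL a).size ≤ N * (B + 1) := by
  have : ∀ L : List BTree, (∀ t ∈ L, t.size ≤ B) → (BTree.ofList L).size ≤ L.length * (B + 1) := by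
    intro L hL
    induction L with
    | nil => simp [BTree.ofList, BTree.size]
    | cons t L ih =>
      have h1 := ih fun t ht => hL t (List.mem_cons_of_mem _ ht)
      have h2 := hL t List.mem_cons_self
      rw [BTree.ofList, BTree.size, List.length_cons, add_mul]; omega
  refine (this _ fun t ht => ?_).trans (by simp)
  obtain ⟨i, rfl⟩ := List.mem_ofFn.1 ht
  exact h i

theorem size_ofNat (k : ℕ) : (BTree.ofNat k).size = k := by
  induction k with
  | zero => rfl
  | succ k ih => simp [BTree.ofNat, BTree.size, ih]

/-- The size is quadratic in `N`; the cube absorbs the constants. -/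
theorem size_instTree (hN : 32 ≤ N) (hkN : k ≤ N) : (instTree k P).size ≤ N ^ 3 := by
  have h1 : (encL fun _ : Fin N => edge1).size ≤ N * (3 + 1) := size_encL fun _ => le_rfl
  have h2 : (encL fun _ : Fin N => BTree.nil).size ≤ N * (0 + 1) := size_encL fun _ => le_rfl
  have h3 : (encL fun _ : Fin N => .cons edge1 (encL fun _ : Fin N => BTree.nil)).size ≤
      N * ((N + 4) + 1) := size_encL fun _ => by
    rw [BTree.size, show edge1.size = 3 from rfl]; omega
  have h4 : (encL fun i => .cons .nil (encL fun j => .ofBool (P i j))).size ≤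
      N * ((2 * N + 1) + 1) := size_encL fun i => by
    have : (encL fun j => .ofBool (P i j)).size ≤ N * (1 + 1) := size_encL fun j => by
      cases P i j <;> simp [BTree.ofBool, BTree.size]
    simp only [BTree.size]; omega
  simp only [instTree, starTree, demTree, BTree.size, size_ofNat]
  have h5 : 32 * (N * N) ≤ N ^ 3 := by
    rw [show N ^ 3 = N * (N * N) by ring]; exact Nat.mul_le_mul_right _ hN
  have h6 : 32 * N ≤ N * N := Nat.mul_le_mul_right _ hN
  ring_nf at h1 h2 h3 h4 h5 h6 ⊢
  omega

theorem leaves_encodeGraph (H : SimpleGraph (Fin (N + 1))) (i : Fin N) :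
    i ∈ leaves N (encodeGraph H).head.tail ↔ H.Adj 0 i.succ := by
  classical
  have : (encodeGraph H).head.tail = encL fun j : Fin N => .ofBool (decide (H.Adj 0 j.succ)) := by
    unfold encodeGraph BTree.ofMatrix encL
    rw [List.ofFn_succ, BTree.ofList, List.ofFn_succ, BTree.ofList]; rfl
  rw [this, leaves, Finset.mem_filter, nth_encL, BTree.truthy_ofBool]
  simp

/-- The first edge of a walk that leaves a leaf of a star goes to the center. -/
theorem adj_of_reachable {H : SimpleGraph (Fin (N + 1))} (hH : H ≤ starGraph N) {i j : Fin N}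
    (hij : i ≠ j) (h : H.Reachable i.succ j.succ) : H.Adj 0 i.succ := by
  obtain ⟨w⟩ := h
  have hnil : ¬ w.Nil := fun h => hij (Fin.succ_injective _ h.eq)
  have h1 := w.adj_snd hnil
  rcases (hH h1).2 with h0 | h0
  · exact absurd h0 (Fin.succ_ne_zero i)
  · rw [h0] at h1; exact h1.symm

variable {P k hk}

theorem isSolution_starInst {H : SimpleGraph (Fin (N + 1))} : (starInst P k hk).IsSolution H ↔
    H ≤ starGraph N ∧ k ≤ {x | x ∈ starDem P ∧ H.Reachable x.1 x.2}.ncard := Iff.rfl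

theorem cost_starInst (H : SimpleGraph (Fin (N + 1))) :
    (starInst P k hk).cost H = H.edgeSet.ncard := by
  unfold SteinerForestInstance.cost
  refine (Finset.card_eq_sum_ones _).symm.trans ((Set.ncard_coe_finset _).symm.trans ?_)
  refine congrArg Set.ncard (Set.ext fun e => ?_)
  rw [Finset.mem_coe]; simp only [SimpleGraph.edgeFinset, Set.mem_toFinset]; exact Iff.rfl

/-- A cheap solution passes the check. -/
theorem verify_of_isSolution {d b lam : ℕ} (hP : ∀ i, P i i = false) {H : SimpleGraph (Fin (N + 1))}
    (h : (starInst P k hk).IsSolution H)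
    (hc : 2 * d * b * (starInst P k hk).cost H ≤ k * lam) :
    verify d b lam k P (encodeGraph H) = true := by
  classical
  rw [verify_eq_true]
  rw [isSolution_starInst] at h
  rw [cost_starInst] at hc
  constructor
  · refine h.2.trans ?_
    rw [← Finset.card_map (⟨fun x => (x.1.succ, x.2.succ), fun x y h => by
      simpa [Prod.ext_iff] using h⟩ : Fin N × Fin N ↪ Fin (N + 1) × Fin (N + 1)),
      ← Set.ncard_coe_finset]
    refine Set.ncard_le_ncard ?_ (Finset.finite_toSet _)
    rintro x ⟨hx, hr⟩
    obtain ⟨i, j, hij, rfl⟩ := (mem_starDem P).1 hx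
    have hne : i ≠ j := fun e => by rw [e, hP] at hij; cases hij
    simp only [Finset.coe_map, Set.mem_image, Finset.mem_coe, Finset.mem_filter, Finset.mem_product]
    exact ⟨(i, j), ⟨⟨(leaves_encodeGraph H i).2 (adj_of_reachable h.1 hne hr),
      (leaves_encodeGraph H j).2 (adj_of_reachable h.1 hne.symm hr.symm)⟩, hij⟩, rfl⟩
  · refine le_trans (Nat.mul_le_mul_left _ ?_) hc
    rw [← Set.ncard_coe_finset]
    refine Set.ncard_le_ncard_of_injOn (fun i => s(0, i.succ)) (fun i hi => ?_) ?_ (Set.toFinite _)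
    · exact (leaves_encodeGraph H i).1 hi
    · intro i _ j _ hij
      simpa using hij

/-- If the demands contain a clique on `q + 1` leaves, then they can be met at cost `q + 1`. -/
theorem exists_solution_of_clique {q : ℕ} (hP : ∀ i, P i i = false) (hkq : k = q * (q + 1))
    (c : Fin (q + 1) → Fin N) (hc : ∀ r r', r ≠ r' → P (c r) (c r') = true) :
    ∃ H, (starInst P k hk).IsSolution H ∧ (starInst P k hk).cost H ≤ q + 1 := by
  classical
  have hinj : Function.Injective c := fun r r' h => by
    by_contra hne; have := hc r r' hne; rw [h, hP] at this; cases this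
  let H : SimpleGraph (Fin (N + 1)) := SimpleGraph.fromRel fun u v => u = 0 ∧ ∃ r, v = (c r).succ
  have hH : ∀ r, H.Adj 0 (c r).succ := fun r => by
    rw [SimpleGraph.fromRel_adj]
    exact ⟨(Fin.succ_ne_zero _).symm, .inl ⟨rfl, r, rfl⟩⟩
  refine ⟨H, isSolution_starInst.2 ⟨?_, ?_⟩, ?_⟩
  · intro u v huv
    rw [SimpleGraph.fromRel_adj] at huv
    refine ⟨huv.1, ?_⟩
    rcases huv.2 with h | h
    · exact .inl h.1
    · exact .inr h.1
  -- Demands are ordered pairs, so `q + 1` pairwise joined leaves give `q * (q + 1)` of them.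
  · have : k = ((Finset.univ : Finset (Fin (q + 1))).offDiag.image fun x =>
        ((c x.1).succ, (c x.2).succ)).card := by
      rw [Finset.card_image_of_injective, Finset.offDiag_card, Finset.card_univ, Fintype.card_fin, hkq]
      · rw [show (q + 1) * (q + 1) = q * (q + 1) + (q + 1) by ring]; omega
      · intro x y hxy
        simp only [Prod.ext_iff, Fin.succ_inj] at hxy
        exact Prod.ext (hinj hxy.1) (hinj hxy.2)
    rw [this, ← Set.ncard_coe_finset]
    refine Set.ncard_le_ncard ?_ (Set.toFinite _)
    intro x hx
    simp only [Finset.coe_image, Set.mem_image, Finset.mem_coe, Finset.mem_offDiag] at hx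
    obtain ⟨⟨r, r'⟩, ⟨-, -, hne⟩, rfl⟩ := hx
    exact ⟨(mem_starDem P).2 ⟨_, _, hc r r' hne, rfl⟩,
      (hH r).symm.reachable.trans (hH r').reachable⟩
  · rw [cost_starInst]
    refine (Set.ncard_le_ncard (t := ↑(Finset.univ.image fun r : Fin (q + 1) => s(0, (c r).succ)))
      (fun e he => ?_) (Finset.finite_toSet _)).trans
        ((Set.ncard_coe_finset _).le.trans (Finset.card_image_le.trans (by simp)))
    induction e with
    | _ u v =>
    rw [SimpleGraph.mem_edgeSet, SimpleGraph.fromRel_adj] at he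
    simp only [Finset.coe_image, Finset.coe_univ, Set.image_univ, Set.mem_range]
    rcases he.2 with ⟨rfl, r, rfl⟩ | ⟨rfl, r, rfl⟩
    · exact ⟨r, rfl⟩
    · exact ⟨r, Sym2.eq_swap⟩

end Star

end RandWhile

namespace RandWhile

open MeasureTheory (measure_biUnion_finset_le measure_mono)

/-! ### Probability -/

section Probability

theorem expect_comm {α β : Type*} (μ : PMF α) (ν : PMF β) (φ : α → β → ℝ≥0∞) :
    expect μ (fun a => expect ν (φ a)) = expect ν fun b => expect μ fun a => φ a b := by
  unfold expect
  simp only [← ENNReal.tsum_mul_left]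
  rw [ENNReal.tsum_comm]
  congr 1; ext b; congr 1; ext a; ring

theorem bind_apply_eq {α β : Type*} (μ : PMF α) (κ : α → PMF β) (b : β) :
    (μ.bind κ) b = expect μ fun a => κ a b := PMF.bind_apply _ _ _

theorem unif_toOuterMeasure {α : Type*} [Fintype α] [Nonempty α] (S : Finset α) :
    (unif α).toOuterMeasure S = S.card / Fintype.card α := by
  classical
  rw [PMF.toOuterMeasure_uniformOfFintype_apply]
  simp

theorem unif_pi {ι β : Type} [Fintype ι] [DecidableEq ι] [Fintype β] [Nonempty β]
    (T : ι → Finset β) : (unif (ι → β)).toOuterMeasure {f | ∀ i, f i ∈ T i} =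
      ∏ i, ((T i).card / Fintype.card β : ℝ≥0∞) := by
  have : {f : ι → β | ∀ i, f i ∈ T i} = ((Fintype.piFinset T : Finset (ι → β)) : Set (ι → β)) := by
    ext f; simp
  rw [this, unif_toOuterMeasure, Fintype.card_piFinset, Fintype.card_fun]
  simp only [div_eq_mul_inv]
  rw [Finset.prod_mul_distrib, Finset.prod_const, Finset.card_univ]
  push_cast
  rw [ENNReal.inv_pow]

theorem unif_pi_mem {ι β : Type} [Fintype ι] [DecidableEq ι] [Fintype β] [Nonempty β]
    (W : Finset ι) (T : Finset β) : (unif (ι → β)).toOuterMeasure {f | ∀ i ∈ W, f i ∈ T} =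
      (T.card / Fintype.card β : ℝ≥0∞) ^ W.card := by
  have : {f : ι → β | ∀ i ∈ W, f i ∈ T} = {f | ∀ i, f i ∈ if i ∈ W then T else Finset.univ} := by
    ext f
    refine forall_congr' fun i => ?_
    split_ifs with h <;> simp [h]
  rw [this, unif_pi, ← Finset.prod_const, ← Finset.prod_subset (Finset.subset_univ W)]
  · exact Finset.prod_congr rfl fun i hi => by rw [if_pos hi]
  · intro i _ hi
    rw [if_neg hi, Finset.card_univ]
    exact ENNReal.div_self (by simp) (by simp)

theorem orIter_true_le (p : ℕ → PMF Bool) (N : ℕ) :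
    orIter p N true ≤ ∑ i ∈ Finset.range N, p i true := by
  induction N with
  | zero => simp [orIter]
  | succ N ih =>
    rw [Finset.sum_range_succ, orIter, bind_apply_eq]
    refine le_trans (expect_mono _ (ψ := fun a => (({true} : Set Bool).indicator (fun _ => 1) a) + p N true)
      fun a => ?_) ?_
    · cases a
      · simp [PMF.map_apply]
      · exact (PMF.coe_le_one _ _).trans (by simp)
    · rw [expect_add, expect_indicator, expect_const, PMF.toOuterMeasure_apply_singleton]
      gcongr

theorem orIter_false (p : ℕ → PMF Bool) (N : ℕ) :
    orIter p N false = ∏ i ∈ Finset.range N, p i false := by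
  induction N with
  | zero => simp [orIter]
  | succ N ih =>
    rw [Finset.prod_range_succ, orIter, bind_apply_eq, ← ih]
    unfold expect
    rw [tsum_bool]
    simp [PMF.map_apply]

theorem two_pow_mul_inv (x y : ℕ) : (2 : ℝ≥0∞) ^ x * 2⁻¹ ^ (x + y) = 2⁻¹ ^ y := by
  rw [pow_add, ← mul_assoc, ← mul_pow, ENNReal.mul_inv_cancel (by simp) (by simp), one_pow, one_mul]

theorem two_pow_mul_inv_le {x y z : ℕ} (h : x + y ≤ z) : (2 : ℝ≥0∞) ^ x * 2⁻¹ ^ z ≤ 2⁻¹ ^ y := by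
  rw [← two_pow_mul_inv x y]
  gcongr 2 ^ x * ?_
  exact pow_le_pow_right_of_le_one' (by simp) h

end Probability

/-! ### Random graphs -/

section Graphs

variable {n : ℕ}

/-- The number of graphs with given edges. -/
theorem card_graph_mul_le [Fintype (SimpleGraph (Fin n))] (E : Finset (Sym2 (Fin n)))
    (S : Finset (SimpleGraph (Fin n))) (hS : ∀ G ∈ S, (E : Set (Sym2 (Fin n))) ⊆ G.edgeSet) :
    S.card * 2 ^ E.card ≤ Fintype.card (SimpleGraph (Fin n)) := by
  classical
  rw [← Finset.card_powerset, ← Finset.card_product, ← Finset.card_univ]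
  -- Deleting a set `Y ⊆ E` from a graph that contains all of `E` can be undone: `Y` is what is
  -- missing from `E`.
  refine Finset.card_le_card_of_injOn (fun x => x.1.deleteEdges x.2) (fun _ _ => Finset.mem_univ _) ?_
  rintro ⟨G, Y⟩ h ⟨G', Y'⟩ h' heq
  simp only [Finset.coe_product, Set.mem_prod, Finset.mem_coe, Finset.mem_powerset] at h h'
  have hE : G.edgeSet \ Y = G'.edgeSet \ Y' := by
    rw [← SimpleGraph.edgeSet_deleteEdges, ← SimpleGraph.edgeSet_deleteEdges]
    exact congrArg _ heq
  have hG := hS G h.1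
  have hG' := hS G' h'.1
  have hY : Y = Y' := by
    ext e
    have h1 := Set.ext_iff.1 hE e
    simp only [Set.mem_sdiff, Finset.mem_coe] at h1
    constructor
    · intro he
      by_contra hne
      exact (h1.2 ⟨hG' (h.2 he), hne⟩).2 he
    · intro he
      by_contra hne
      exact (h1.1 ⟨hG (h'.2 he), hne⟩).2 he
  subst hY
  refine Prod.ext (SimpleGraph.edgeSet_injective ?_) rfl
  ext e
  have h1 := Set.ext_iff.1 hE e
  simp only [Set.mem_sdiff, Finset.mem_coe] at h1
  by_cases he : e ∈ Y
  · exact ⟨fun _ => hG' (h.2 he), fun _ => hG (h.2 he)⟩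
  · exact ⟨fun h => (h1.1 ⟨h, he⟩).1, fun h => (h1.2 ⟨h, he⟩).1⟩

open Classical in
/-- Adjacency in `G`, as a relation on numbers. -/
noncomputable def gadj (G : SimpleGraph (Fin n)) (x y : ℕ) : Bool :=
  decide (∃ (hx : x < n) (hy : y < n), G.Adj ⟨x, hx⟩ ⟨y, hy⟩)

theorem gadj_eq_true {G : SimpleGraph (Fin n)} {x y : ℕ} :
    gadj G x y = true ↔ ∃ (hx : x < n) (hy : y < n), G.Adj ⟨x, hx⟩ ⟨y, hy⟩ := by
  simp [gadj]

theorem gadj_self (G : SimpleGraph (Fin n)) (x : ℕ) : gadj G x x = false := by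
  simp [gadj]

/-- A random graph contains many given edges with small probability. -/
theorem erdosRenyiHalf_forall_adj_le (D : Finset (ℕ × ℕ)) {M : ℕ} (hM : 2 * M ≤ D.card) :
    (erdosRenyiHalf n).toOuterMeasure {G | ∀ x ∈ D, gadj G x.1 x.2 = true} ≤ 2⁻¹ ^ M := by
  classical
  let S : Finset (SimpleGraph (Fin n)) := {G | ∀ x ∈ D, gadj G x.1 x.2 = true}
  have hS : {G : SimpleGraph (Fin n) | ∀ x ∈ D, gadj G x.1 x.2 = true} = S := by
    ext G; simp [S]
  -- As soon as one graph satisfies all conditions, no pair in `D` is a loop or out of range, so `D`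
  -- consists of genuine edges.
  rcases S.eq_empty_or_nonempty with h0 | ⟨G₀, hG₀⟩
  · rw [hS, h0]; simp
  have hG₀' : ∀ x ∈ D, gadj G₀ x.1 x.2 = true := by simpa [S] using hG₀
  let E : Finset (Sym2 (Fin n)) := {e | ∃ x y : Fin n, ((x : ℕ), (y : ℕ)) ∈ D ∧ e = s(x, y)}
  -- `D` may contain an edge in both orders, whence the factor `2` in `hM`.
  have hE : D.card ≤ E.card * 2 := by
    have hsub : D ⊆ E.biUnion fun e =>
        (Finset.univ.filter fun z : Fin n × Fin n => s(z.1, z.2) = e).image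
          fun z => ((z.1 : ℕ), (z.2 : ℕ)) := by
      rintro ⟨x, y⟩ hxy
      obtain ⟨hx, hy, -⟩ := gadj_eq_true.1 (hG₀' _ hxy)
      simp only [Finset.mem_biUnion, Finset.mem_image, Finset.mem_filter, Finset.mem_univ, true_and]
      exact ⟨s(⟨x, hx⟩, ⟨y, hy⟩), Finset.mem_filter.2 ⟨Finset.mem_univ _, ⟨x, hx⟩, ⟨y, hy⟩, hxy, rfl⟩,
        (⟨x, hx⟩, ⟨y, hy⟩), rfl, rfl⟩
    refine (Finset.card_le_card hsub).trans (Finset.card_biUnion_le_card_mul _ _ _ fun e _ => ?_)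
    refine Finset.card_image_le.trans ?_
    induction e with
    | _ u v =>
    refine (Finset.card_le_card (t := {(u, v), (v, u)}) ?_).trans Finset.card_le_two
    rintro ⟨x, y⟩ h
    simpa [Sym2.eq_iff] using h
  have hc := card_graph_mul_le E S fun G hG e he => by
    have hG' : ∀ x ∈ D, gadj G x.1 x.2 = true := by simpa [S] using hG
    simp only [E, Finset.coe_filter, Finset.mem_univ, true_and] at he
    obtain ⟨x, y, h, rfl⟩ := he
    obtain ⟨hx, hy, h2⟩ := gadj_eq_true.1 (hG' _ h)
    exact h2
  have hc' : S.card * 2 ^ M ≤ Fintype.card (SimpleGraph (Fin n)) :=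
    (Nat.mul_le_mul_left _ (Nat.pow_le_pow_right (by norm_num) (by omega))).trans hc
  have h1 : (erdosRenyiHalf n).toOuterMeasure S = S.card / Fintype.card (SimpleGraph (Fin n)) := by
    unfold erdosRenyiHalf
    convert unif_toOuterMeasure S
  rw [hS, h1]
  refine ENNReal.div_le_of_le_mul ?_
  calc (S.card : ℝ≥0∞) = 2⁻¹ ^ M * (S.card * 2 ^ M) := by
        rw [mul_comm, mul_assoc, ← mul_pow, ENNReal.mul_inv_cancel (by simp) (by simp), one_pow,
          mul_one]
    _ ≤ 2⁻¹ ^ M * (Fintype.card (SimpleGraph (Fin n)) : ℝ≥0∞) := by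
        gcongr; exact_mod_cast hc'

end Graphs

end RandWhile

namespace RandWhile

open MeasureTheory (measure_biUnion_finset_le measure_mono)

/-! ### Soundness of the distinguisher -/

section Sound

variable {N l b B : ℕ}

/-- Every small subfamily covers many points. -/
def Expanding (b lam : ℕ) (f : Fin N → Fin l → Fin B) : Prop :=
  ∀ W : Finset (Fin N), W.Nonempty → W.card ≤ b →
    lam * W.card ≤ (W.biUnion fun i => Finset.univ.image (f i)).card

/-- In an expanding family the sets of a small subfamily have disjoint large subsets. -/
theorem Expanding.exists_injective {lam : ℕ} {f : Fin N → Fin l → Fin B} (hf : Expanding b lam f)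
    {W : Finset (Fin N)} (hW : W.card ≤ b) : ∃ x : W × Fin lam → Fin B, Function.Injective x ∧
      ∀ i, x i ∈ Finset.univ.image (f i.1) := by
  classical
  -- Hall's theorem with `lam` copies of each set. Expansion of the family `W'` underlying `s` gives
  -- Hall's condition, since `s` has at most `lam * W'.card` elements.
  refine (Finset.all_card_le_biUnion_card_iff_exists_injective
    fun i : W × Fin lam => Finset.univ.image (f i.1)).1 fun s => ?_
  rcases s.eq_empty_or_nonempty with rfl | hs
  · simp
  let W' : Finset (Fin N) := s.image fun x => (x.1 : Fin N)
  have hW' : W' ⊆ W := by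
    intro i hi
    obtain ⟨x, -, rfl⟩ := Finset.mem_image.1 hi
    exact x.1.2
  have h1 := hf W' (hs.image _) ((Finset.card_le_card hW').trans hW)
  have h2 : (W'.biUnion fun i => Finset.univ.image (f i)) ⊆
      s.biUnion fun i => Finset.univ.image (f i.1) := by
    intro y hy
    obtain ⟨i, hi, hy⟩ := Finset.mem_biUnion.1 hy
    obtain ⟨x, hx, rfl⟩ := Finset.mem_image.1 hi
    exact Finset.mem_biUnion.2 ⟨x, hx, hy⟩
  have h3 : s.card ≤ lam * W'.card := by
    have : (s.image fun x => ((x.1 : Fin N), x.2)).card = s.card :=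
      Finset.card_image_of_injective _ fun x y h => by
        simp only [Prod.ext_iff] at h
        exact Prod.ext (Subtype.ext h.1) h.2
    rw [← this, mul_comm]
    refine (Finset.card_le_card (t := W' ×ˢ (Finset.univ : Finset (Fin lam))) ?_).trans
      (by rw [Finset.card_product]; simp)
    intro y hy
    obtain ⟨x, hx, rfl⟩ := Finset.mem_image.1 hy
    exact Finset.mem_product.2 ⟨Finset.mem_image.2 ⟨x, hx, rfl⟩, Finset.mem_univ _⟩
  exact h3.trans (h1.trans (Finset.card_le_card h2))

/-- Random families are expanding. -/
theorem unif_not_expanding {a lam : ℕ} (hN : N = 2 ^ (b * (a * lam))) (hl : l = (a + 8) * lam)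
    (hlam : 1 ≤ lam) (hlb : lam ≤ b) (hb : (b * b) ^ (a + 8) ≤ 2 ^ b) :
    (unif (Fin N → Fin l → Fin (2 ^ b))).toOuterMeasure {f | ¬ Expanding b lam f} ≤
      2⁻¹ ^ (5 * b) := by
  classical
  have hbb : b * b ≤ 2 ^ b := (Nat.le_self_pow (by omega) _).trans hb
  -- If `W` violates expansion, then all its tuples lie in a set `U` of exactly `lam * w` points.
  -- For fixed `W` and `U` this has probability `(lam * w / 2 ^ b) ^ (l * w)`.
  have hsub : {f : Fin N → Fin l → Fin (2 ^ b) | ¬ Expanding b lam f} ⊆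
      ⋃ w ∈ Finset.Icc 1 b, ⋃ W ∈ Finset.powersetCard w (Finset.univ : Finset (Fin N)),
        ⋃ U ∈ Finset.powersetCard (lam * w) (Finset.univ : Finset (Fin (2 ^ b))),
          {f | ∀ i ∈ W, f i ∈ Fintype.piFinset fun _ : Fin l => U} := by
    intro f hf
    simp only [Set.mem_ofPred_eq, Expanding, not_forall] at hf
    obtain ⟨W, hW0, hWb, hlt⟩ := hf
    have hcard : lam * W.card ≤ (Finset.univ : Finset (Fin (2 ^ b))).card := by
      rw [Finset.card_univ, Fintype.card_fin]
      exact (Nat.mul_le_mul hlb hWb).trans hbb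
    obtain ⟨U, hU, -, hUc⟩ := Finset.exists_subsuperset_card_eq (Finset.subset_univ _)
      (not_le.1 hlt).le hcard
    simp only [Set.mem_iUnion, exists_prop]
    refine ⟨W.card, Finset.mem_Icc.2 ⟨hW0.card_pos, hWb⟩, W,
      Finset.mem_powersetCard.2 ⟨Finset.subset_univ _, rfl⟩, U,
      Finset.mem_powersetCard.2 ⟨Finset.subset_univ _, hUc⟩, fun i hi => ?_⟩
    rw [Fintype.mem_piFinset]
    exact fun x => hU (Finset.mem_biUnion.2 ⟨i, hi, Finset.mem_image_of_mem _ (Finset.mem_univ _)⟩)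
  refine (measure_mono hsub).trans ?_
  have hterm : ∀ w ∈ Finset.Icc 1 b, (unif (Fin N → Fin l → Fin (2 ^ b))).toOuterMeasure
      (⋃ W ∈ Finset.powersetCard w (Finset.univ : Finset (Fin N)),
        ⋃ U ∈ Finset.powersetCard (lam * w) (Finset.univ : Finset (Fin (2 ^ b))),
          {f | ∀ i ∈ W, f i ∈ Fintype.piFinset fun _ : Fin l => U}) ≤ 2⁻¹ ^ (6 * b) := by
    intro w hw
    rw [Finset.mem_Icc] at hw
    let s := lam * w
    have hs : 1 ≤ s := Nat.mul_pos hlam hw.1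
    have hsd : s ^ (a + 8) ≤ 2 ^ b :=
      (Nat.pow_le_pow_left (Nat.mul_le_mul hlb hw.2) _).trans hb
    have hone : ∀ W ∈ Finset.powersetCard w (Finset.univ : Finset (Fin N)),
        ∀ U ∈ Finset.powersetCard (lam * w) (Finset.univ : Finset (Fin (2 ^ b))),
        (unif (Fin N → Fin l → Fin (2 ^ b))).toOuterMeasure
          {f | ∀ i ∈ W, f i ∈ Fintype.piFinset fun _ : Fin l => U} ≤
            2 ^ (b * s) * 2⁻¹ ^ (b * ((a + 8) * s)) := by
      intro W hW U hU
      rw [unif_pi_mem, Fintype.card_piFinset, (Finset.mem_powersetCard.1 hW).2]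
      simp only [Finset.prod_const, Finset.card_univ, Fintype.card_fin, Fintype.card_fun,
        (Finset.mem_powersetCard.1 hU).2]
      push_cast
      rw [div_eq_mul_inv, ENNReal.inv_pow, ← mul_pow, ← pow_mul, hl,
        show (a + 8) * lam * w = (a + 8) * s by simp only [s]; ring, mul_pow, ENNReal.inv_pow,
        ← pow_mul (2⁻¹ : ℝ≥0∞)]
      refine mul_le_mul' ?_ le_rfl
      have : s ^ ((a + 8) * s) ≤ 2 ^ (b * s) := by
        have := Nat.pow_le_pow_left hsd s
        rwa [← pow_mul, ← pow_mul] at this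
      exact_mod_cast this
    refine (measure_biUnion_finset_le _ _).trans ?_
    refine (Finset.sum_le_sum fun W hW => (measure_biUnion_finset_le _ _).trans
      (Finset.sum_le_sum fun U hU => hone W hW U hU)).trans ?_
    rw [Finset.sum_const, Finset.sum_const, Finset.card_powersetCard, Finset.card_powersetCard,
      Finset.card_univ, Finset.card_univ, Fintype.card_fin, Fintype.card_fin, nsmul_eq_mul,
      nsmul_eq_mul]
    have h1 : ((N.choose w : ℕ) : ℝ≥0∞) ≤ 2 ^ (b * (a * s)) := by
      have := Nat.choose_le_pow N w
      rw [hN, ← pow_mul, show b * (a * lam) * w = b * (a * s) by simp only [s]; ring] at this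
      rw [hN]
      exact_mod_cast this
    have h2 : (((2 ^ b).choose (lam * w) : ℕ) : ℝ≥0∞) ≤ 2 ^ (b * s) := by
      have := Nat.choose_le_pow (2 ^ b) (lam * w)
      rw [← pow_mul] at this
      exact_mod_cast this
    refine (mul_le_mul' h1 (mul_le_mul' h2 le_rfl)).trans ?_
    -- With `s = lam * w`, the choices of `W` and `U` and the numerator `s ^ ((a + 8) * s)` cost `b
    -- * a * s`, `b * s` and `b * s` bits, against `b * (a + 8) * s` in the denominator. At least `6
    -- * b * s` bits remain.
    rw [← mul_assoc, ← mul_assoc, ← pow_add, ← pow_add]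
    refine two_pow_mul_inv_le ?_
    have : b * 1 ≤ b * s := Nat.mul_le_mul_left _ hs
    have h3 : b * ((a + 8) * s) = b * (a * s) + 8 * (b * s) := by ring
    omega
  refine (measure_biUnion_finset_le _ _).trans ((Finset.sum_le_sum hterm).trans ?_)
  rw [Finset.sum_const, nsmul_eq_mul, Nat.card_Icc, Nat.add_sub_cancel]
  have : (b : ℝ≥0∞) ≤ 2 ^ b := by exact_mod_cast Nat.lt_two_pow_self.le
  exact (mul_le_mul' this le_rfl).trans (two_pow_mul_inv_le (by omega))

variable (p : Params)

theorem famPat_eq_true {lam : ℕ} {adj : ℕ → ℕ → Bool} {f : p.Fam b lam} {i j : Fin (p.num b lam)} :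
    p.famPat adj f i j = true ↔ ∀ x y, adj (f i x) (f j y) = true := by
  simp [Params.famPat, pat]

/-- The pairs that are joined and an upper bound on the number of sets in a witness that the
distinguisher accepts. -/
def Params.Witness {lam : ℕ} (k : ℕ) (adj : ℕ → ℕ → Bool) (f : p.Fam b lam)
    (W : Finset (Fin (p.num b lam))) : Prop :=
  k ≤ ((W ×ˢ W).filter fun x => p.famPat adj f x.1 x.2 = true).card ∧
    2 * p.d * b * W.card ≤ k * lam

/-- The benefit of checking the answer: nothing is assumed about `A`, and yet acceptance requires a
witness in the family. -/
theorem coreK_true_le {lam q : ℕ} {adj : ℕ → ℕ → Bool} {f : p.Fam b lam} :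
    p.coreK b lam q (p.famPat adj f) true ≤
      {f | ∃ W, p.Witness (q * (q + 1)) adj f W}.indicator (fun _ => 1) f := by
  by_cases h : ∃ W, p.Witness (q * (q + 1)) adj f W
  · rw [Set.indicator_of_mem (by exact h)]; exact PMF.coe_le_one _ _
  · rw [Set.indicator_of_notMem (by exact h), Params.coreK, PMF.map_apply]
    refine le_of_eq (ENNReal.tsum_eq_zero.2 fun y => ?_)
    rw [if_neg]
    exact fun hy => h ⟨_, verify_eq_true.1 hy.symm⟩

/-- For an expanding family, a random graph has no witness. -/
theorem erdosRenyiHalf_witness_le {n k lam : ℕ} (hd : p.d = p.a + 8) {f : p.Fam b lam}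
    (hf : Expanding b lam f) (hlam : 1 ≤ lam) (hlb : lam ≤ b) (hk : 1 ≤ k) (hkb : k ≤ b) :
    (erdosRenyiHalf n).toOuterMeasure {G | ∃ W, p.Witness k (gadj G) f W} ≤ 2⁻¹ ^ (6 * b) := by
  classical
  let N := p.num b lam
  have hsub : {G : SimpleGraph (Fin n) | ∃ W, p.Witness k (gadj G) f W} ⊆
      ⋃ w ∈ (Finset.Icc 1 b).filter (fun w => 2 * p.d * b * w ≤ k * lam),
        ⋃ W ∈ Finset.powersetCard w (Finset.univ : Finset (Fin N)),
        ⋃ F ∈ (W ×ˢ W).powerset.filter (fun F => k ≤ F.card),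
          {G | ∀ x ∈ F, p.famPat (gadj G) f x.1 x.2 = true} := by
    rintro G ⟨W, h1, h2⟩
    have hW0 : 1 ≤ W.card := by
      by_contra h0
      have : W = ∅ := Finset.card_eq_zero.1 (by omega)
      subst this
      simp at h1; omega
    -- Follows from `2 * d * b * W.card ≤ k * lam ≤ b * b`. It is needed because expansion only
    -- concerns subfamilies of at most `b` sets.
    have hWb : W.card ≤ b := by
      by_contra hlt
      have h3 : k * lam ≤ b * b := Nat.mul_le_mul hkb hlb
      have h4 : b * (b + 1) ≤ b * W.card := Nat.mul_le_mul_left _ (by omega)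
      have h5 : 1 * (b * W.card) ≤ 2 * p.d * (b * W.card) := Nat.mul_le_mul_right _ (by omega)
      have h6 : 2 * p.d * b * W.card = 2 * p.d * (b * W.card) := by ring
      have h7 : b * (b + 1) = b * b + b := by ring
      omega
    simp only [Set.mem_iUnion, exists_prop]
    refine ⟨W.card, Finset.mem_filter.2 ⟨Finset.mem_Icc.2 ⟨hW0, hWb⟩, h2⟩, W,
      Finset.mem_powersetCard.2 ⟨Finset.subset_univ _, rfl⟩, _,
      Finset.mem_filter.2 ⟨Finset.mem_powerset.2 (Finset.filter_subset _ _), h1⟩, fun x hx =>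
        (Finset.mem_filter.1 hx).2⟩
  refine (measure_mono hsub).trans ?_
  have hterm : ∀ w ∈ (Finset.Icc 1 b).filter (fun w => 2 * p.d * b * w ≤ k * lam),
      (erdosRenyiHalf n).toOuterMeasure
      (⋃ W ∈ Finset.powersetCard w (Finset.univ : Finset (Fin N)),
        ⋃ F ∈ (W ×ˢ W).powerset.filter (fun F => k ≤ F.card),
          {G | ∀ x ∈ F, p.famPat (gadj G) f x.1 x.2 = true}) ≤ 2⁻¹ ^ (7 * b) := by
    intro w hw
    rw [Finset.mem_filter, Finset.mem_Icc] at hw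
    obtain ⟨⟨hw1, hwb⟩, hwk⟩ := hw
    have hone : ∀ W ∈ Finset.powersetCard w (Finset.univ : Finset (Fin N)),
        ∀ F ∈ (W ×ˢ W).powerset.filter (fun F => k ≤ F.card),
        (erdosRenyiHalf n).toOuterMeasure
          {G | ∀ x ∈ F, p.famPat (gadj G) f x.1 x.2 = true} ≤ 2⁻¹ ^ (p.d * b * w * lam) := by
      intro W hW F hF
      rw [Finset.mem_filter, Finset.mem_powerset] at hF
      obtain ⟨hFW, hFk⟩ := hF
      have hWc := (Finset.mem_powersetCard.1 hW).2
      obtain ⟨x, hxi, hx⟩ := hf.exists_injective (W := W) (hWc.le.trans hwb)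
      let F' : Finset (W × W) := Finset.univ.filter fun z => ((z.1 : Fin N), (z.2 : Fin N)) ∈ F
      have hF' : F.card ≤ F'.card := by
        refine (Finset.card_le_card (t := F'.image fun z => ((z.1 : Fin N), (z.2 : Fin N))) ?_).trans
          Finset.card_image_le
        intro z hz
        have := Finset.mem_product.1 (hFW hz)
        exact Finset.mem_image.2 ⟨(⟨z.1, this.1⟩, ⟨z.2, this.2⟩),
          Finset.mem_filter.2 ⟨Finset.mem_univ _, hz⟩, rfl⟩
      -- A joined pair of sets joins the disjoint `lam`-subsets chosen in them. This gives `lam *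
      -- lam` adjacent pairs of vertices, and different pairs of sets give different ones.
      let D : Finset (ℕ × ℕ) := (F' ×ˢ (Finset.univ : Finset (Fin lam × Fin lam))).image fun z =>
        ((x (z.1.1, z.2.1) : ℕ), (x (z.1.2, z.2.2) : ℕ))
      have hD : D.card = F'.card * (lam * lam) := by
        rw [Finset.card_image_of_injective, Finset.card_product]
        · simp
        · intro z z' h
          simp only [Prod.ext_iff, Fin.val_inj] at h
          have h1 := hxi h.1
          have h2 := hxi h.2
          simp only [Prod.ext_iff] at h1 h2
          exact Prod.ext (Prod.ext h1.1 h2.1) (Prod.ext h1.2 h2.2)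
      refine le_trans (measure_mono ?_) (erdosRenyiHalf_forall_adj_le (n := n) D ?_)
      · intro G hG z hz
        obtain ⟨⟨⟨i, j⟩, α, β⟩, hz', rfl⟩ := Finset.mem_image.1 hz
        have hij := (Finset.mem_filter.1 (Finset.mem_product.1 hz').1).2
        have h1 := (famPat_eq_true p).1 (hG _ hij)
        obtain ⟨u, -, hu⟩ := Finset.mem_image.1 (hx (i, α))
        obtain ⟨v, -, hv⟩ := Finset.mem_image.1 (hx (j, β))
        have := h1 u v
        simp only at hu hv
        simp only [hu, hv] at this
        exact this
      · rw [hD]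
        have h1 : k * (lam * lam) ≤ F'.card * (lam * lam) := Nat.mul_le_mul_right _ (hFk.trans hF')
        have h2 := Nat.mul_le_mul_right lam hwk
        refine le_trans (le_of_eq ?_) (h2.trans (le_trans (le_of_eq ?_) h1)) <;> ring
    refine (measure_biUnion_finset_le _ _).trans ?_
    refine (Finset.sum_le_sum fun W hW => (measure_biUnion_finset_le _ _).trans
      ((Finset.sum_le_sum fun U hU => hone W hW U hU).trans
        (c := 2 ^ (w * w) * 2⁻¹ ^ (p.d * b * w * lam)) ?_)).trans ?_
    · rw [Finset.sum_const, nsmul_eq_mul]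
      gcongr
      have h1 := Finset.card_filter_le (W ×ˢ W).powerset (fun F => k ≤ F.card)
      rw [Finset.card_powerset, Finset.card_product, (Finset.mem_powersetCard.1 hW).2] at h1
      exact_mod_cast h1
    rw [Finset.sum_const, Finset.card_powersetCard, Finset.card_univ, Fintype.card_fin, nsmul_eq_mul]
    have h1 : ((N.choose w : ℕ) : ℝ≥0∞) ≤ 2 ^ (b * (p.a * lam) * w) := by
      have := Nat.choose_le_pow N w
      rw [show N ^ w = 2 ^ (b * (p.a * lam) * w) by simp only [N, Params.num]; rw [← pow_mul]] at this
      exact_mod_cast this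
    -- In bits: `b * a * lam * w` for the choice of `W` and `w * w ≤ b * w` for `F`, against `d * b
    -- * w * lam`. As `d = a + 8`, at least `7 * b` remain.
    refine (mul_le_mul' h1 le_rfl).trans ?_
    rw [← mul_assoc, ← pow_add]
    refine two_pow_mul_inv_le ?_
    have h2 : w * w ≤ b * w := Nat.mul_le_mul_right _ hwb
    have h3 : b * (w * 1) ≤ b * (w * lam) := Nat.mul_le_mul_left _ (Nat.mul_le_mul_left _ hlam)
    have h4 : b * 1 ≤ b * (w * lam) := Nat.mul_le_mul_left _ (Nat.mul_pos hw1 hlam)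
    have h5 : p.d * b * w * lam = b * (p.a * lam) * w + 8 * (b * (w * lam)) := by rw [hd]; ring
    have h6 : b * (w * 1) = b * w := by ring
    omega
  refine (measure_biUnion_finset_le _ _).trans ((Finset.sum_le_sum hterm).trans ?_)
  rw [Finset.sum_const, nsmul_eq_mul]
  have : ((((Finset.Icc 1 b).filter (fun w => 2 * p.d * b * w ≤ k * lam)).card : ℕ) : ℝ≥0∞) ≤ 2 ^ b := by
    have h1 := Finset.card_filter_le (Finset.Icc 1 b) (fun w => 2 * p.d * b * w ≤ k * lam)
    rw [Nat.card_Icc, Nat.add_sub_cancel] at h1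
    exact_mod_cast h1.trans Nat.lt_two_pow_self.le
  exact (mul_le_mul' this le_rfl).trans (two_pow_mul_inv_le (by omega))

/-- On random graphs the distinguisher hardly ever accepts. -/
theorem expect_roundK_le {n lam q : ℕ} (hd : p.d = p.a + 8) (hlam : 1 ≤ lam) (hlb : lam ≤ b)
    (hq : 1 ≤ q) (hqb : q * (q + 1) ≤ b) (hb : (b * b) ^ p.d ≤ 2 ^ b) :
    expect (erdosRenyiHalf n) (fun G => p.roundK b lam q (gadj G) true) ≤ 2⁻¹ ^ (4 * b) := by
  classical
  have hb1 : 1 ≤ b := hlam.trans hlb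
  calc expect (erdosRenyiHalf n) (fun G => p.roundK b lam q (gadj G) true)
      ≤ expect (erdosRenyiHalf n) fun G => expect (unif (p.Fam b lam)) fun f =>
          {f | ∃ W, p.Witness (q * (q + 1)) (gadj G) f W}.indicator (fun _ => 1) f :=
        expect_mono _ fun G => by
          rw [Params.roundK, bind_apply_eq]
          exact expect_mono _ fun f => coreK_true_le p
    -- After the exchange the family is fixed and the graph is random. Families that do not expand
    -- are given up entirely.
    _ = expect (unif (p.Fam b lam)) fun f => expect (erdosRenyiHalf n) fun G =>
          {G | ∃ W, p.Witness (q * (q + 1)) (gadj G) f W}.indicator (fun _ => 1) G :=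
        expect_comm _ _ _
    _ ≤ expect (unif (p.Fam b lam)) fun f =>
          {f | ¬ Expanding b lam f}.indicator (fun _ => 1) f + 2⁻¹ ^ (6 * b) :=
        expect_mono _ fun f => by
          by_cases hf : Expanding b lam f
          · rw [expect_indicator]
            exact (erdosRenyiHalf_witness_le p hd hf hlam hlb (Nat.mul_pos hq (by omega)) hqb).trans
              le_add_self
          · rw [Set.indicator_of_mem (by exact hf)]
            refine le_trans ?_ le_self_add
            rw [expect_indicator, ← expect_const (erdosRenyiHalf n) 1, ← expect_indicator]
            exact expect_mono _ fun G => Set.indicator_le_self' (fun _ _ => zero_le) G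
    _ ≤ 2⁻¹ ^ (5 * b) + 2⁻¹ ^ (6 * b) := by
        rw [expect_add, expect_const, expect_indicator]
        gcongr
        exact unif_not_expanding rfl (by rw [hd]) hlam hlb (by rw [← hd]; exact hb)
    _ ≤ 2⁻¹ ^ (4 * b + 1) + 2⁻¹ ^ (4 * b + 1) :=
        add_le_add (pow_le_pow_right_of_le_one' (by simp) (by omega))
          (pow_le_pow_right_of_le_one' (by simp) (by omega))
    _ = 2⁻¹ ^ (4 * b) := by
        rw [pow_succ, ← mul_add, ENNReal.inv_two_add_inv_two, mul_one]

theorem expect_sum {α ι : Type*} (μ : PMF α) (s : Finset ι) (φ : ι → α → ℝ≥0∞) :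
    expect μ (fun a => ∑ i ∈ s, φ i a) = ∑ i ∈ s, expect μ (φ i) := by
  unfold expect
  simp only [Finset.mul_sum]
  exact Summable.tsum_finsetSum fun _ _ => ENNReal.summable

/-- Union bound over `n * b₂ ≤ 2 ^ (2 * b)` rounds, each of which errs with probability at most `2⁻¹
^ (4 * b)`. -/
theorem expect_distK_le {n b₂ lam : ℕ} (hd : p.d = p.a + 8) (hlam : 1 ≤ lam) (hlb : lam ≤ b)
    (hqb : b₂ * (b₂ + 1) ≤ b) (hb : (b * b) ^ p.d ≤ 2 ^ b) (hn : n ≤ 2 ^ b) :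
    expect (erdosRenyiHalf n) (fun G => p.distK n b b₂ lam (gadj G) true) ≤ 2⁻¹ ^ (2 * b) := by
  calc expect (erdosRenyiHalf n) (fun G => p.distK n b b₂ lam (gadj G) true)
      ≤ expect (erdosRenyiHalf n) fun G => ∑ _j ∈ Finset.range n, ∑ i ∈ Finset.range b₂,
          p.roundK b lam (i + 1) (gadj G) true :=
        expect_mono _ fun G => (orIter_true_le _ _).trans
          (Finset.sum_le_sum fun _ _ => orIter_true_le _ _)
    _ = ∑ _j ∈ Finset.range n, ∑ i ∈ Finset.range b₂,
          expect (erdosRenyiHalf n) (fun G => p.roundK b lam (i + 1) (gadj G) true) := by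
        simp only [expect_sum]
    _ ≤ ∑ _j ∈ Finset.range n, ∑ _i ∈ Finset.range b₂, 2⁻¹ ^ (4 * b) := by
        refine Finset.sum_le_sum fun _ _ => Finset.sum_le_sum fun i hi => ?_
        have hi' := Finset.mem_range.1 hi
        exact expect_roundK_le p hd hlam hlb (by omega)
          ((Nat.mul_le_mul (by omega) (by omega)).trans hqb) hb
    _ ≤ 2 ^ b * (2 ^ b * 2⁻¹ ^ (4 * b)) := by
        rw [Finset.sum_const, Finset.sum_const, Finset.card_range, Finset.card_range, nsmul_eq_mul,
          nsmul_eq_mul]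
        have h1 : b₂ ≤ b := (Nat.le_mul_of_pos_right _ (by omega)).trans hqb
        gcongr
        · exact_mod_cast hn
        · exact_mod_cast h1.trans Nat.lt_two_pow_self.le
    _ ≤ 2⁻¹ ^ (2 * b) := by
        rw [← mul_assoc, ← pow_add]
        exact two_pow_mul_inv_le (by omega)

end Sound

end RandWhile

namespace RandWhile

open MeasureTheory (measure_biUnion_finset_le measure_mono)

/-! ### Completeness of the distinguisher -/

section Complete

/-- A single term of the binomial expansion. It replaces the exponential estimate of `(1 - x / X) ^
N`, as a bound of order `X / (N * x)` suffices. -/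
theorem mul_pow_mul_le_add_pow (Y x N : ℕ) : (N + 1) * Y ^ N * x ≤ (Y + x) ^ (N + 1) := by
  induction N with
  | zero => simp
  | succ N ih =>
    have h1 : Y ^ (N + 1) ≤ (Y + x) ^ (N + 1) := Nat.pow_le_pow_left (by omega) _
    calc (N + 1 + 1) * Y ^ (N + 1) * x = (N + 1) * Y ^ N * x * Y + Y ^ (N + 1) * x := by ring
      _ ≤ (Y + x) ^ (N + 1) * Y + (Y + x) ^ (N + 1) * x := by gcongr
      _ = _ := by ring

/-- `(1 - x / X) ^ N ≤ 1 / M` if `M ≤ N * x / X`. -/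
theorem one_sub_pow_le {X x N M : ℕ} (hx : x ≤ X) (hX : 0 < X) (hM : 0 < M)
    (h : M * X ≤ N * x) : (((X - x : ℕ) : ℝ≥0∞) / X) ^ N ≤ (M : ℝ≥0∞)⁻¹ := by
  obtain ⟨Y, rfl⟩ := Nat.exists_eq_add_of_le' hx
  rw [Nat.add_sub_cancel]
  have h1 : Y ^ N * M ≤ (Y + x) ^ N := by
    cases N with
    | zero => simp at h; omega
    | succ N =>
      calc Y ^ (N + 1) * M = Y ^ N * (M * Y) := by ring
        _ ≤ Y ^ N * (M * (Y + x)) := by gcongr; omega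
        _ ≤ Y ^ N * ((N + 1) * x) := by gcongr
        _ = (N + 1) * Y ^ N * x := by ring
        _ ≤ _ := mul_pow_mul_le_add_pow Y x N
  rw [div_eq_mul_inv, mul_pow, ← ENNReal.inv_pow, ← div_eq_mul_inv]
  refine ENNReal.div_le_of_le_mul ?_
  rw [mul_comm, ← div_eq_mul_inv, ENNReal.le_div_iff_mul_le (by simp; omega) (by simp)]
  exact_mod_cast h1

variable (p : Params) {b lam q κ₀ : ℕ}

/-- For every `r` there is a set of the family inside the part `r` of the clique. -/
def Params.Hits {b lam : ℕ} (y : Fin (q + 1) × Fin κ₀ → Fin (2 ^ b)) (f : p.Fam b lam) : Prop :=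
  ∀ r, ∃ i, ∀ x, ∃ t, f i x = y (r, t)

/-- A random tuple lies in a given part with probability `(κ₀ / 2 ^ b) ^ (d * lam)`. As `d = a + 8`,
the expected number of such tuples is `(κ₀ ^ d / 2 ^ (8 * b)) ^ lam`, hence at least `4 * (q + 1)`.
By independence a part is missed with probability at most `1 / (4 * (q + 1))`. -/
theorem three_quarters_le_hits {y : Fin (q + 1) × Fin κ₀ → Fin (2 ^ b)} (hy : Function.Injective y)
    (hd : p.d = p.a + 8) (hlam : 1 ≤ lam) (hκ : 4 * (q + 1) * (2 ^ b) ^ 8 ≤ κ₀ ^ p.d) :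
    1 ≤ (unif (p.Fam b lam)).toOuterMeasure {f | p.Hits y f} + 4⁻¹ := by
  classical
  let T : Fin (q + 1) → Finset (Fin (p.d * lam) → Fin (2 ^ b)) := fun r =>
    Fintype.piFinset fun _ => Finset.univ.image fun t => y (r, t)
  have hT : ∀ r, (T r).card = κ₀ ^ (p.d * lam) := fun r => by
    rw [Fintype.card_piFinset, Finset.prod_const, Finset.card_image_of_injective]
    · simp
    · exact fun t t' h => (Prod.ext_iff.1 (hy h)).2
  have hone : ∀ r, (unif (p.Fam b lam)).toOuterMeasure {f | ∀ i, f i ∈ (T r)ᶜ} ≤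
      ((4 * (q + 1) : ℕ) : ℝ≥0∞)⁻¹ := fun r => by
    have hle : κ₀ ^ (p.d * lam) ≤ (2 ^ b) ^ (p.d * lam) := by
      rw [← hT r]; exact (Finset.card_le_univ _).trans (by simp)
    rw [unif_pi]
    simp only [Finset.card_compl, hT, Fintype.card_fun, Fintype.card_fin, Finset.prod_const,
      Finset.card_univ]
    refine one_sub_pow_le hle (by positivity) (by omega) ?_
    calc 4 * (q + 1) * (2 ^ b) ^ (p.d * lam)
        = p.num b lam * (4 * (q + 1) * ((2 ^ b) ^ 8) ^ lam) := by
          rw [hd, Params.num]; ring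
      _ ≤ p.num b lam * ((4 * (q + 1)) ^ lam * ((2 ^ b) ^ 8) ^ lam) := by
          gcongr; exact Nat.le_self_pow (by omega) _
      _ ≤ p.num b lam * κ₀ ^ (p.d * lam) := by
          rw [← mul_pow, pow_mul]; gcongr
  have hbad : (unif (p.Fam b lam)).toOuterMeasure {f | ¬ p.Hits y f} ≤ 4⁻¹ := by
    have hsub : {f : p.Fam b lam | ¬ p.Hits y f} ⊆
        ⋃ r ∈ (Finset.univ : Finset (Fin (q + 1))), {f | ∀ i, f i ∈ (T r)ᶜ} := by
      intro f hf
      simp only [Set.mem_ofPred_eq, Params.Hits, not_forall] at hf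
      obtain ⟨r, hr⟩ := hf
      simp only [Set.mem_iUnion]
      refine ⟨r, Finset.mem_univ _, fun i => Finset.mem_compl.2 fun hi => hr ⟨i, fun x => ?_⟩⟩
      obtain ⟨t, -, ht⟩ := Finset.mem_image.1 (Fintype.mem_piFinset.1 hi x)
      exact ⟨t, ht.symm⟩
    refine (measure_mono hsub).trans ((measure_biUnion_finset_le _ _).trans
      ((Finset.sum_le_sum fun r _ => hone r).trans ?_))
    rw [Finset.sum_const, Finset.card_univ, Fintype.card_fin, nsmul_eq_mul, Nat.cast_mul,
      ENNReal.mul_inv (by simp) (by simp), mul_left_comm,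
      ENNReal.mul_inv_cancel (by simp) (by simp), mul_one]
    simp
  refine le_trans ?_ (add_le_add_right hbad _)
  rw [← expect_indicator, ← expect_indicator, ← expect_add]
  refine le_trans (expect_const _ _).ge (expect_mono _ fun f => ?_)
  by_cases h : p.Hits y f <;> simp [h]

variable {f : ℕ → ℕ} {c : ℕ} {g : ℕ → ℝ} {adj : ℕ → ℕ → Bool}

/-- Tuples inside different parts of the clique are joined, so the optimum is at most `q + 1`. By
`hg` every solution within the guarantee passes the check, and by `hT` the clock does not interfere
with `A`. -/
theorem two_thirds_le_coreK
    (hA : ApproximatesSteinerForest p.A (fun I => f I.k * I.encode.size ^ c) g)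
    (hq : 1 ≤ q) (hl : 0 < p.d * lam) (hN : 32 ≤ p.num b lam) (hkN : q * (q + 1) ≤ p.num b lam)
    (hT : f (q * (q + 1)) * (p.num b lam ^ 3) ^ c ≤ p.num b lam ^ p.e)
    (hg : 2 * p.d * b * (|g (q * (q + 1))| * (q + 1)) ≤ (q * (q + 1) * lam : ℝ))
    (hadj : ∀ x, adj x x = false) {y : Fin (q + 1) × Fin κ₀ → Fin (2 ^ b)}
    (hclique : ∀ u v, u ≠ v → adj (y u) (y v) = true)
    {F : p.Fam b lam} (hF : p.Hits y F) : 2 / 3 ≤ p.coreK b lam q (p.famPat adj F) true := by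
  have hk : 0 < q * (q + 1) := Nat.mul_pos hq (by omega)
  have hP : ∀ i, p.famPat adj F i i = false := fun i => by
    by_contra h
    have := (famPat_eq_true p).1 (by simpa using h) ⟨0, hl⟩ ⟨0, hl⟩
    rw [hadj] at this; cases this
  choose s hs using hF
  choose t ht using hs
  obtain ⟨H₀, hH₀, hcost⟩ := exists_solution_of_clique (hk := hk) hP rfl s fun r r' hr =>
    (famPat_eq_true p).2 fun u v => by
      rw [ht, ht]; exact hclique _ _ fun h => hr (Prod.ext_iff.1 h).1
  let I := starInst (p.famPat adj F) (q * (q + 1)) hk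
  have hopt : I.opt ≤ q + 1 := le_trans
    (Nat.sInf_le (s := {w | ∃ H, I.IsSolution H ∧ I.cost H = w}) ⟨H₀, hH₀, rfl⟩) hcost
  have hT' : f I.k * I.encode.size ^ c ≤ p.num b lam ^ p.e := by
    refine le_trans ?_ hT
    change f (q * (q + 1)) * _ ≤ _
    rw [encode_starInst]
    gcongr
    exact size_instTree _ _ hN hkN
  have h1 := hA I ⟨H₀, hH₀⟩
  have h2 := outputWithin_le_outDist p.A hT' I.encode
    {z | verify p.d b lam (q * (q + 1)) (p.famPat adj F) z = true}
  refine h1.trans (le_trans (measure_mono ?_) (h2.trans (le_of_eq ?_)))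
  · rintro o ⟨H, rfl, hH, hc⟩
    refine ⟨_, rfl, verify_of_isSolution (hk := hk) hP hH ?_⟩
    have hc1 : (I.cost H : ℝ) ≤ |g (q * (q + 1))| * (q + 1) := by
      refine hc.trans ?_
      change g (q * (q + 1)) * _ ≤ _
      have : (I.opt : ℝ) ≤ q + 1 := by exact_mod_cast hopt
      exact mul_le_mul (le_abs_self _) this (Nat.cast_nonneg _) (abs_nonneg _)
    have hc2 : (2 * p.d * b * I.cost H : ℝ) ≤ q * (q + 1) * lam :=
      (mul_le_mul_of_nonneg_left hc1 (by positivity)).trans hg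
    exact_mod_cast hc2
  · rw [show I.encode = instTree _ _ from encode_starInst _ _ hk, Params.coreK, ← PMF.toOuterMeasure_apply_singleton, PMF.toOuterMeasure_map_apply]
    rfl

/-- On a graph with a large clique the distinguisher accepts with constant probability. -/
theorem half_le_roundK
    (hA : ApproximatesSteinerForest p.A (fun I => f I.k * I.encode.size ^ c) g)
    (hd : p.d = p.a + 8) (hlam : 1 ≤ lam)
    (hq : 1 ≤ q) (hN : 32 ≤ p.num b lam) (hkN : q * (q + 1) ≤ p.num b lam)
    (hT : f (q * (q + 1)) * (p.num b lam ^ 3) ^ c ≤ p.num b lam ^ p.e)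
    (hg : 2 * p.d * b * (|g (q * (q + 1))| * (q + 1)) ≤ (q * (q + 1) * lam : ℝ))
    (hκ : 4 * (q + 1) * (2 ^ b) ^ 8 ≤ κ₀ ^ p.d)
    (hadj : ∀ x, adj x x = false) {y : Fin (q + 1) × Fin κ₀ → Fin (2 ^ b)}
    (hy : Function.Injective y) (hclique : ∀ u v, u ≠ v → adj (y u) (y v) = true) :
    2⁻¹ ≤ p.roundK b lam q adj true := by
  have hl : 0 < p.d * lam := Nat.mul_pos (by omega) hlam
  have h1 : 3 / 4 ≤ (unif (p.Fam b lam)).toOuterMeasure {f | p.Hits y f} := by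
    have := three_quarters_le_hits p hy hd hlam hκ
    rw [← tsub_le_iff_right] at this
    refine le_trans (le_of_eq ?_) this
    refine ENNReal.eq_sub_of_add_eq (by simp) ?_
    rw [← one_div, ENNReal.div_add_div_same]
    norm_num
    exact ENNReal.div_self (by simp) (by simp)
  -- The success probability of `A` times the probability that the family hits all parts.
  calc (2⁻¹ : ℝ≥0∞) = 2 / 3 * (3 / 4) := by
        rw [← ENNReal.toReal_eq_toReal_iff' (by simp) (by finiteness)]
        simp; norm_num
    _ ≤ 2 / 3 * (unif (p.Fam b lam)).toOuterMeasure {f | p.Hits y f} := by gcongr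
    _ = expect (unif (p.Fam b lam)) fun F => 2 / 3 * {f | p.Hits y f}.indicator (fun _ => 1) F := by
        rw [expect_mul_left, expect_indicator]
    _ ≤ _ := by
        rw [Params.roundK, bind_apply_eq]
        refine expect_mono _ fun F => ?_
        by_cases hF : p.Hits y F
        · rw [Set.indicator_of_mem (by exact hF), mul_one]
          exact two_thirds_le_coreK p hA hq hl hN hkN hT hg hadj hclique hF
        · rw [Set.indicator_of_notMem (by exact hF), mul_zero]
          exact zero_le

theorem true_add_false (μ : PMF Bool) : μ true + μ false = 1 := by
  have := μ.tsum_coe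
  rwa [tsum_bool, add_comm] at this

/-- One good value of `q` is enough, since the other values can only add acceptances; the `n`
independent repetitions do the rest. -/
theorem distK_false_le {n b₂ : ℕ} (hq : 1 ≤ q) (hqb : q ≤ b₂) (h : 2⁻¹ ≤ p.roundK b lam q adj true) :
    p.distK n b b₂ lam adj false ≤ 2⁻¹ ^ n := by
  have h1 : p.roundK b lam q adj false ≤ 2⁻¹ := by
    have h2 := true_add_false (p.roundK b lam q adj)
    rw [← ENNReal.inv_two_add_inv_two] at h2
    by_contra hlt
    exact absurd h2 (ENNReal.add_lt_add_of_le_of_lt (by simp) h (not_le.1 hlt)).ne'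
  rw [Params.distK, orIter_false, Finset.prod_const, Finset.card_range]
  refine pow_le_pow_left₀ zero_le ?_ _
  rw [orIter_false]
  have hmem : q - 1 ∈ Finset.range b₂ := Finset.mem_range.2 (by omega)
  rw [← Finset.mul_prod_erase _ _ hmem, Nat.sub_add_cancel hq]
  refine (mul_le_mul' h1 (Finset.prod_le_one' fun i _ => PMF.coe_le_one _ _)).trans (by simp)

end Complete

end RandWhile

namespace RandWhile

open BTree (nth)

/-! ### Graphs as inputs -/

section Inputs

variable {n : ℕ}

theorem nth_encL_of_le {a : Fin n → BTree} {i : ℕ} (hi : n ≤ i) : (encL a).nth i = .nil := by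
  rw [encL, BTree.nth_ofList, List.getD_eq_default _ _ (by simpa)]

theorem truthy_nth_nth (a : Fin n → Fin n → Bool) (x y : ℕ) :
    (((encL fun i => encL fun j => .ofBool (a i j)).nth x).nth y).truthy = true ↔
      ∃ (hx : x < n) (hy : y < n), a ⟨x, hx⟩ ⟨y, hy⟩ = true := by
  by_cases hx : x < n
  · rw [nth_encL _ ⟨x, hx⟩]
    by_cases hy : y < n
    · rw [nth_encL _ ⟨y, hy⟩]; simp [hx, hy]
    · rw [nth_encL_of_le (not_lt.1 hy)]; simp [hy, BTree.truthy]
  · rw [nth_encL_of_le (not_lt.1 hx), ← BTree.ofList, BTree.nth_ofList]; simp [hx, BTree.truthy]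

theorem gadj_comm (G : SimpleGraph (Fin n)) (x y : ℕ) : gadj G x y = gadj G y x := by
  rw [Bool.eq_iff_iff, gadj_eq_true, gadj_eq_true]
  exact ⟨fun ⟨hx, hy, h⟩ => ⟨hy, hx, h.symm⟩, fun ⟨hx, hy, h⟩ => ⟨hy, hx, h.symm⟩⟩

/-- Both sides are symmetric and irreflexive, so the entries below the diagonal decide. -/
theorem adjK_eq_gadj {mat : BTree} {κ : ℕ} {G : SimpleGraph (Fin n)}
    (h : ∀ x y, y < x → adjO mat κ x y = gadj G x y) : adjK mat κ = gadj G := by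
  ext x y
  unfold adjK
  split_ifs with h1 h2
  · exact h x y h1
  · rw [h y x h2, gadj_comm]
  · rw [show x = y by omega, gadj_self]

theorem adjK_encodeGraph (G : SimpleGraph (Fin n)) : adjK (encodeGraph G) 0 = gadj G := by
  classical
  refine adjK_eq_gadj fun x y _ => ?_
  rw [Bool.eq_iff_iff, gadj_eq_true, adjO, decide_eq_false (by omega), Bool.false_or]
  refine (truthy_nth_nth (fun i j => decide (G.Adj i j)) x y).trans ?_
  simp

/-- The graph given by the lower triangle of a matrix of bits in reversed order. -/
def bitGraph (β : Fin n → Fin n → Bool) : SimpleGraph (Fin n) :=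
  SimpleGraph.fromRel fun x y => y < x ∧ β x.rev y.rev = true

theorem bitGraph_adj {β : Fin n → Fin n → Bool} {x y : Fin n} (h : y < x) :
    (bitGraph β).Adj x y ↔ β x.rev y.rev = true := by
  simp only [bitGraph, SimpleGraph.fromRel_adj, h, true_and, not_lt.2 h.le, false_and, or_false,
    and_iff_right_iff_imp]
  exact fun _ => h.ne'

theorem plantClique_adj {G : SimpleGraph (Fin n)} {S : Finset (Fin n)} {x y : Fin n} :
    (plantClique G S).Adj x y ↔ G.Adj x y ∨ x ≠ y ∧ x ∈ S ∧ y ∈ S := by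
  simp only [plantClique, SimpleGraph.sup_adj, SimpleGraph.fromRel_adj]
  tauto

/-- The first `κ` vertices. -/
def initial (n κ : ℕ) : Finset (Fin n) := {i | (i : ℕ) < κ}

/-- Random rows and columns are generated with the last one in front, so position `i` holds index
`i.rev`; the reversal in `bitGraph` makes up for this. -/
theorem adjK_bitTree {κ : ℕ} (hκ : κ ≤ n) (β : Fin n → Fin n → Bool) :
    adjK (bitTree β) κ = gadj (plantClique (bitGraph β) (initial n κ)) := by
  refine adjK_eq_gadj fun x y hxy => ?_
  have h1 : bitTree β = encL fun i => encL fun j => .ofBool (β i.rev j.rev) := by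
    unfold bitTree
    rw [← encL_rev]
    simp only [← encL_rev]
  rw [Bool.eq_iff_iff, gadj_eq_true, adjO, h1, Bool.or_eq_true, truthy_nth_nth, decide_eq_true_eq]
  constructor
  · rintro (h | ⟨hx, hy, h⟩)
    · exact ⟨by omega, by omega, plantClique_adj.2 (.inr ⟨by simp [Fin.ext_iff]; omega,
        by simp [initial, h], by simp [initial]; omega⟩)⟩
    · exact ⟨hx, hy, plantClique_adj.2 (.inl ((bitGraph_adj (by simpa using hxy)).2 h))⟩
  · rintro ⟨hx, hy, h⟩
    rcases plantClique_adj.1 h with h | h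
    · exact .inr ⟨hx, hy, (bitGraph_adj (by simpa using hxy)).1 h⟩
    · left; simpa [initial] using h.2.1

theorem eq_unif_of_const {α : Type*} [Fintype α] [Nonempty α] {μ : PMF α} (a₀ : α)
    (h : ∀ a, μ a = μ a₀) : μ = unif α := by
  ext a
  have h1 := μ.tsum_coe
  rw [tsum_fintype, Finset.sum_congr rfl fun a _ => h a, Finset.sum_const, nsmul_eq_mul,
    Finset.card_univ] at h1
  rw [h, PMF.uniformOfFintype_apply]
  exact ENNReal.eq_inv_of_mul_eq_one_left (by rw [mul_comm]; exact h1)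

/-- Adding the reversed adjacency matrix of `G` modulo `2` permutes the bit matrices and carries
those of the empty graph to those of `G`. So all graphs are equally likely. -/
theorem unif_map_bitGraph : (unif (Fin n → Fin n → Bool)).map bitGraph = erdosRenyiHalf n := by
  classical
  have key : (unif (Fin n → Fin n → Bool)).map bitGraph = unif (SimpleGraph (Fin n)) := by
    refine eq_unif_of_const ⊥ fun G => ?_
    let γ : Fin n → Fin n → Bool := fun i j => decide (G.Adj i.rev j.rev)
    have hinv : Function.Involutive fun (β : Fin n → Fin n → Bool) i j => (β i j).xor (γ i j) := by
      intro β; ext i j; simp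
    let e : Equiv.Perm (Fin n → Fin n → Bool) := Function.Involutive.toPerm _ hinv
    have he : ∀ β i j, e β i j = (β i j).xor (γ i j) := fun _ _ _ => rfl
    rw [PMF.map_apply, PMF.map_apply, ← Equiv.tsum_eq e]
    refine tsum_congr fun β => ?_
    rw [PMF.uniformOfFintype_apply, PMF.uniformOfFintype_apply]
    refine if_congr ?_ rfl rfl
    have hG : G = bitGraph (e β) ↔ ∀ x y : Fin n, y < x → β x.rev y.rev = false := by
      constructor
      · intro h x y hxy
        have h2 := bitGraph_adj (β := e β) hxy
        rw [← h] at h2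
        simp only [he, γ, Fin.rev_rev] at h2
        by_cases hadj : G.Adj x y
        · simpa [hadj] using h2
        · simpa [hadj] using h2
      · intro h
        have h3 : ∀ x y : Fin n, y < x → (G.Adj x y ↔ (bitGraph (e β)).Adj x y) := by
          intro x y hxy
          rw [bitGraph_adj hxy]
          simp [he, γ, h x y hxy]
        ext x y
        rcases lt_trichotomy x y with hxy | rfl | hxy
        · rw [SimpleGraph.adj_comm, h3 _ _ hxy, SimpleGraph.adj_comm]
        · simp
        · exact h3 _ _ hxy
    have h0 : ⊥ = bitGraph β ↔ ∀ x y : Fin n, y < x → β x.rev y.rev = false := by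
      constructor
      · intro h x y hxy
        have h2 := bitGraph_adj (β := β) hxy
        rw [← h] at h2
        simpa using h2
      · intro h
        ext x y
        rcases lt_trichotomy x y with hxy | rfl | hxy
        · rw [SimpleGraph.adj_comm (bitGraph β), bitGraph_adj hxy, h _ _ hxy]; simp
        · simp
        · rw [bitGraph_adj hxy, h _ _ hxy]; simp
    rw [hG, h0]
  exact key

variable (p : Params) {b b₂ lam : ℕ}

/-- The probability that the distinguisher misses a planted clique. -/
noncomputable def Params.miss (n b b₂ lam κ : ℕ) : ℝ≥0∞ :=
  expect (erdosRenyiHalf n) fun G => p.distK n b b₂ lam (gadj (plantClique G (initial n κ))) false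

theorem testK_true {κ : ℕ} (hκ : κ ≤ n) : p.testK n b b₂ lam κ true = p.miss n b b₂ lam κ := by
  classical
  rw [Params.testK, bind_apply_eq, Params.miss, ← unif_map_bitGraph, expect_map]
  refine congrArg _ (funext fun β => ?_)
  rw [PMF.map_apply, tsum_bool, adjK_bitTree hκ]
  simp

/-- Extension of a permutation of the vertices. -/
theorem exists_perm_extend {B : ℕ} (h : n ≤ B) (σ : Equiv.Perm (Fin n)) :
    ∃ τ : Equiv.Perm (Fin B), (∀ x : Fin n, (τ (Fin.castLE h x) : ℕ) = σ x) ∧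
      ∀ x : Fin B, n ≤ x → n ≤ (τ x : ℕ) := by
  refine ⟨σ.viaFintypeEmbedding (Fin.castLEEmb h), fun x => ?_, fun x hx => ?_⟩
  · exact congrArg Fin.val (σ.viaFintypeEmbedding_apply_image (Fin.castLEEmb h) x)
  · rw [Equiv.Perm.viaFintypeEmbedding_apply_notMem_range]
    · exact hx
    · rintro ⟨y, rfl⟩
      exact absurd y.2 (not_lt.2 hx)

/-- Renaming the vertices turns a family into another one, and families are uniform. The permutation
is extended to the numbers below `2 ^ b` so that the isolated numbers from `n` on stay among
themselves. -/
theorem roundK_comap (hn : n ≤ 2 ^ b) (σ : Equiv.Perm (Fin n)) (G : SimpleGraph (Fin n)) (q : ℕ) :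
    p.roundK b lam q (gadj (G.comap σ)) = p.roundK b lam q (gadj G) := by
  obtain ⟨τ, hτ, hτ'⟩ := exists_perm_extend hn σ
  have hlt : ∀ x : Fin (2 ^ b), (τ x : ℕ) < n ↔ (x : ℕ) < n := by
    intro x
    constructor
    · intro h; by_contra hx; have := hτ' x (by omega); omega
    · intro h
      have := hτ ⟨x, h⟩
      rw [show Fin.castLE hn ⟨x, h⟩ = x from rfl] at this
      rw [this]; exact (σ _).2
  have hadj : ∀ x y : Fin (2 ^ b), gadj (G.comap σ) x y = gadj G (τ x) (τ y) := by
    intro x y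
    rw [Bool.eq_iff_iff, gadj_eq_true, gadj_eq_true]
    have h1 : ∀ (x : Fin (2 ^ b)) (hx : (x : ℕ) < n) (hx' : (τ x : ℕ) < n),
        σ ⟨x, hx⟩ = ⟨τ x, hx'⟩ := fun x hx hx' => Fin.ext (hτ ⟨x, hx⟩).symm
    constructor
    · rintro ⟨hx, hy, h⟩
      refine ⟨(hlt x).2 hx, (hlt y).2 hy, ?_⟩
      rw [← h1 x hx, ← h1 y hy]; exact h
    · rintro ⟨hx, hy, h⟩
      refine ⟨(hlt x).1 hx, (hlt y).1 hy, ?_⟩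
      rw [SimpleGraph.comap_adj, h1 x _ hx, h1 y _ hy]; exact h
  let e : p.Fam b lam ≃ p.Fam b lam :=
    Equiv.arrowCongr (Equiv.refl _) (Equiv.arrowCongr (Equiv.refl _) τ)
  conv_rhs => rw [Params.roundK, ← unif_map_equiv e, PMF.bind_map]
  unfold Params.roundK
  refine congrArg _ (funext fun F => congrArg (p.coreK b lam q) (funext fun i => funext fun j => ?_))
  rw [Bool.eq_iff_iff, famPat_eq_true, famPat_eq_true]
  simp only [hadj]
  rfl

theorem distK_comap (hn : n ≤ 2 ^ b) (σ : Equiv.Perm (Fin n)) (G : SimpleGraph (Fin n)) :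
    p.distK n b b₂ lam (gadj (G.comap σ)) = p.distK n b b₂ lam (gadj G) := by
  unfold Params.distK
  simp only [roundK_comap p hn]

theorem expect_erdosRenyiHalf_comap (σ : Equiv.Perm (Fin n)) (φ : SimpleGraph (Fin n) → ℝ≥0∞) :
    expect (erdosRenyiHalf n) (fun G => φ (G.comap σ)) = expect (erdosRenyiHalf n) φ := by
  classical
  let e : SimpleGraph (Fin n) ≃ SimpleGraph (Fin n) :=
    ⟨fun G => G.comap σ, fun G => G.comap σ.symm, fun G => by ext; simp, fun G => by ext; simp⟩
  have h : (erdosRenyiHalf n).map e = erdosRenyiHalf n := by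
    unfold erdosRenyiHalf; exact unif_map_equiv e
  conv_rhs => rw [← h, expect_map]
  rfl

/-- Some permutation carries `S` to `S'`, and neither the law of the random graph nor the
distinguisher notices it. This is why the tests may always plant the clique on the first vertices.
-/
theorem expect_distK_plantClique (hn : n ≤ 2 ^ b) {S S' : Finset (Fin n)} (h : S.card = S'.card)
    (r : Bool) :
    expect (erdosRenyiHalf n) (fun G => p.distK n b b₂ lam (gadj (plantClique G S)) r) =
      expect (erdosRenyiHalf n) (fun G => p.distK n b b₂ lam (gadj (plantClique G S')) r) := by
  classical
  obtain ⟨σ, hσ⟩ : ∃ σ : Equiv.Perm (Fin n), ∀ x, σ x ∈ S' ↔ x ∈ S := by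
    let e : {x // x ∈ S} ≃ {x // x ∈ S'} := Finset.equivOfCardEq h
    refine ⟨e.extendSubtype, fun x => ⟨fun hx => ?_, fun hx => e.extendSubtype_mem x hx⟩⟩
    by_contra hxS
    exact e.extendSubtype_not_mem x hxS hx
  rw [← expect_erdosRenyiHalf_comap σ]
  have hG : ∀ G, plantClique (G.comap σ) S = (plantClique G S').comap σ := fun G => by
    ext x y
    rw [plantClique_adj, SimpleGraph.comap_adj, SimpleGraph.comap_adj, plantClique_adj, hσ, hσ]
    simp
  simp only [hG, distK_comap p hn σ]

/-- The position of the planted clique does not matter. -/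
theorem expect_plantedClique_distK (hn : n ≤ 2 ^ b) {κ : ℕ} (hκ : κ ≤ n) (r : Bool) :
    expect (plantedClique n κ) (fun G => p.distK n b b₂ lam (gadj G) r) =
      expect (erdosRenyiHalf n)
        (fun G => p.distK n b b₂ lam (gadj (plantClique G (initial n κ))) r) := by
  rw [plantedClique, expect_bind]
  simp only [expect_map]
  rw [expect_comm]
  refine (tsum_congr fun S => ?_).trans ((ENNReal.tsum_mul_right).trans
    (by rw [(randomSubset n κ).tsum_coe, one_mul]))
  by_cases hS : (randomSubset n κ) S = 0
  · rw [hS, zero_mul, zero_mul]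
  · have hS' : S ∈ (randomSubset n κ).support := hS
    rw [randomSubset, PMF.mem_support_uniformOfFinset_iff, Finset.mem_powersetCard] at hS'
    refine congrArg _ (expect_distK_plantClique p hn (hS'.2.trans ?_) r)
    rw [min_eq_left hκ, initial]
    rw [Fin.card_filter_val_lt]; omega

end Inputs

end RandWhile

namespace RandWhile

/-! ### The answer of the algorithm -/

section Answer

variable (p : Params) {n b b₂ lam : ℕ}

theorem value_succ (adj : ℕ → ℕ → Bool) (ψ : Bool → ℝ≥0∞) (j lam : ℕ) :
    p.value n b b₂ adj ψ (j + 1) lam =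
      p.calK n b b₂ (lam + 1) true * p.value n b b₂ adj ψ j (lam + 1) +
        p.calK n b b₂ (lam + 1) false * expect (p.distK n b b₂ (lam + 1) adj) ψ := by
  rw [Params.value, Params.stageK, expect_bind]
  have h : ∀ (μ : PMF Bool) φ, expect μ φ = μ true * φ true + μ false * φ false := fun μ φ => by
    unfold expect; rw [tsum_bool, add_comm]
  rw [h]
  simp [expect_map]

/-- If every stage that stops gives the right answer and the last one stops, then the answer is
right. -/
theorem le_expect_value (μ : PMF (SimpleGraph (Fin n))) (ψ : Bool → ℝ≥0∞) {x η : ℝ≥0∞} (j : ℕ) :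
    ∀ lam, (∀ i ≤ j, p.calK n b b₂ (lam + i + 1) false * (9 / 10) ≤
      p.calK n b b₂ (lam + i + 1) false *
        expect μ (fun G => expect (p.distK n b b₂ (lam + i + 1) (gadj G)) ψ) + x) →
    p.calK n b b₂ (lam + j + 1) true ≤ η →
    9 / 10 ≤ expect μ (fun G => p.value n b b₂ (gadj G) ψ (j + 1) lam) + (j + 1) * x + η := by
  have h910 : (9 / 10 : ℝ≥0∞) ≤ 1 := by
    refine ENNReal.div_le_of_le_mul ?_; norm_num
  induction j with
  | zero =>
    intro lam hstage hlast
    have h := hstage 0 le_rfl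
    rw [add_zero] at h hlast
    simp only [value_succ, show ∀ adj, p.value n b b₂ adj ψ 0 (lam + 1) = 0 from fun _ => rfl,
      mul_zero, zero_add]
    rw [expect_mul_left]
    calc (9 / 10 : ℝ≥0∞) = p.calK n b b₂ (lam + 1) true * (9 / 10) +
            p.calK n b b₂ (lam + 1) false * (9 / 10) := by rw [← add_mul, true_add_false, one_mul]
      _ ≤ η * 1 + _ := add_le_add (mul_le_mul' hlast h910) h
      _ = _ := by push_cast; ring
  | succ j ih =>
    intro lam hstage hlast
    have h := hstage 0 (by omega)
    rw [add_zero] at h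
    have h2 := ih (lam + 1) (fun i hi => by
      have := hstage (i + 1) (by omega)
      rwa [show lam + (i + 1) + 1 = lam + 1 + i + 1 by ring] at this)
      (by rwa [show lam + 1 + j + 1 = lam + (j + 1) + 1 by ring])
    have hval : expect μ (fun G => p.value n b b₂ (gadj G) ψ (j + 1 + 1) lam) =
        p.calK n b b₂ (lam + 1) true *
          expect μ (fun G => p.value n b b₂ (gadj G) ψ (j + 1) (lam + 1)) +
        p.calK n b b₂ (lam + 1) false *
          expect μ (fun G => expect (p.distK n b b₂ (lam + 1) (gadj G)) ψ) := by
      simp only [value_succ p _ _ (j + 1)]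
      rw [expect_add, expect_mul_left, expect_mul_left]
    rw [hval]
    -- Either the stage stops, where `9 / 10` of the mass is right up to the error `x`, or the
    -- induction hypothesis takes over, with its errors multiplied by a probability.
    calc (9 / 10 : ℝ≥0∞) = p.calK n b b₂ (lam + 1) true * (9 / 10) +
            p.calK n b b₂ (lam + 1) false * (9 / 10) := by rw [← add_mul, true_add_false, one_mul]
      _ ≤ _ := add_le_add (mul_le_mul' le_rfl h2) h
      _ ≤ (p.calK n b b₂ (lam + 1) true *
          expect μ (fun G => p.value n b b₂ (gadj G) ψ (j + 1) (lam + 1)) +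
            1 * ((j + 1) * x + η)) + (p.calK n b b₂ (lam + 1) false *
          expect μ (fun G => expect (p.distK n b b₂ (lam + 1) (gadj G)) ψ) + x) := by
          refine add_le_add ?_ le_rfl
          rw [add_assoc, mul_add]
          exact add_le_add le_rfl (mul_le_mul' (PMF.coe_le_one _ _) le_rfl)
      _ = _ := by push_cast; ring

/-- The choice of constants: `9 / 10 - 7 / 30 = 2 / 3`. -/
theorem two_thirds_le_of_le {v x : ℝ≥0∞} {b : ℕ} {η : ℝ≥0∞} (h : 9 / 10 ≤ v + b * x + η)
    (hs : b * x + η ≤ 7 / 30) : 2 / 3 ≤ v := by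
  have h1 : (2 / 3 : ℝ≥0∞) + 7 / 30 = 9 / 10 := by
    rw [← ENNReal.toReal_eq_toReal_iff' (by finiteness) (by finiteness),
      ENNReal.toReal_add (by finiteness) (by finiteness)]
    simp; norm_num
  rw [add_assoc] at h
  exact (ENNReal.add_le_add_iff_right (a := 7 / 30) (by finiteness)).1
    (h1.le.trans (h.trans (add_le_add le_rfl hs)))

/-- Union bound over at most `n` sizes of cliques and `n` tests for each. -/
theorem calK_true_le (h : ∀ κ, 1 ≤ κ → κ ≤ n → n ≤ κ ^ p.m → p.miss n b b₂ lam κ ≤ 2⁻¹ ^ n) :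
    p.calK n b b₂ lam true ≤ n * (n * 2⁻¹ ^ n) := by
  refine (orIter_true_le _ _).trans ((Finset.sum_le_sum fun i hi => ?_).trans_eq
    (by rw [Finset.sum_const, Finset.card_range, nsmul_eq_mul]))
  have hi' := Finset.mem_range.1 hi
  unfold Params.kapK
  split_ifs with hκ
  · simp
  · refine (orIter_true_le _ _).trans ((Finset.sum_le_sum fun _ _ => ?_).trans_eq
      (by rw [Finset.sum_const, Finset.card_range, nsmul_eq_mul]))
    rw [testK_true p (by omega)]
    exact h _ (by omega) (by omega) (not_lt.1 hκ)

/-- A stage that stops has passed `n` independent tests with size `κ`, each with the acceptance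
probability of the distinguisher on such graphs. So an unreliable stage almost never stops, although
nobody knows which stages are unreliable. -/
theorem calK_false_le {κ : ℕ} (hκ1 : 1 ≤ κ) (hκn : κ ≤ n) (hκ : n ≤ κ ^ p.m) :
    p.calK n b b₂ lam false ≤ (expect (erdosRenyiHalf n) fun G =>
      p.distK n b b₂ lam (gadj (plantClique G (initial n κ))) true) ^ n := by
  rw [Params.calK, orIter_false]
  have hmem : κ - 1 ∈ Finset.range n := Finset.mem_range.2 (by omega)
  rw [← Finset.mul_prod_erase _ _ hmem, Nat.sub_add_cancel hκ1]
  refine (mul_le_mul' le_rfl (Finset.prod_le_one' fun i _ => PMF.coe_le_one _ _)).trans ?_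
  rw [mul_one, Params.kapK, if_neg (not_lt.2 hκ), orIter_false, Finset.prod_const, Finset.card_range]
  refine pow_le_pow_left₀ zero_le (le_of_eq ?_) _
  have h1 := true_add_false (p.testK n b b₂ lam κ)
  have h2 : p.miss n b b₂ lam κ + (expect (erdosRenyiHalf n) fun G =>
      p.distK n b b₂ lam (gadj (plantClique G (initial n κ))) true) = 1 := by
    rw [Params.miss, ← expect_add, ← expect_const (erdosRenyiHalf n) 1]
    congr 1; ext1 G
    rw [add_comm, true_add_false]
  rw [testK_true p hκn, ← h2] at h1
  refine (ENNReal.add_right_inj ?_).1 h1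
  intro htop
  rw [htop] at h2; simp at h2

/-- The answer on a graph with a planted clique. -/
theorem two_thirds_le_planted {κ j : ℕ} {η : ℝ≥0∞} (hn : n ≤ 2 ^ b) (hκ1 : 1 ≤ κ) (hκn : κ ≤ n)
    (hκ : n ≤ κ ^ p.m) (hlast : p.calK n b b₂ (j + 1) true ≤ η)
    (hs : (j + 1 : ℕ) * (9 / 10) ^ n + η ≤ 7 / 30) :
    2 / 3 ≤ expect (plantedClique n κ) fun G =>
      p.value n b b₂ (gadj G) (fun r => if r then 1 else 0) (j + 1) 0 := by
  refine two_thirds_le_of_le ?_ hs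
  push_cast
  refine le_expect_value p _ _ j 0 (fun i _ => ?_) (by simpa using hlast)
  have hψ : ∀ μ : PMF Bool, expect μ (fun r => if r then 1 else 0) = μ true := fun μ => by
    unfold expect; rw [tsum_bool]; simp
  simp only [hψ]
  rw [expect_plantedClique_distK p hn hκn]
  -- A stage either accepts planted cliques with probability at least `9 / 10`, or it stops with
  -- probability at most `(9 / 10) ^ n`.
  by_cases h : 9 / 10 ≤ expect (erdosRenyiHalf n) fun G =>
      p.distK n b b₂ (0 + i + 1) (gadj (plantClique G (initial n κ))) true
  · exact (mul_le_mul' le_rfl h).trans le_self_add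
  · refine le_trans ?_ le_add_self
    refine (mul_le_mul' (calK_false_le p hκ1 hκn hκ) ?_).trans ((mul_one _).le.trans
      (pow_le_pow_left₀ zero_le (not_le.1 h).le _))
    refine ENNReal.div_le_of_le_mul ?_; norm_num

/-- The answer on a random graph. -/
theorem two_thirds_le_random {j : ℕ} {η : ℝ≥0∞} (hn : n ≤ 2 ^ b) (hd : p.d = p.a + 8)
    (hqb : b₂ * (b₂ + 1) ≤ b) (hb : (b * b) ^ p.d ≤ 2 ^ b) (hb2 : 2 ≤ b) (hj : j + 1 ≤ b)
    (hlast : p.calK n b b₂ (j + 1) true ≤ η) (hs : (j + 1 : ℕ) * (9 / 10) ^ n + η ≤ 7 / 30) :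
    2 / 3 ≤ expect (erdosRenyiHalf n) fun G =>
      p.value n b b₂ (gadj G) (fun r => if r then 0 else 1) (j + 1) 0 := by
  refine two_thirds_le_of_le ?_ hs
  push_cast
  refine le_expect_value p _ _ j 0 (fun i hi => ?_) (by simpa using hlast)
  have hψ : ∀ μ : PMF Bool, expect μ (fun r => if r then 0 else 1) = μ false := fun μ => by
    unfold expect; rw [tsum_bool]; simp
  simp only [hψ]
  -- The tests play no role here: on random graphs every stage is reliable, whatever `A` does.
  refine le_trans (mul_le_mul' le_rfl ?_) le_self_add
  have h1 := expect_distK_le p (n := n) (b₂ := b₂) (lam := 0 + i + 1) hd (by omega) (by omega) hqb hb hn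
  have h2 : (expect (erdosRenyiHalf n) fun G => p.distK n b b₂ (0 + i + 1) (gadj G) false) +
      (expect (erdosRenyiHalf n) fun G => p.distK n b b₂ (0 + i + 1) (gadj G) true) = 1 := by
    rw [← expect_add, ← expect_const (erdosRenyiHalf n) 1]
    congr 1; ext1 G
    rw [add_comm, true_add_false]
  have h3 : (2⁻¹ : ℝ≥0∞) ^ (2 * b) ≤ 1 / 10 := by
    refine (pow_le_pow_right_of_le_one' (by simp) (show 4 ≤ 2 * b by omega)).trans ?_
    rw [← ENNReal.inv_pow, one_div, ENNReal.inv_le_inv]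
    norm_num
  have h4 : (9 / 10 : ℝ≥0∞) + 1 / 10 = 1 := by
    rw [ENNReal.div_add_div_same]; norm_num
    exact ENNReal.div_self (by simp) (by simp)
  refine (ENNReal.add_le_add_iff_right (a := 1 / 10) (by finiteness)).1 ?_
  exact (h4.trans h2.symm).le.trans (add_le_add le_rfl (h1.trans h3))

/-- The bound holds for every underlying graph, as the planted clique alone makes the distinguisher
accept. `finProdFinEquiv` cuts its vertices into `q + 1` parts of size `κ / (q + 1)`. -/
theorem miss_le {f : ℕ → ℕ} {c : ℕ} {g : ℕ → ℝ} {q κ : ℕ}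
    (hA : ApproximatesSteinerForest p.A (fun I => f I.k * I.encode.size ^ c) g)
    (hd : p.d = p.a + 8) (hlam : 1 ≤ lam)
    (hq : 1 ≤ q) (hqb : q ≤ b₂) (hN : 32 ≤ p.num b lam) (hkN : q * (q + 1) ≤ p.num b lam)
    (hT : f (q * (q + 1)) * (p.num b lam ^ 3) ^ c ≤ p.num b lam ^ p.e)
    (hg : 2 * p.d * b * (|g (q * (q + 1))| * (q + 1)) ≤ (q * (q + 1) * lam : ℝ))
    (hκ : 4 * (q + 1) * (2 ^ b) ^ 8 ≤ (κ / (q + 1)) ^ p.d) (hn : n ≤ 2 ^ b) (hκn : κ ≤ n) :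
    p.miss n b b₂ lam κ ≤ 2⁻¹ ^ n := by
  rw [Params.miss, ← expect_const (erdosRenyiHalf n) (2⁻¹ ^ n)]
  refine expect_mono _ fun G => ?_
  have hle : (q + 1) * (κ / (q + 1)) ≤ κ := Nat.mul_div_le _ _
  refine distK_false_le p hq hqb (half_le_roundK p hA hd hlam hq hN hkN hT hg hκ (gadj_self _)
    (y := fun u => Fin.castLE (hle.trans (hκn.trans hn)) (finProdFinEquiv u)) ?_ ?_)
  · intro u v h
    exact finProdFinEquiv.injective (Fin.castLE_injective _ h)
  · intro u v huv
    rw [gadj_eq_true]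
    have h1 := (finProdFinEquiv u).2
    have h2 := (finProdFinEquiv v).2
    refine ⟨by rw [Fin.val_castLE]; omega, by rw [Fin.val_castLE]; omega,
      plantClique_adj.2 (.inr ⟨fun h => huv ?_, ?_, ?_⟩)⟩
    · have := congrArg Fin.val h
      exact finProdFinEquiv.injective (Fin.ext this)
    · simp only [initial, Finset.mem_filter, Finset.mem_univ, true_and, Fin.val_castLE]; omega
    · simp only [initial, Finset.mem_filter, Finset.mem_univ, true_and, Fin.val_castLE]; omega

/-- The reason for `d = 16 * m`: here `κ ^ (16 * m) ≥ n ^ 16`, while `B ^ 8` is of order `n ^ 8`.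
The spare `n ^ 8` absorbs all factors that depend on `q` and `m` only, including the loss from
rounding `κ / (q + 1)`. -/
theorem part_large {q κ m B : ℕ} (hB : B ≤ 2 * n) (hκ : n ≤ κ ^ m)
    (hn : 4 * (q + 1) * 2 ^ 8 * (2 * (q + 1)) ^ (16 * m) < n) :
    4 * (q + 1) * B ^ 8 ≤ (κ / (q + 1)) ^ (16 * m) := by
  have hκq : q + 1 ≤ κ := by
    by_contra hlt
    have h1 : κ ^ m ≤ (2 * (q + 1)) ^ (16 * m) :=
      (Nat.pow_le_pow_left (by omega) m).trans (Nat.pow_le_pow_right (by omega) (by omega))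
    have h2 : 1 * (2 * (q + 1)) ^ (16 * m) ≤ 4 * (q + 1) * 2 ^ 8 * (2 * (q + 1)) ^ (16 * m) :=
      Nat.mul_le_mul_right _ (by omega)
    omega
  have h0 : κ ≤ 2 * (q + 1) * (κ / (q + 1)) := by
    have h1 := Nat.div_add_mod κ (q + 1)
    have h2 := Nat.mod_lt κ (show 0 < q + 1 by omega)
    have h3 : 1 ≤ κ / (q + 1) := (Nat.one_le_div_iff (by omega)).2 hκq
    have h4 : (q + 1) * 1 ≤ (q + 1) * (κ / (q + 1)) := Nat.mul_le_mul_left _ h3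
    have h5 : 2 * (q + 1) * (κ / (q + 1)) = 2 * ((q + 1) * (κ / (q + 1))) := by ring
    omega
  have hpos : 0 < (2 * (q + 1)) ^ (16 * m) := by positivity
  refine Nat.le_of_mul_le_mul_left ?_ hpos
  calc (2 * (q + 1)) ^ (16 * m) * (4 * (q + 1) * B ^ 8)
      ≤ (2 * (q + 1)) ^ (16 * m) * (4 * (q + 1) * (2 * n) ^ 8) := by gcongr
    _ = (4 * (q + 1) * 2 ^ 8 * (2 * (q + 1)) ^ (16 * m)) * n ^ 8 := by ring
    _ ≤ n ^ 8 * n ^ 8 := by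
        gcongr; exact hn.le.trans (Nat.le_self_pow (by norm_num) _)
    _ = n ^ 16 := by ring
    _ ≤ (κ ^ m) ^ 16 := by gcongr
    _ = κ ^ (16 * m) := by rw [← pow_mul, mul_comm]
    _ ≤ (2 * (q + 1) * (κ / (q + 1))) ^ (16 * m) := by gcongr
    _ = _ := by rw [mul_pow]

end Answer

end RandWhile

namespace RandWhile

open Filter

/-! ### Asymptotics -/

section Asymptotics

theorem tendsto_clog : Tendsto (Nat.clog 2) atTop atTop := by
  refine tendsto_atTop.2 fun C => ?_
  filter_upwards [eventually_ge_atTop (2 ^ C)] with n hn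
  have := Nat.clog_mono_right 2 hn
  rwa [Nat.clog_pow _ _ (by norm_num)] at this

theorem eventually_pow_le_two_pow (d : ℕ) : ∀ᶠ b : ℕ in atTop, (b * b) ^ d ≤ 2 ^ b := by
  have h := tendsto_pow_const_div_const_pow_of_one_lt (2 * d) (r := 2) (by norm_num)
  filter_upwards [h.eventually_le_const (show (0 : ℝ) < 1 by norm_num)] with b hb
  rw [div_le_one (by positivity)] at hb
  rw [← pow_two, ← pow_mul]
  exact_mod_cast hb

theorem eventually_clog_le : ∀ᶠ b : ℕ in atTop, Nat.clog 2 b * (Nat.clog 2 b + 1) ≤ b := by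
  filter_upwards [tendsto_clog.eventually_ge_atTop 7, eventually_ge_atTop 2] with b hb h2
  have h1 := Nat.pow_pred_clog_lt_self (b := 2) (by norm_num) (x := b) (by omega)
  refine le_trans ?_ h1.le
  generalize Nat.clog 2 b = x at hb
  induction x, hb using Nat.le_induction with
  -- The base case is `7 * 8 ≤ 2 ^ 6`; with `6` in place of `7` the inequality fails.
  | base => norm_num
  | succ x hx ih =>
    rw [Nat.pred_eq_sub_one] at ih
    rw [Nat.pred_eq_sub_one, show x + 1 - 1 = (x - 1) + 1 by omega, pow_succ]
    nlinarith

theorem eventually_error_le : ∀ᶠ n : ℕ in atTop,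
    (n : ℝ≥0∞) * (9 / 10) ^ n + n * (n * 2⁻¹ ^ n) ≤ 7 / 30 := by
  have h1 := tendsto_pow_const_mul_const_pow_of_abs_lt_one 1 (r := 9 / 10)
    (by rw [abs_of_pos] <;> norm_num)
  have h2 := tendsto_pow_const_mul_const_pow_of_abs_lt_one 2 (r := 2⁻¹)
    (by rw [abs_of_pos] <;> norm_num)
  have h3 := h1.add h2
  rw [add_zero] at h3
  filter_upwards [h3.eventually_le_const (show (0 : ℝ) < 7 / 30 by norm_num)] with n hn
  rw [← ENNReal.toReal_le_toReal (by finiteness) (by finiteness),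
    ENNReal.toReal_add (by finiteness) (by finiteness)]
  simp only [ENNReal.toReal_mul, ENNReal.toReal_pow, ENNReal.toReal_natCast, ENNReal.toReal_div,
    ENNReal.toReal_ofNat, ENNReal.toReal_inv]
  rw [← mul_assoc, ← pow_two]
  rwa [pow_one] at hn

theorem clog_le_log {n : ℕ} (hn : 3 ≤ n) : (Nat.clog 2 n : ℝ) ≤ 3 * Real.log n := by
  have hn' : (3 : ℝ) ≤ n := by exact_mod_cast hn
  have h1 := Nat.pow_pred_clog_lt_self (b := 2) (by norm_num) (x := n) (by omega)
  have hc : 1 ≤ Nat.clog 2 n := Nat.clog_pos (by norm_num) (by omega)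
  have h2 : ((2 : ℝ) ^ (Nat.clog 2 n - 1)) ≤ n := by exact_mod_cast h1.le
  have h3 := Real.log_le_log (by positivity) h2
  rw [Real.log_pow, Nat.cast_sub hc, Nat.cast_one] at h3
  have h4 := Real.log_two_gt_d9
  have h5 : 1 ≤ Real.log n := by
    rw [Real.le_log_iff_exp_le (by linarith)]
    exact (Real.exp_one_lt_d9.le.trans (by norm_num)).trans hn'
  have h6 : (0 : ℝ) ≤ Nat.clog 2 n - 1 := by
    have : (1 : ℝ) ≤ Nat.clog 2 n := by exact_mod_cast hc
    linarith
  nlinarith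

/-- `2 ^ (E * b * ⌈ε' * b⌉)` is at most `n ^ (ε * log n)` for `b = ⌈log₂ n⌉` and small `ε'`. -/
theorem two_pow_le_floor {n E b : ℕ} {ε ε' : ℝ} (hn : 3 ≤ n) (hbn : b = Nat.clog 2 n) (hε' : 0 < ε')
    (hb : 1 ≤ ε' * b) (h : 18 * E * ε' ≤ ε) :
    2 ^ (E * b * ⌈ε' * b⌉₊) ≤ ⌊(n : ℝ) ^ (ε * Real.log n)⌋₊ := by
  have hn' : (0 : ℝ) < n := by exact_mod_cast (by omega : 0 < n)
  have hlog := clog_le_log hn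
  rw [← hbn] at hlog
  have hlam : (⌈ε' * b⌉₊ : ℝ) ≤ 2 * ε' * b := by
    have := (Nat.ceil_lt_add_one (show 0 ≤ ε' * b by positivity)).le
    linarith
  refine Nat.le_floor ?_
  rw [Real.rpow_def_of_pos hn', Nat.cast_pow, ← Real.rpow_natCast,
    Real.rpow_def_of_pos (by norm_num)]
  refine Real.exp_le_exp.2 ?_
  push_cast
  have h2 : Real.log 2 ≤ 1 := by have := Real.log_two_lt_d9; linarith
  calc Real.log 2 * (E * b * ⌈ε' * b⌉₊) ≤ 1 * (E * b * (2 * ε' * b)) := by gcongr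
    _ = 2 * E * ε' * (b * b) := by ring
    _ ≤ 2 * E * ε' * ((3 * Real.log n) * (3 * Real.log n)) := by gcongr
    _ = 18 * E * ε' * (Real.log n * Real.log n) := by ring
    _ ≤ ε * (Real.log n * Real.log n) := by
        gcongr
    _ = Real.log n * (ε * Real.log n) := by ring

theorem ceil_rpow_bounds {δ : ℝ} {m n : ℕ} (hδ : 0 < δ) (hδ' : δ < 1 / 2) (hm : 1 ≤ δ * m)
    (hn : 1 ≤ n) : 1 ≤ ⌈(n : ℝ) ^ δ⌉₊ ∧ ⌈(n : ℝ) ^ δ⌉₊ ≤ n ∧ n ≤ ⌈(n : ℝ) ^ δ⌉₊ ^ m := by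
  have hn' : (1 : ℝ) ≤ n := by exact_mod_cast hn
  refine ⟨Nat.one_le_ceil_iff.2 (by positivity), Nat.ceil_le.2 ?_, ?_⟩
  · exact (Real.rpow_le_rpow_of_exponent_le hn' (by linarith : δ ≤ 1)).trans_eq (Real.rpow_one _)
  · have h1 : (n : ℝ) ≤ ((n : ℝ) ^ δ) ^ m := by
      rw [← Real.rpow_mul_natCast (by positivity)]
      exact (Real.rpow_one _).symm.le.trans (Real.rpow_le_rpow_of_exponent_le hn' hm)
    have h2 : ((n : ℝ) ^ δ) ^ m ≤ (⌈(n : ℝ) ^ δ⌉₊ : ℝ) ^ m := by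
      gcongr; exact Nat.le_ceil _
    exact_mod_cast h1.trans h2

/-- Diagonalization over the constants in the exponent. -/
theorem exists_isLittleO_log {Q : ℕ → ℝ → Prop}
    (h : ∀ ε > 0, ∀ᶠ n in atTop, Q n (ε * Real.log n)) :
    ∃ e : ℕ → ℝ, (e =o[atTop] fun n : ℕ => Real.log n) ∧ ∀ᶠ n in atTop, Q n (e n) := by
  have h' : ∀ k : ℕ, ∃ N, ∀ n ≥ N, Q n (1 / (k + 1) * Real.log n) := fun k =>
    eventually_atTop.1 (h _ (by positivity))
  choose N hN using h'
  -- The constant `1 / (k + 1)` comes into use once its threshold `N k` is passed; the cap `n` makes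
  -- the search finite.
  let k : ℕ → ℕ := fun n => Nat.findGreatest (fun k => N k ≤ n) n
  have hk : Tendsto k atTop atTop := by
    refine tendsto_atTop.2 fun K => ?_
    filter_upwards [eventually_ge_atTop K, eventually_ge_atTop (N K)] with n h1 h2
    exact Nat.le_findGreatest h1 h2
  refine ⟨fun n => 1 / (k n + 1) * Real.log n, ?_, ?_⟩
  · have h1 : (fun n => (1 / (k n + 1) : ℝ)) =o[atTop] fun _ => (1 : ℝ) :=
      (Asymptotics.isLittleO_one_iff ℝ).2 (tendsto_one_div_add_atTop_nhds_zero_nat.comp hk)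
    simpa using h1.mul_isBigO (Asymptotics.isBigO_refl (fun n : ℕ => Real.log n) atTop)
  · filter_upwards [eventually_ge_atTop (N 0)] with n hn
    exact hN _ _ (Nat.findGreatest_spec (P := fun k => N k ≤ n) (Nat.zero_le n) hn)

/-- Since `√(q * (q + 1)) ≤ q + 1`, a function in `o(√k)` is eventually below any multiple of `q +
1` at `k = q * (q + 1)`. This is the only place where the growth of `g` enters. -/
theorem exists_small_ratio {g : ℕ → ℝ} (hg : g =o[atTop] fun k : ℕ => √(k : ℝ)) {η : ℝ}
    (hη : 0 < η) : ∃ q, 1 ≤ q ∧ |g (q * (q + 1))| ≤ η * (q + 1) := by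
  have h := hg.bound hη
  obtain ⟨K, hK⟩ := eventually_atTop.1 h
  refine ⟨K + 1, by omega, ?_⟩
  have h1 := hK ((K + 1) * (K + 1 + 1)) (by nlinarith)
  rw [Real.norm_eq_abs, Real.norm_eq_abs, abs_of_nonneg (Real.sqrt_nonneg _)] at h1
  refine h1.trans (mul_le_mul_of_nonneg_left ?_ hη.le)
  refine Real.sqrt_le_iff.2 ⟨by positivity, ?_⟩
  push_cast
  nlinarith

end Asymptotics

/-! ### The running time -/

section Time

variable (p : Params)

/-- One bound, made for stage `lam'`, serves all earlier stages. Its exponent adds up `2 * a` for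
the square of `num`, `a * e` for the clock, `m` for the powers of `n` and `2` for everything else.
-/
theorem Params.budget {n b b₂ lam lam' : ℕ} (hlam : 1 ≤ lam) (hl : lam ≤ lam') (hl' : lam' ≤ b)
    (hn : n ≤ 2 ^ b) (hb₂ : b₂ * (b₂ + 1) ≤ b) (h32 : 32 ≤ b) (hd : 2 * p.d ≤ b) (ha : p.a ≤ b)
    (hA : p.A.cost + 2 * p.A.vb + 10 ≤ b) (he : p.e + 1 ≤ b) (hm : p.m + 1 ≤ b)
    (hbb : b * b ≤ 2 ^ b) :
    p.Budget n b b₂ lam (2 ^ ((2 * p.a + p.a * p.e + p.m + 2) * b * lam')) := by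
  have hbl : b * 1 ≤ b * lam' := Nat.mul_le_mul_left _ (hlam.trans hl)
  set E := 2 * p.a + p.a * p.e + p.m + 2 with hE
  have hexp : ∀ i, i ≤ E → i * (b * lam') ≤ E * b * lam' := fun i hi => by
    rw [mul_assoc]; exact Nat.mul_le_mul_right _ hi
  have h2 := hexp 2 (by omega)
  have hZ : b * b ≤ 2 ^ (E * b * lam') :=
    hbb.trans (Nat.pow_le_pow_right (by norm_num) (by omega))
  have hbb1 : b * 1 ≤ b * b := Nat.mul_le_mul_left _ (by omega)
  have hnum : p.num b lam ≤ 2 ^ (p.a * (b * lam')) := by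
    unfold Params.num
    refine Nat.pow_le_pow_right (by norm_num) ?_
    rw [show b * (p.a * lam) = p.a * (b * lam) by ring]
    exact Nat.mul_le_mul_left _ (Nat.mul_le_mul_left _ hl)
  have hlb : lam ≤ b := hl.trans hl'
  have hb₂' : b₂ ≤ b := (Nat.le_mul_of_pos_right _ (by omega)).trans hb₂
  refine ⟨by omega, by omega, ?_, by omega, ?_, ?_, ?_, by omega, ?_, ?_, by omega, by omega, ?_,
    by omega, ?_, ?_, by omega, ?_⟩
  · exact (Nat.mul_le_mul_right _ hd).trans hZ
  · exact (Nat.mul_le_mul ha hlb).trans hZ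
  · exact (Nat.mul_le_mul (by omega) hlb).trans hZ
  · exact Nat.pow_le_pow_right (by norm_num) (by omega)
  · refine (Nat.mul_le_mul hnum hnum).trans ?_
    rw [← pow_add]
    refine Nat.pow_le_pow_right (by norm_num) ?_
    have := hexp (2 * p.a) (by omega)
    rw [show 2 * p.a * (b * lam') = p.a * (b * lam') + p.a * (b * lam') by ring] at this
    exact this
  · intro i hi
    have h1 : p.num b lam ^ i ≤ 2 ^ (p.a * p.e * (b * lam')) := by
      refine (Nat.pow_le_pow_left hnum i).trans ?_
      rw [← pow_mul]
      refine Nat.pow_le_pow_right (by norm_num) ?_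
      rw [show p.a * p.e * (b * lam') = p.a * (b * lam') * p.e by ring]
      exact Nat.mul_le_mul_left _ hi
    have h3 : 1 ≤ 2 ^ (p.a * p.e * (b * lam')) := Nat.one_le_two_pow
    refine le_trans (show _ ≤ 2 ^ (p.a * p.e * (b * lam') + 1) by rw [pow_succ]; omega) ?_
    refine Nat.pow_le_pow_right (by norm_num) ?_
    have := hexp (p.a * p.e + 1) (by omega)
    rw [add_mul, one_mul] at this
    omega
  · have : b₂ + 1 ≤ b * b := by nlinarith
    exact this.trans hZ
  · exact (Nat.mul_le_mul hb₂ hlb).trans hZ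
  · refine le_trans (show _ ≤ 2 ^ (b + 1) by rw [pow_succ]; omega)
      (Nat.pow_le_pow_right (by norm_num) (by omega))
  · intro i hi
    refine (Nat.pow_le_pow_left hn i).trans ?_
    rw [← pow_mul]
    refine Nat.pow_le_pow_right (by norm_num) ?_
    refine le_trans ?_ (hexp p.m (by omega))
    rw [mul_comm]
    exact Nat.mul_le_mul hi (by omega)

theorem time_le {j Z : ℕ} (hZ : 32 ≤ Z) (hj : j ≤ Z) : j * (Z ^ 46 + 1) + Z ^ 12 ≤ Z ^ 48 := by
  have h1 : 1 ≤ Z ^ 46 := Nat.one_le_pow _ _ (by omega)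
  have h2 : Z ^ 12 ≤ Z ^ 47 := Nat.pow_le_pow_right (by omega) (by norm_num)
  calc j * (Z ^ 46 + 1) + Z ^ 12 ≤ Z * (Z ^ 46 + Z ^ 46) + Z ^ 47 := by gcongr
    _ = 3 * Z ^ 47 := by ring
    _ ≤ Z * Z ^ 47 := Nat.mul_le_mul_right _ (by omega)
    _ = Z ^ 48 := by ring

end Time

/-! ### Correctness of the algorithm within time `n ^ (ε * log n)` -/

section Solve

variable (p : Params) {n : ℕ}

theorem le_toOuterMeasure_bind (μ : PMF (SimpleGraph (Fin n))) (j : ℕ) {T Z b b₂ : ℕ}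
    (hbn : b = Nat.clog 2 n) (hbb : b₂ = Nat.clog 2 b) (hn : 2 * n ≤ Z) (hb : 2 * b ≤ Z)
    (hB : ∀ i < j, p.Budget n b b₂ (i + 1) Z)
    (hZ : 32 ≤ Z) (S : Set BTree) (ψ : Bool → ℝ≥0∞)
    (hψ : ∀ r, ψ r ≤ S.indicator (fun _ => 1) (.ofBool r)) (hT : j * (Z ^ 46 + 1) + Z ^ 12 ≤ T) :
    expect μ (fun G => p.value n b b₂ (gadj G) ψ j 0) ≤
      (μ.bind fun G => outputWithin (mainP p) T (encodeGraph G)).toOuterMeasure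
        {o | ∃ y, o = some y ∧ y ∈ S} := by
  classical
  subst hbb hbn
  rw [← expect_indicator, expect_bind]
  refine expect_mono _ fun G => ?_
  rw [expect_indicator, ← adjK_encodeGraph]
  let L : List BTree := List.ofFn fun i : Fin n => .ofList (List.ofFn fun j : Fin n =>
    .ofBool (decide (G.Adj i j)))
  have hL : encodeGraph G = .ofList L := rfl
  have hlen : L.length = n := List.length_ofFn
  have h := value_le_outputWithin (p := p) L j (Z := Z) (T := T)
  rw [hlen, ← hL] at h
  exact h hn hb hB hZ S ψ hψ hT

/-- For every `ε > 0` the algorithm needs at most `n ^ (ε * log n)` steps. -/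
theorem eventually_solves {f : ℕ → ℕ} {c : ℕ} {g : ℕ → ℝ} {δ ε : ℝ}
    (hA : ApproximatesSteinerForest p.A (fun I => f I.k * I.encode.size ^ c) g)
    (hg : g =o[atTop] fun k : ℕ => √(k : ℝ)) (hδ : 0 < δ) (hδ' : δ < 1 / 2) (hmδ : 1 ≤ δ * p.m)
    (hm1 : 1 ≤ p.m) (hd : p.d = 16 * p.m) (ha : p.d = p.a + 8) (he : p.e = 3 * c + 1) (hε : 0 < ε) :
    ∀ᶠ n : ℕ in atTop,
      2 / 3 ≤ ((plantedClique n ⌈(n : ℝ) ^ δ⌉₊).bind fun G =>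
        outputWithin (mainP p) ⌊(n : ℝ) ^ (ε * Real.log n)⌋₊ (encodeGraph G)).toOuterMeasure
          {o | o = some (BTree.ofBool true)} ∧
      2 / 3 ≤ ((erdosRenyiHalf n).bind fun G =>
        outputWithin (mainP p) ⌊(n : ℝ) ^ (ε * Real.log n)⌋₊ (encodeGraph G)).toOuterMeasure
          {o | ∃ y, o = some y ∧ y ≠ BTree.ofBool true} := by
  set E := 2 * p.a + p.a * p.e + p.m + 2 with hE
  have hE0 : (0 : ℝ) < E := by positivity
  have hd0 : (0 : ℝ) < p.d := by exact_mod_cast (by omega : 0 < p.d)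
  -- `ε'` is the ratio `lam / b` by which the algorithm almost surely stops. The factor `48` is the
  -- exponent in `time_le`, and `18` comes from `two_pow_le_floor`.
  obtain ⟨ε', hε', hε'2, hε'E⟩ : ∃ ε' : ℝ, 0 < ε' ∧ ε' ≤ 1 / 2 ∧ 18 * ((48 * E : ℕ) : ℝ) * ε' ≤ ε := by
    refine ⟨min (1 / 2) (ε / (18 * (48 * E : ℕ))), by positivity, min_le_left _ _, ?_⟩
    refine (mul_le_mul_of_nonneg_left (min_le_right _ _) (by positivity)).trans_eq ?_
    field_simp
  -- `q` does not depend on `n`, so `f (q * (q + 1))` is a constant. The program does not know `q`,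
  -- but it tries all values up to `b₂`, which tends to infinity.
  obtain ⟨q, hq, hgq⟩ := exists_small_ratio hg (η := ε' / (4 * p.d)) (by positivity)
  have hb := tendsto_clog
  filter_upwards [hb.eventually (eventually_pow_le_two_pow p.d), hb.eventually eventually_clog_le,
    hb.eventually_ge_atTop (32 + 2 * p.d + p.a + (p.A.cost + 2 * p.A.vb + 10) + (p.e + 1) + (p.m + 1)
      + q * (q + 1) + 2 ^ q),
    hb.eventually (tendsto_natCast_atTop_atTop.eventually_ge_atTop (1 / ε')), eventually_error_le,
    eventually_gt_atTop (3 + 4 * (q + 1) * 2 ^ 8 * (2 * (q + 1)) ^ (16 * p.m) + f (q * (q + 1)))]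
    with n hbd hb₂ hbC hbε herr hnC
  obtain ⟨b, hbdef⟩ : ∃ b, b = Nat.clog 2 n := ⟨_, rfl⟩
  obtain ⟨b₂, hb₂def⟩ : ∃ b₂, b₂ = Nat.clog 2 b := ⟨_, rfl⟩
  rw [← hbdef] at hbd hb₂ hbC hbε
  rw [← hb₂def] at hb₂
  have h2q : 1 ≤ 2 ^ q := Nat.one_le_two_pow
  have hn2 : n ≤ 2 ^ b := hbdef ▸ Nat.le_pow_clog (by norm_num) n
  have h2n : 2 ^ b ≤ 2 * n := by
    have h1 := Nat.pow_pred_clog_lt_self (b := 2) (by norm_num) (x := n) (by omega)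
    rw [Nat.pred_eq_sub_one, ← hbdef] at h1
    have : 2 ^ b = 2 ^ (b - 1) * 2 := by rw [← pow_succ, Nat.sub_add_cancel (by omega)]
    omega
  have hbb : b * b ≤ 2 ^ b := (Nat.le_self_pow (by omega) _).trans hbd
  have hbn : b ≤ n := by
    have h1 : 32 * b ≤ b * b := Nat.mul_le_mul_right _ (by omega)
    omega
  have hεb : 1 ≤ ε' * b := by rwa [div_le_iff₀ hε', mul_comm] at hbε
  -- The last stage that the time bound allows for; later answers are not counted.
  set lam := ⌈ε' * b⌉₊ with hlamdef
  have hlam1 : 1 ≤ lam := Nat.one_le_ceil_iff.2 (by linarith)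
  have hlamb : lam ≤ b := by
    refine Nat.ceil_le.2 ?_
    have : (0 : ℝ) ≤ b := Nat.cast_nonneg _
    nlinarith
  obtain ⟨j, hj⟩ : ∃ j, lam = j + 1 := ⟨lam - 1, by omega⟩
  set Z := 2 ^ (E * b * lam) with hZdef
  have hB : ∀ i < lam, p.Budget n b b₂ (i + 1) Z := fun i hi =>
    p.budget (by omega) hi hlamb hn2 hb₂ (by omega) (by omega) (by omega) (by omega) (by omega)
      (by omega) hbb
  have hBlast := hB 0 (by omega)
  have hT : lam * (Z ^ 46 + 1) + Z ^ 12 ≤ ⌊(n : ℝ) ^ (ε * Real.log n)⌋₊ := by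
    refine (time_le hBlast.hZ (by have := hBlast.hdl; have := (hB j (by omega)).hlam; omega)).trans ?_
    rw [hZdef, ← pow_mul, show E * b * lam * 48 = 48 * E * b * lam by ring]
    exact two_pow_le_floor (by omega) hbdef hε' hεb hε'E
  have hnum : 2 ^ b ≤ p.num b lam := by
    unfold Params.num
    refine Nat.pow_le_pow_right (by norm_num) ?_
    exact Nat.le_mul_of_pos_right _ (Nat.mul_pos (by omega) hlam1)
  have hb2b : b ≤ 2 ^ b := Nat.lt_two_pow_self.le
  have hmiss : ∀ κ, 1 ≤ κ → κ ≤ n → n ≤ κ ^ p.m → p.miss n b b₂ lam κ ≤ 2⁻¹ ^ n := by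
    intro κ _ hκn hκ
    refine miss_le p hA ha hlam1 hq (q := q) ?_ (by omega) (by omega) ?_ ?_ ?_ hn2 hκn
    · have := Nat.clog_mono_right 2 (show 2 ^ q ≤ b by omega)
      rwa [Nat.clog_pow _ _ (by norm_num), ← hb₂def] at this
    -- In the clock `num ^ (3 * c + 1)` the part `num ^ (3 * c)` covers the size of the instance,
    -- and the last factor exceeds the constant `f (q * (q + 1))`, as `num ≥ 2 ^ b ≥ n`.
    · rw [he, ← pow_mul, pow_succ, mul_comm]
      exact Nat.mul_le_mul_left _ (by omega)
    · have hlam' : ε' * b ≤ lam := Nat.le_ceil _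
      have hq' : (1 : ℝ) ≤ q := by exact_mod_cast hq
      calc 2 * p.d * b * (|g (q * (q + 1))| * (q + 1))
          ≤ 2 * p.d * b * (ε' / (4 * p.d) * (q + 1) * (q + 1)) := by gcongr
        _ = (ε' * b) * ((q + 1) * ((q + 1) / 2)) := by field_simp; ring
        -- Uses `(q + 1) / 2 ≤ q`, which is where `q ≥ 1` matters.
        _ ≤ lam * ((q + 1) * q) := by gcongr; linarith
        _ = _ := by ring
    · rw [hd]
      exact part_large h2n hκ (by omega)
  have hcal : p.calK n b b₂ (j + 1) true ≤ n * (n * 2⁻¹ ^ n) := calK_true_le p (by rwa [← hj])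
  have hs : ((j + 1 : ℕ) : ℝ≥0∞) * (9 / 10) ^ n + n * (n * 2⁻¹ ^ n) ≤ 7 / 30 := by
    refine le_trans ?_ herr
    gcongr
    omega
  obtain ⟨hκ1, hκn, hκ⟩ := ceil_rpow_bounds hδ hδ' hmδ (show 1 ≤ n by omega)
  have hbZ : 2 * b ≤ Z := le_trans (by have := Nat.mul_le_mul_right b (show 2 ≤ b by omega); omega)
    (hbb.trans hBlast.hb)
  constructor
  · refine (two_thirds_le_planted p hn2 hκ1 hκn hκ hcal hs).trans ?_
    rw [← hj]
    refine (le_toOuterMeasure_bind p _ lam hbdef hb₂def hBlast.hn hbZ hB hBlast.hZ {BTree.ofBool true} _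
      (fun r => ?_) hT).trans (le_of_eq ?_)
    · cases r <;> simp
    · congr 1; ext o; simp
  · refine (two_thirds_le_random p hn2 ha hb₂ hbd (by omega) (by omega) hcal hs).trans ?_
    rw [← hj]
    refine le_toOuterMeasure_bind p _ lam hbdef hb₂def hBlast.hn hbZ hB hBlast.hZ {y | y ≠ BTree.ofBool true} _
      (fun r => ?_) hT
    cases r
    · rw [Set.indicator_of_mem (by simp [BTree.ofBool])]; simp
    · simp

end Solve

end RandWhile

theorem mainTheorem8 (hSPCH : StrongishPlantedCliqueHypothesis) :
    ¬ ∃ (A : RandWhile.Program) (f : ℕ → ℕ) (c : ℕ) (g : ℕ → ℝ),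
      (g =o[Filter.atTop] fun k : ℕ => √(k : ℝ)) ∧
      ApproximatesSteinerForest A (fun I => f I.k * I.encode.size ^ c) g := by
  rintro ⟨A, f, c, g, hg, hA⟩
  obtain ⟨δ, hδ, hδ', hno⟩ := hSPCH
  have hm : 0 < ⌈1 / δ⌉₊ := Nat.ceil_pos.2 (by positivity)
  have hmδ : 1 ≤ δ * (⌈1 / δ⌉₊ : ℝ) := by
    have := Nat.le_ceil (1 / δ)
    rwa [div_le_iff₀ hδ, mul_comm] at this
  -- As `m ≥ 1 / δ`, the size `⌈n ^ δ⌉` is among those tested, and `δ` itself need not be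
  -- computable. `d = 16 * m` is what `part_large` needs, the difference `d - a = 8` drives both the
  -- union bounds and the hitting of the parts, and `e = 3 * c + 1` covers the running time of `A`
  -- on instances of size at most `N ^ 3`.
  let p : RandWhile.Params := ⟨A, 16 * ⌈1 / δ⌉₊, 16 * ⌈1 / δ⌉₊ - 8, 3 * c + 1, ⌈1 / δ⌉₊⟩
  let Q : ℕ → ℝ → Prop := fun n x =>
    2 / 3 ≤ ((plantedClique n ⌈(n : ℝ) ^ δ⌉₊).bind fun G =>
        RandWhile.outputWithin (RandWhile.mainP p) ⌊(n : ℝ) ^ x⌋₊ (encodeGraph G)).toOuterMeasure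
          {o | o = some (BTree.ofBool true)} ∧
    2 / 3 ≤ ((erdosRenyiHalf n).bind fun G =>
        RandWhile.outputWithin (RandWhile.mainP p) ⌊(n : ℝ) ^ x⌋₊ (encodeGraph G)).toOuterMeasure
          {o | ∃ y, o = some y ∧ y ≠ BTree.ofBool true}
  obtain ⟨e, he, hev⟩ := RandWhile.exists_isLittleO_log (Q := Q) fun ε hε =>
    RandWhile.eventually_solves p hA hg hδ hδ' hmδ hm rfl (show 16 * _ = 16 * _ - 8 + 8 by omega) rfl hε
  exact hno ⟨RandWhile.mainP p, e, he, hev⟩
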